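/- **Setting.** Let $S=\mathbb H^2/\Gamma$ be a closed orientable surface, $\widetilde S=\mathbb H^2$ its universal cover, $J=\mathbb R$ or $J=[0,\infty)$, and let $M\cong S\times J$ be a (welded) model manifold of split geometry. That is, $\widetilde M\cong\widetilde S\times J$ carries a $\Gamma$-invariant length metric $d_{wel}$ (the weld-metric), and there is a collection of welded Margulis tubes, i.e. of vertical annuli $A_T=\sigma_T\times[a_T,b_T]\subset S\times J$ with $\sigma_T$ a simple closed curve and $a_T<b_T$ in $\frac12\mathbb Z$; $T$ *splits* the level $n\in\mathbb Z\cap J$ if $n\in[a_T,b_T]$. The block $\widetilde B_i=\widetilde S\times[i,i+1]$ ($[i,i+1]\subset J$, $i \in \mathbb Z$) is a *split block* if some tube splits both levels $i$ and $i+1$, and otherwise a *thick block*. It is required that, with uniform constants: 1. each tube splits at least one and at most a bounded number of levels, and lies in the union of the split blocks; distinct lifts of tubes to $\widetilde M$ are a definite distance apart; distinct tubes splitting a common level are not homotopic; 2. each $A_T$ with its induced path metric is the product of a circle of fixed length $\varepsilon_0$ and the interval $[a_T,b_T]$, and the lifts of $\sigma_T\times\{n\}$ are geodesics of the horizontal sheet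 $\widetilde S\times\{n\}$ whenever $T$ splits level $n$; 3. each horizontal sheet $\widetilde S\times\{n\}$, with its induced path metric $d_n$, is $K_0$-bi-Lipschitz to the lift of a hyperbolic metric on $S$ with diameter bounded above and injectivity radius bounded below; the sheets are uniformly embedded on a small scale ($d_n\le K_0 d_{wel}$ for pairs of points of the sheet with $d_{wel}$ at most a fixed constant), and the height $\widetilde M\to J$ is $K_0$-Lipschitz; 4. each thick block, with its induced path metric, is $K_0$-bi-Lipschitz to the product of $[i,i+1]$ with the lift of a hyperbolic metric on $S$ of bounded diameter and injectivity radius. (Split geometry also demands that split components be quasiconvex and uniformly graph-quasiconvex; this is not needed and not assumed.) In a split block the lifts of the curves $\sigma_T$ of the tubes splitting both its levels cut $\widetilde S$ into *amalgamation components* $\widetilde A$ (taken closed), and the sets $\widetilde A\times[i,i+1]$ are the *split components*. The tube-electrocuted metric $d_{tel}$ is obtained from $d_{wel}$ by putting the zero metric on the lifts of all horizontal circles $\sigma_T\times\{t\}$, $t \in [a_T,b_T]$. The *graph metric* $d_G$ is obtained from $d_{tel}$ by electrocuting every split component $\widetilde K$ (attach $\widetilde K\times[0,1]$ along $\widetilde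 K\times\{0\}$, put the zero metric on $\widetilde K\times\{1\}$, take the path pseudometric). Put $\widetilde M_H=\bigcup_{n\in\mathbb Z\cap J}\widetilde S\times\{n\}$. For a split block, $d_{Gel}(x,y)$ is the least number of crossings, by a path in $\widetilde S$ from $x$ to $y$, of the lifts that bound the amalgamation components. In a sheet $\widetilde S\times\{n\}$ of the block, an *electro-ambient quasigeodesic* from $a$ to $b$ is the following representative of an electric geodesic. It crosses the least number of lifts, passing through a sequence of components; in each of them it is a $d_n$-geodesic segment realizing the distance between the two consecutive lifts crossed (with the first and last lift replaced by the point $a$ at the beginning and the point $b$ at the end); consecutive segments are joined by the subsegment of the lift between their endpoints. **Ladder and retraction.** Let $\lambda$ be a $d_0$-geodesic segment in $\widetilde S\times\{0\}$, with endpoints $(a,0)$, $(b,0)$. For each block $\widetilde B_i$ and each $n\in\{i,i+1\}$ let $\mathcal L_{i,n}\subset\widetilde S\times\{n\}$ be a $d_n$-geodesic segment from $(a,n)$ to $(b,n)$ (equal to $\lambda$ if $n=0$) if $\widetilde B_i$ is thick, and an electro-ambient quasigeodesic from $(a,n)$ to $(b,n)$ if $\widetilde B_i$ is split. The ladder is $\mathcal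 L_\lambda=\bigcup_{i,n}\mathcal L_{i,n}$. For $x\in\widetilde S\times\{n\}$ let $\Pi_\lambda(x)$ denote any point obtained by choosing a block $\widetilde B_i$ with $n\in\{i,i+1\}$ and projecting $x$ to a nearest point of $\mathcal L_{i,n}$: nearest for $d_n$ if $\widetilde B_i$ is thick, and minimizing the pair $(d_{Gel},d_n)$ lexicographically if $\widetilde B_i$ is split. **Theorem 5.3.** For every such $M$ there is $C>0$ such that for every geodesic segment $\lambda\subset\widetilde S\times\{0\}$ a ladder $\mathcal L_\lambda$ exists and, for every such ladder, $\Pi_\lambda:\widetilde M_H\to\mathcal L_\lambda$ is defined on all of $\widetilde M_H$ and satisfies, for all $x,y\in\widetilde M_H$ and all choices of the values $\Pi_\lambda(x),\Pi_\lambda(y)$, $$d_G(\Pi_\lambda(x),\Pi_\lambda(y))\le C\,d_G(x,y)+C .$$ -/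

import Mathlib

open Set UpperHalfPlane
open scoped ENNReal NNReal MatrixGroups

noncomputable section

/-! ### Generic metric notions -/

/-- Induced path metric on a subset `A` of a metric space: the infimum of the lengths of the
continuous curves in `A` joining `x` to `y`. -/
def inducedEDist {X : Type*} [MetricSpace X] (A : Set X) (x y : X) : ℝ≥0∞ :=
  ⨅ (c : ℝ → X) (_ : ContinuousOn c (Icc 0 1) ∧ MapsTo c (Icc 0 1) A ∧ c 0 = x ∧ c 1 = y),
    eVariationOn c (Icc 0 1)

/-- Cost of one step from `x` to `y`: the distance `d x y`, or the price `w` if `x` and `y` lie in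
a common member of the collection `H`. -/
def electricStep {X : Type*} (d : X → X → ℝ≥0∞) (w : ℝ≥0∞) (H : Set (Set X)) (x y : X) : ℝ≥0∞ :=
  min (d x y) (⨅ (A ∈ H) (_ : x ∈ A ∧ y ∈ A), w)

/-- The pseudometric obtained from `d` by letting one travel inside each member of `H` at price
`w`: infimum of the costs of finite chains.

For `w = 2` and `d` a path metric this is the restriction to `X` of the path pseudometric of the
electric space, in which a copy of `A × [0,1]` is attached to `X` along `A × {0}` for
each `A ∈ H` and `A × {1}` carries the zero metric (go up, travel for free, come down).
For `w = 0` it puts the zero metric on each member of `H`. -/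
def electrocute {X : Type*} (d : X → X → ℝ≥0∞) (w : ℝ≥0∞) (H : Set (Set X)) (x y : X) : ℝ≥0∞ :=
  ⨅ (n : ℕ) (p : ℕ → X) (_ : p 0 = x ∧ p n = y),
    ∑ k ∈ Finset.range n, electricStep d w H (p k) (p (k + 1))

/-- `s` is (the image of) a geodesic segment from `u` to `v` for the distance `d`. -/
def IsGeodesicSegment {Y : Type*} (d : Y → Y → ℝ≥0∞) (s : Set Y) (u v : Y) : Prop :=
  ∃ (r : ℝ) (c : ℝ → Y), 0 ≤ r ∧ c 0 = u ∧ c r = v ∧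
    (∀ t ∈ Icc 0 r, ∀ t' ∈ Icc 0 r, d (c t) (c t') = ENNReal.ofReal |t - t'|) ∧
    s = c '' Icc 0 r

/-- `p` is a nearest point to `x` on `s` for the distance `d`. -/
def IsNearestPoint {Y : Type*} (d : Y → Y → ℝ≥0∞) (s : Set Y) (x p : Y) : Prop :=
  p ∈ s ∧ ∀ q ∈ s, d x p ≤ d x q

/-! ### Electric geometry of a surface cut along lifts of simple closed curves

`lines` is the collection of all lifts of the cutting curves, `comps` the collection of the
(closed) lifts of the amalgamation components. -/

/-- An electric path from `a` to `b`: it runs through the amalgamation components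
`A 0, …, A n` and crosses the lifts `l 1, …, l n`, where `l k` lies between `A (k-1)` and `A k`. -/
def IsElectricPath {Y : Type*} (lines comps : Set (Set Y)) (n : ℕ) (A l : ℕ → Set Y)
    (a b : Y) : Prop :=
  (∀ k ≤ n, A k ∈ comps) ∧ a ∈ A 0 ∧ b ∈ A n ∧
    ∀ k < n, l (k + 1) ∈ lines ∧ l (k + 1) ⊆ A k ∩ A (k + 1)

/-- The electric distance `d_Gel`: pieces of paths inside an amalgamation component have length
zero, each crossing of a lift has length one. -/
def dGel {Y : Type*} (lines comps : Set (Set Y)) (a b : Y) : ℕ∞ :=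
  ⨅ (n : ℕ) (_ : ∃ A l : ℕ → Set Y, IsElectricPath lines comps n A l a b), (n : ℕ∞)

/-- The successive sets between which the amalgamation segments run: the initial point, the lifts
`l 1, …, l n` that are crossed, and the final point. -/
def gate {Y : Type*} (n : ℕ) (l : ℕ → Set Y) (a b : Y) (k : ℕ) : Set Y :=
  if k = 0 then {a} else if k ≤ n then l k else {b}

/-- `μ` is the electro-ambient representative of an electric geodesic from `a` to `b`, where `d` is
the underlying (non-electric) metric.

The electric geodesic runs through `A 0, …, A n` (with `n` the electric distance). In each `A k`
it is a `d`-geodesic segment from `u k` to `v k`, perpendicular to the bounding lifts, i.e.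
realizing the distance between the two gates of `A k` (the amalgamation segments `seg k`).
The point `v k` at which the lift `l (k+1)` is reached is joined to the point `u (k+1)` at which
it is left by the subsegment of that lift between them (the interpolating segments `int k`). -/
def IsElectroAmbient {Y : Type*} (d : Y → Y → ℝ≥0∞) (lines comps : Set (Set Y)) (a b : Y)
    (μ : Set Y) : Prop :=
  ∃ (n : ℕ) (A l : ℕ → Set Y) (u v : ℕ → Y) (seg int : ℕ → Set Y),
    IsElectricPath lines comps n A l a b ∧ (n : ℕ∞) = dGel lines comps a b ∧
    (∀ k ≤ n, u k ∈ gate n l a b k ∧ v k ∈ gate n l a b (k + 1) ∧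
      (∀ p ∈ gate n l a b k, ∀ q ∈ gate n l a b (k + 1), d (u k) (v k) ≤ d p q) ∧
      IsGeodesicSegment d (seg k) (u k) (v k) ∧ seg k ⊆ A k) ∧
    (∀ k < n, IsGeodesicSegment d (int k) (v k) (u (k + 1)) ∧ int k ⊆ l (k + 1)) ∧
    μ = (⋃ k ≤ n, seg k) ∪ ⋃ k < n, int k

/-- `p` is an electric nearest point to `x` on `μ`: it minimizes the ordered pair
`(d_Gel, d)` lexicographically. -/
def IsElectricNearestPoint {Y : Type*} (d : Y → Y → ℝ≥0∞) (lines comps : Set (Set Y))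
    (μ : Set Y) (x p : Y) : Prop :=
  p ∈ μ ∧ ∀ q ∈ μ, dGel lines comps x p < dGel lines comps x q ∨
    (dGel lines comps x p = dGel lines comps x q ∧ d x p ≤ d x q)

/-! ### Surfaces and tubes -/

/-- `ℍ / Γ` is a closed surface (with fundamental group `Γ` and universal cover `ℍ`). -/
structure IsClosedSurfaceGroup (Γ : Subgroup SL(2, ℝ)) : Prop where
  free : ∀ γ ∈ Γ, ∀ z : ℍ, γ • z = z → γ = 1
  discontinuous : ∀ K : Set ℍ, IsCompact K →
    {γ : SL(2, ℝ) | γ ∈ Γ ∧ (((fun z : ℍ => γ • z) '' K) ∩ K).Nonempty}.Finite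
  cocompact : ∃ K : Set ℍ, IsCompact K ∧ ∀ z : ℍ, ∃ γ ∈ Γ, γ • z ∈ K

/-- The pullback of the metric of `ℍ` by the homeomorphism `f` is a hyperbolic metric on the closed
surface `ℍ / Γ`, of injectivity radius at least `ι` and diameter at most `Δ`. -/
structure IsBoundedHyperbolicMetric (Γ : Subgroup SL(2, ℝ)) (ι Δ : ℝ) (f : ℍ ≃ₜ ℍ) : Prop where
  invariant : ∀ γ ∈ Γ, ∀ x y : ℍ, dist (f (γ • x)) (f (γ • y)) = dist (f x) (f y)
  inj : ∀ γ ∈ Γ, γ ≠ 1 → ∀ x : ℍ, 2 * ι ≤ dist (f x) (f (γ • x))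
  diam : ∀ x y : ℍ, ∃ γ ∈ Γ, dist (f x) (f (γ • y)) ≤ Δ

/-- Data of a welded Margulis tube, that is of a vertical annulus `σ × [lo/2, hi/2]`: a lift
`curve` of the simple closed curve `σ` to `ℍ`, the deck transformation `gen` that generates the
stabilizer of the lift, and the ends of the vertical interval in half-integers (an end that is not
an integer is that of a hanging tube). -/
structure Tube where
  curve : ℝ → ℍ
  gen : SL(2, ℝ)
  lo : ℤ
  hi : ℤ

namespace Tube

/-- The translate by `γ` of the chosen lift of `σ`. -/
def lift (T : Tube) (γ : SL(2, ℝ)) : Set ℍ := (fun z : ℍ => γ • z) '' range T.curve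

/-- The vertical interval of the tube. -/
def interval (T : Tube) : Set ℝ := Icc ((T.lo : ℝ) / 2) ((T.hi : ℝ) / 2)

/-- The tube splits the horizontal surface at level `n`. -/
def SplitsLevel (T : Tube) (n : ℤ) : Prop := T.lo ≤ 2 * n ∧ 2 * n ≤ T.hi

end Tube

/-! ### Marked metric models -/

/-- `X` is the universal cover of a metric model of the surface `S = ℍ / Γ` times `J`, where
`J = ℝ` or `J = [0, ∞)`: a length space marked by a homeomorphism with `ℍ × J`, on which
`Γ` acts by isometries through the first factor; with a collection of welded Margulis
tubes. -/
structure MarkedModel (Γ : Subgroup SL(2, ℝ)) (X : Type*) [MetricSpace X] where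
  J : Set ℝ
  J_eq : J = univ ∨ J = Ici 0
  mark : ℍ × J ≃ₜ X
  deck_isometry : ∀ γ ∈ Γ, ∀ (x y : ℍ) (s t : J),
    dist (mark (γ • x, s)) (mark (γ • y, t)) = dist (mark (x, s)) (mark (y, t))
  length_space : ∀ p q : X, inducedEDist univ p q = edist p q
  tubes : Set Tube

namespace MarkedModel

variable {Γ : Subgroup SL(2, ℝ)} {X : Type*} [MetricSpace X] (M : MarkedModel Γ X)

/-- The `ℍ`-coordinate of a point. -/
def base (p : X) : ℍ := (M.mark.symm p).1

/-- The `J`-coordinate of a point. -/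
def height (p : X) : ℝ := (M.mark.symm p).2

/-- The part of `X` over the subset `A` of `ℍ` and at heights in `I`. -/
def region (A : Set ℍ) (I : Set ℝ) : Set X := {p | M.base p ∈ A ∧ M.height p ∈ I}

/-- The horizontal sheet at level `n`. -/
def sheet (n : ℤ) : Set X := M.region univ {(n : ℝ)}

/-- The metric of the sheet at level `n` (the welded, loosely called hyperbolic, metric): the
induced path metric. -/
def sheetDist (n : ℤ) : X → X → ℝ≥0∞ := inducedEDist (M.sheet n)

/-- The union of all horizontal sheets. -/
def horizontal : Set X := {p | ∃ n : ℤ, p ∈ M.sheet n}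

/-- There is a block between the levels `i` and `i + 1`. -/
def IsBlock (i : ℤ) : Prop := Icc (i : ℝ) (i + 1) ⊆ M.J

/-- The block between the levels `i` and `i + 1` is a split block: some tube splits both its
horizontal boundary surfaces. -/
def IsSplit (i : ℤ) : Prop := ∃ T ∈ M.tubes, T.SplitsLevel i ∧ T.SplitsLevel (i + 1)

/-- The slab at heights in `I`, with its induced path metric, is `K`-bi-Lipschitz to the product of
`I` with a hyperbolic surface of injectivity radius at least `ι` and diameter at most `Δ`. -/
def IsBiLipschitzProduct (ι Δ : ℝ) (K : ℝ≥0) (I : Set ℝ) : Prop :=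
  ∃ f : ℍ ≃ₜ ℍ, IsBoundedHyperbolicMetric Γ ι Δ f ∧
    ∀ p ∈ M.region univ I, ∀ q ∈ M.region univ I,
      edist (f (M.base p), M.height p) (f (M.base q), M.height q)
          ≤ K * inducedEDist (M.region univ I) p q ∧
        inducedEDist (M.region univ I) p q
          ≤ K * edist (f (M.base p), M.height p) (f (M.base q), M.height q)

/-- The lifts of the curves that cut the surface into the amalgamation components of the split
block `i`, i.e. of the curves of the tubes splitting the block. -/
def splitLines (i : ℤ) : Set (Set ℍ) :=
  {l | ∃ T ∈ M.tubes, (T.SplitsLevel i ∧ T.SplitsLevel (i + 1)) ∧ ∃ γ ∈ Γ, l = T.lift γ}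

/-- The (closed) lifts of the amalgamation components of the split block `i`. -/
def amalgamationComponents (i : ℤ) : Set (Set ℍ) :=
  {A | ∃ x ∈ (⋃₀ M.splitLines i)ᶜ, A = closure (connectedComponentIn (⋃₀ M.splitLines i)ᶜ x)}

/-- A collection of subsets of `ℍ`, placed in the sheet at level `n`. -/
def atLevel (n : ℤ) (F : Set (Set ℍ)) : Set (Set X) := (fun A => M.region A {(n : ℝ)}) '' F

/-- The lifts to `X` of all split components of all split blocks. -/
def splitComponents : Set (Set X) :=
  {K | ∃ i : ℤ, M.IsSplit i ∧ ∃ A ∈ M.amalgamationComponents i, K = M.region A (Icc (i : ℝ) (i + 1))}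

/-- The lifts to `X` of the horizontal circles of the standard annuli. -/
def horizontalCircles : Set (Set X) :=
  {l | ∃ T ∈ M.tubes, ∃ γ ∈ Γ, ∃ t ∈ T.interval, l = M.region (T.lift γ) {t}}

/-- The tube-electrocuted metric `d_tel`: the zero metric is put on the horizontal circles of the
standard annuli. -/
def telDist : X → X → ℝ≥0∞ := electrocute (fun p q => edist p q) 0 M.horizontalCircles

/-- The graph metric `d_G`: the split components are electrocuted in the tube-electrocuted
metric. -/
def graphDist : X → X → ℝ≥0∞ := electrocute M.telDist 2 M.splitComponents

/-- The marked model has weak split geometry and is built from thick and split blocks; the metric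
of `X` is the weld-metric `d_wel`. Split geometry demands in addition that the split components be
quasiconvex and uniformly graph-quasiconvex; that is not required here, so that every model of
split geometry is included. -/
structure IsWeakSplitGeometry : Prop where
  /-- Every tube is a vertical annulus `σ × [lo/2, hi/2]` over a simple closed curve `σ` on the
  surface; it splits at least one horizontal surface, and lies in the union of the
  split blocks. The lift of `σ` is a properly embedded line of the plane. -/
  tube : ∀ T ∈ M.tubes, T.gen ∈ Γ ∧ (∃ Φ : ℝ × ℝ ≃ₜ ℍ, ∀ s, T.curve s = Φ (s, 0)) ∧
    (∀ γ ∈ Γ, γ ∈ Subgroup.zpowers T.gen ∨ Disjoint (T.lift γ) (T.lift 1)) ∧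
    T.lo < T.hi ∧ (∃ n, T.SplitsLevel n) ∧ T.interval ⊆ M.J ∧
    ∀ t ∈ T.interval, ∃ i : ℤ, M.IsSplit i ∧ t ∈ Icc (i : ℝ) (i + 1)
  /-- Two different tubes that split the same horizontal surface are not homotopic. -/
  not_homotopic : ∀ T ∈ M.tubes, ∀ T' ∈ M.tubes, T ≠ T' →
    (∃ n, T.SplitsLevel n ∧ T'.SplitsLevel n) →
    ∀ γ ∈ Γ, γ * T.gen * γ⁻¹ ≠ T'.gen ∧ γ * T.gen * γ⁻¹ ≠ T'.gen⁻¹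
  /-- Each tube splits a uniformly bounded number of horizontal surfaces. -/
  bounded_splitting : ∃ N : ℤ, ∀ T ∈ M.tubes, T.hi - T.lo ≤ N
  /-- Different lifts of tubes are uniformly separated. -/
  separated : ∃ r : ℝ, 0 < r ∧ ∀ T ∈ M.tubes, ∀ T' ∈ M.tubes, ∀ γ ∈ Γ,
    (T ≠ T' ∨ γ ∉ Subgroup.zpowers T.gen) →
    ∀ p ∈ M.region (T.lift γ) T.interval, ∀ q ∈ M.region (T'.lift 1) T'.interval, r ≤ dist p q
  /-- Standard annuli: `σ` has length `ε₀`, the induced path metric on the annulus is the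
  Euclidean one, and `σ × {n}` is a geodesic of each horizontal surface that it splits. -/
  standard_annuli : ∃ ε₀ : ℝ, 0 < ε₀ ∧ ∀ T ∈ M.tubes, (∀ s, T.curve (s + ε₀) = T.gen • T.curve s) ∧
    (∀ s s' : ℝ, ∀ p q : X, M.base p = T.curve s → M.base q = T.curve s' →
      M.height p ∈ T.interval → M.height q ∈ T.interval →
      inducedEDist (M.region (T.lift 1) T.interval) p q
        = ENNReal.ofReal (Real.sqrt ((s - s') ^ 2 + (M.height p - M.height q) ^ 2))) ∧
    (∀ n : ℤ, T.SplitsLevel n → ∀ s s' : ℝ, ∀ p ∈ M.sheet n, ∀ q ∈ M.sheet n,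
      M.base p = T.curve s → M.base q = T.curve s' →
      M.sheetDist n p q = ENNReal.ofReal |s - s'|)
  /-- The horizontal surfaces have uniformly bounded geometry, and every block that is not split is
  a thick block, i.e. uniformly bi-Lipschitz to a product. -/
  bounded_geometry : ∃ (ι Δ : ℝ) (K : ℝ≥0), 0 < ι ∧
    (∀ n : ℤ, M.IsBiLipschitzProduct ι Δ K {(n : ℝ)}) ∧
    ∀ i : ℤ, M.IsBlock i → ¬ M.IsSplit i → M.IsBiLipschitzProduct ι Δ K (Icc (i : ℝ) (i + 1))
  /-- Different horizontal surfaces are uniformly separated (the height is a Lipschitz function), and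
  each of them is uniformly embedded on small scales (as it has a product neighbourhood of a
  definite height). -/
  uniform_sheets : ∃ (K : ℝ≥0) (r : ℝ), 0 < r ∧ LipschitzWith K M.height ∧
    ∀ n : ℤ, ∀ p ∈ M.sheet n, ∀ q ∈ M.sheet n, dist p q ≤ r → M.sheetDist n p q ≤ K * edist p q

/-! ### The ladder and the retraction -/

/-- `μ` is the curve that the ladder of the segment with endpoints over `a` and `b` has in the
horizontal sheet `n` of the block `i`: an electro-ambient representative if the block is split, a
geodesic segment if it is thick. -/
def IsRung (i n : ℤ) (a b : ℍ) (μ : Set X) : Prop :=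
  ∃ a' ∈ M.sheet n, ∃ b' ∈ M.sheet n, M.base a' = a ∧ M.base b' = b ∧
    (M.IsSplit i → IsElectroAmbient (M.sheetDist n) (M.atLevel n (M.splitLines i))
      (M.atLevel n (M.amalgamationComponents i)) a' b' μ) ∧
    (¬ M.IsSplit i → IsGeodesicSegment (M.sheetDist n) μ a' b')

/-- `L` is a ladder built from the segment `lam` from `a` to `b` in the base sheet at level `0`;
here `L i n` is the part of the ladder in the sheet `n` (equal to `i` or `i + 1`) of the block `i`.

Passing through a block, upwards or downwards, replaces a curve by the (electro-ambient) geodesic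
joining the images of its endpoints under the map `(x, n) ↦ (x, n ± 1)`; hence the curve at
level `n` always joins `(a, n)` to `(b, n)`. In the base sheet, a thick block uses `lam` itself. -/
def IsLadder (lam : Set X) (a b : X) (L : ℤ → ℤ → Set X) : Prop :=
  ∀ i n : ℤ, M.IsBlock i → n = i ∨ n = i + 1 →
    M.IsRung i n (M.base a) (M.base b) (L i n) ∧ (n = 0 → ¬ M.IsSplit i → L i n = lam)

/-- `p` is a value at `x` of the retraction of the union of the sheets onto the ladder `L`: in a
block `i` containing the sheet of `x`, it is a nearest-point projection of `x` to the
curve of `L` in that sheet, in the electric sense if the block is split. -/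
def IsProjection (L : ℤ → ℤ → Set X) (x p : X) : Prop :=
  ∃ i n : ℤ, M.IsBlock i ∧ (n = i ∨ n = i + 1) ∧ x ∈ M.sheet n ∧
    (M.IsSplit i → IsElectricNearestPoint (M.sheetDist n) (M.atLevel n (M.splitLines i))
      (M.atLevel n (M.amalgamationComponents i)) (L i n) x p) ∧
    (¬ M.IsSplit i → IsNearestPoint (M.sheetDist n) (L i n) x p)

end MarkedModel

end

open Set UpperHalfPlane
open scoped ENNReal NNReal MatrixGroups

noncomputable section

/-! ### Hyperbolic geometry of the upper half-plane -/

section Hyperbolic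

/-! The point of the proof is that a value of the projection depends, up to a bounded error in the
graph metric, only on the projected point and on the two ends of the ladder, and not on the block or
the rung that was chosen.

In a single sheet, with chart `f` to the hyperbolic plane, a nearest point of `x` on a geodesic from
`a` to `b` is a coarse center of the triangle `f x`, `f a`, `f b`: it has small excess between any
two of the vertices (`exists_isCoarseCenter`). This is the Morse lemma (`exists_excess_le`) applied
to the geodesic and to the broken path that runs from `x` to the nearest point and then along the
geodesic. Coarse centers are unique up to bounded distance by the four-point condition
(`dist_le_of_centers`), so they depend coarsely Lipschitz on `x`. Both boundary sheets of a thick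
block can be read in one chart, so points above each other have the same coarse centers.

In a split block the argument is combinatorial. The lines cut the plane into components in a
treelike way, and a shortest electric path does not backtrack. If the electric projections `p` of
`x` and `q` of `y` lie in no common component, a line adjacent to a component of `q` separates them.
Both rungs have to cross this line, so a projected point strictly on the wrong side of it would have
a closer point on its rung. Hence projections of two points of one component are joined through at
most three components, even for two different rungs (`electric_projections_close`). The same idea,
together with thin triangles, shows that the nearest point on a genuine geodesic is at bounded
distance from a component of the electric projection (`exists_nearest_close_electric`). So every
value of the retraction is close to a coarse center (`exists_center_of_projection`). Quasiconvexity
of split components plays no role.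

These facts make up `IsCoarseRetraction`: bounded change for close points of a sheet, for vertical
steps, and inside split components. The rest is soft. A selection of values is extended to all
heights by the vertical projection `shadow`. It varies boundedly over small distances of the
weld-metric (`of_edist_lt`), and over short chains for the tube-electrocuted metric, because such a
chain meets at most one lift of a tube (`of_short_chain`). The counting lemma `coarse_chain` turns
local bounds into linear ones, in turn for the weld-metric, the tube-electrocuted metric and the
graph metric. -/

/-- The excess `d(a,p) + d(p,b) - d(a,b)`, twice the Gromov product of `a` and `b` at `p`. -/
def excess (a p b : ℍ) : ℝ := dist a p + dist p b - dist a b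

/-- Since `sinh (d(z,w)/2) = |z - w| / (2 √(Im z · Im w))`, this is Ptolemy's inequality of the
Euclidean plane: all three products carry the same four square roots. -/
lemma sinh_half_dist_ptolemy (a b c d : ℍ) :
    Real.sinh (dist a b / 2) * Real.sinh (dist c d / 2) ≤
      Real.sinh (dist a c / 2) * Real.sinh (dist b d / 2) +
        Real.sinh (dist a d / 2) * Real.sinh (dist b c / 2) := by
  have hP := EuclideanGeometry.mul_dist_le_mul_dist_add_mul_dist (a : ℂ) c b d
  simp only [UpperHalfPlane.sinh_half_dist]
  have ha := Real.sqrt_pos.2 a.im_pos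
  have hb := Real.sqrt_pos.2 b.im_pos
  have hc := Real.sqrt_pos.2 c.im_pos
  have hd := Real.sqrt_pos.2 d.im_pos
  rw [Real.sqrt_mul a.im_pos.le, Real.sqrt_mul a.im_pos.le, Real.sqrt_mul a.im_pos.le,
    Real.sqrt_mul b.im_pos.le, Real.sqrt_mul b.im_pos.le, Real.sqrt_mul c.im_pos.le]
  rw [dist_comm (c : ℂ) b] at hP
  field_simp
  nlinarith [hP]

lemma exp_half_le_sinh (t : ℝ) (ht : 0 ≤ t) : Real.exp (t / 2) ≤ 2 * Real.sinh (t / 2) + 1 := by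
  rw [Real.sinh_eq]
  have : Real.exp (-(t / 2)) ≤ 1 := Real.exp_le_one_iff.2 (by linarith)
  linarith

lemma sinh_half_le_exp (t : ℝ) : 2 * Real.sinh (t / 2) ≤ Real.exp (t / 2) := by
  rw [Real.sinh_eq]
  have := Real.exp_pos (-(t / 2))
  linarith

/-- The four-point condition: `ℍ` is Gromov hyperbolic. -/
lemma four_point (a b c d : ℍ) :
    dist a b + dist c d ≤ max (dist a c + dist b d) (dist a d + dist b c) + 2 * Real.log 5 := by
  set m := max (dist a c + dist b d) (dist a d + dist b c) with hm
  have h1 : dist a c + dist b d ≤ m := le_max_left _ _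
  have h2 : dist a d + dist b c ≤ m := le_max_right _ _
  have hab : dist a b ≤ m := by
    have := dist_triangle a c b; have := dist_triangle a d b
    rw [dist_comm c b] at *; rw [dist_comm d b] at *; linarith
  have hcd : dist c d ≤ m := by
    have := dist_triangle c a d; have := dist_triangle c b d
    rw [dist_comm c a] at *; rw [dist_comm c b] at *; linarith
  have hm0 : 0 ≤ m := dist_nonneg.trans hab
  have P := sinh_half_dist_ptolemy a b c d
  have e1 := exp_half_le_sinh _ (dist_nonneg (x := a) (y := b))
  have e2 := exp_half_le_sinh _ (dist_nonneg (x := c) (y := d))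
  have s1 : 0 ≤ Real.sinh (dist a b / 2) := Real.sinh_nonneg_iff.2 (by positivity)
  have s2 : 0 ≤ Real.sinh (dist c d / 2) := Real.sinh_nonneg_iff.2 (by positivity)
  -- In the expansion of `(2 sinh + 1)(2 sinh + 1)` the quadratic term gives at most `2 exp (m/2)`
  -- by Ptolemy; the two linear terms and the constant give `exp (m/2)` each. This is the 5.
  have key : Real.exp ((dist a b + dist c d) / 2) ≤ 5 * Real.exp (m / 2) := by
    have f1 : 4 * (Real.sinh (dist a c / 2) * Real.sinh (dist b d / 2)) ≤ Real.exp (m / 2) := by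
      calc _ = (2 * Real.sinh (dist a c / 2)) * (2 * Real.sinh (dist b d / 2)) := by ring
        _ ≤ Real.exp (dist a c / 2) * Real.exp (dist b d / 2) :=
            mul_le_mul (sinh_half_le_exp _) (sinh_half_le_exp _)
              (mul_nonneg (by norm_num) (Real.sinh_nonneg_iff.2 (by positivity)))
              (Real.exp_pos _).le
        _ = Real.exp ((dist a c + dist b d) / 2) := by rw [← Real.exp_add]; ring_nf
        _ ≤ _ := Real.exp_le_exp.2 (by linarith)
    have f2 : 4 * (Real.sinh (dist a d / 2) * Real.sinh (dist b c / 2)) ≤ Real.exp (m / 2) := by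
      calc _ = (2 * Real.sinh (dist a d / 2)) * (2 * Real.sinh (dist b c / 2)) := by ring
        _ ≤ Real.exp (dist a d / 2) * Real.exp (dist b c / 2) :=
            mul_le_mul (sinh_half_le_exp _) (sinh_half_le_exp _)
              (mul_nonneg (by norm_num) (Real.sinh_nonneg_iff.2 (by positivity)))
              (Real.exp_pos _).le
        _ = Real.exp ((dist a d + dist b c) / 2) := by rw [← Real.exp_add]; ring_nf
        _ ≤ _ := Real.exp_le_exp.2 (by linarith)
    have f3 : 2 * Real.sinh (dist a b / 2) ≤ Real.exp (m / 2) :=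
      (sinh_half_le_exp _).trans (Real.exp_le_exp.2 (by linarith))
    have f4 : 2 * Real.sinh (dist c d / 2) ≤ Real.exp (m / 2) :=
      (sinh_half_le_exp _).trans (Real.exp_le_exp.2 (by linarith))
    have f5 : 1 ≤ Real.exp (m / 2) := Real.one_le_exp (by linarith)
    calc Real.exp ((dist a b + dist c d) / 2)
        = Real.exp (dist a b / 2) * Real.exp (dist c d / 2) := by rw [← Real.exp_add]; ring_nf
      _ ≤ (2 * Real.sinh (dist a b / 2) + 1) * (2 * Real.sinh (dist c d / 2) + 1) :=
          mul_le_mul e1 e2 (Real.exp_pos _).le (by positivity)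
      _ ≤ _ := by nlinarith
  have key2 : (dist a b + dist c d) / 2 ≤ Real.log 5 + m / 2 := by
    have := Real.log_le_log (Real.exp_pos _) key
    rwa [Real.log_exp, Real.log_mul (by norm_num) (Real.exp_pos _).ne', Real.log_exp] at this
  linarith

/-- Coarse centers of a triangle are coarsely unique. -/
lemma dist_le_of_centers {x a b p q : ℍ} {D : ℝ}
    (p1 : excess x p a ≤ D) (p2 : excess x p b ≤ D) (p3 : excess a p b ≤ D)
    (q1 : excess x q a ≤ D) (q2 : excess x q b ≤ D) (q3 : excess a q b ≤ D) :
    dist p q ≤ D + 2 * Real.log 5 := by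
  unfold excess at *
  have h1 := four_point x a p q
  have h2 := four_point x b p q
  have h3 := four_point a b p q
  have := Real.log_nonneg (by norm_num : (1 : ℝ) ≤ 5)
  simp only [dist_comm p a, dist_comm p b, dist_comm q a, dist_comm q b] at *
  -- Put `δ v = d(v,q) - d(v,p)`. If `d(p,q)` exceeded the bound, each of the three inequalities
  -- would force the two `δ`s of its pair to have opposite signs, which is impossible for three
  -- numbers.
  rcases max_cases (dist x p + dist a q) (dist x q + dist a p) with ⟨e1, _⟩ | ⟨e1, _⟩ <;>
  rcases max_cases (dist x p + dist b q) (dist x q + dist b p) with ⟨e2, _⟩ | ⟨e2, _⟩ <;>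
  rcases max_cases (dist a p + dist b q) (dist a q + dist b p) with ⟨e3, _⟩ | ⟨e3, _⟩ <;>
  rw [e1] at h1 <;> rw [e2] at h2 <;> rw [e3] at h3 <;> linarith

/-- Two points of small excess at the same distance from one end are close. -/
lemma dist_le_of_excess {u v g m : ℍ} {D : ℝ} (hg : excess u g v ≤ D) (hm : excess u m v ≤ D)
    (h : |dist u g - dist u m| ≤ D) : dist g m ≤ 2 * D + 2 * Real.log 5 := by
  unfold excess at *
  have h1 := four_point u v g m
  have h2 := abs_le.1 h
  simp only [dist_comm v] at *
  rcases max_cases (dist u g + dist m v) (dist u m + dist g v) with ⟨e1, _⟩ | ⟨e1, _⟩ <;>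
  rw [e1] at h1 <;> linarith [h2.1, h2.2]

/-! ### Projection to the imaginary axis. -/

/-- The level of the projection of `z` to the imaginary axis. -/
def axisLevel (z : ℍ) : ℝ := Real.log ‖(z : ℂ)‖

/-- The point of the imaginary axis at level `t`. -/
def axisPoint (t : ℝ) : ℍ := UpperHalfPlane.mk ⟨0, Real.exp t⟩ (Real.exp_pos t)

lemma dist_axisPoint (s t : ℝ) : dist (axisPoint s) (axisPoint t) = |s - t| :=
  (UpperHalfPlane.isometry_vertical_line 0).dist_eq s t

lemma dist_axisPoint_add {a b c : ℝ} (h : b ∈ uIcc a c) :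
    dist (axisPoint a) (axisPoint b) + dist (axisPoint b) (axisPoint c) =
      dist (axisPoint a) (axisPoint c) := by
  simp only [dist_axisPoint]
  rcases mem_uIcc.1 h with ⟨i1, i2⟩ | ⟨i1, i2⟩
  · rw [abs_sub_comm, abs_of_nonneg (sub_nonneg.2 i1), abs_sub_comm,
      abs_of_nonneg (sub_nonneg.2 i2), abs_sub_comm,
      abs_of_nonneg (sub_nonneg.2 (i1.trans i2))]
    ring
  · rw [abs_of_nonneg (sub_nonneg.2 i2), abs_of_nonneg (sub_nonneg.2 i1),
      abs_of_nonneg (sub_nonneg.2 (i1.trans i2))]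
    ring

lemma norm_coe_pos (z : ℍ) : 0 < ‖(z : ℂ)‖ := norm_pos_iff.2 (UpperHalfPlane.ne_zero z)

lemma continuous_axisLevel : Continuous axisLevel :=
  (continuous_norm.comp UpperHalfPlane.continuous_coe).log fun z => (norm_coe_pos z).ne'

lemma axisPoint_axisLevel {z : ℍ} (hz : z.re = 0) : axisPoint (axisLevel z) = z := by
  apply UpperHalfPlane.ext
  apply Complex.ext
  · simp [axisPoint, hz]
  · have : ‖(z : ℂ)‖ = z.im := by
      rw [← abs_of_pos z.im_pos]
      exact (Complex.abs_im_eq_norm.2 (by simpa using hz)).symm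
    simp [axisPoint, axisLevel, this, Real.exp_log z.im_pos]

/-- The distance of `z` to its projection on the imaginary axis. -/
def axisDist (z : ℍ) : ℝ := dist z (axisPoint (axisLevel z))

lemma continuous_axisDist : Continuous axisDist := by
  have : Continuous axisPoint := (UpperHalfPlane.isometry_vertical_line 0).continuous
  exact continuous_id.dist (this.comp continuous_axisLevel)

lemma cosh_axisDist (z : ℍ) : Real.cosh (axisDist z) = ‖(z : ℂ)‖ / z.im := by
  have hn := norm_coe_pos z
  have hsq : ‖(z : ℂ)‖ ^ 2 = z.re ^ 2 + z.im ^ 2 := by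
    rw [Complex.sq_norm, Complex.normSq_apply]; simp; ring
  rw [axisDist, UpperHalfPlane.cosh_dist']
  simp only [axisPoint, axisLevel, Real.exp_log hn]
  have hi := z.im_pos
  simp only [UpperHalfPlane.re, UpperHalfPlane.im] at *
  field_simp
  nlinarith

lemma axisDist_eq_zero {z : ℍ} (hz : z.re = 0) : axisDist z = 0 := by
  rw [axisDist, axisPoint_axisLevel hz, dist_self]

/-- Projection to a geodesic contracts far from the geodesic. -/
lemma sinh_axisLevel_le (z w : ℍ) {R : ℝ} (hz : R ≤ axisDist z) (hw : R ≤ axisDist w)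
    (hR : 0 ≤ R) :
    Real.cosh R * Real.sinh (|axisLevel z - axisLevel w| / 2) ≤ Real.sinh (dist z w / 2) := by
  have hz0 := norm_coe_pos z
  have hw0 := norm_coe_pos w
  rw [← dist_axisPoint, UpperHalfPlane.sinh_half_dist, UpperHalfPlane.sinh_half_dist]
  have i1 : (axisPoint (axisLevel z)).im = ‖(z : ℂ)‖ := by
    simp [axisPoint, axisLevel, UpperHalfPlane.im, Real.exp_log hz0]
  have i2 : (axisPoint (axisLevel w)).im = ‖(w : ℂ)‖ := by
    simp [axisPoint, axisLevel, UpperHalfPlane.im, Real.exp_log hw0]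
  have e1 : dist (axisPoint (axisLevel z) : ℂ) (axisPoint (axisLevel w)) ≤ dist (z : ℂ) w := by
    rw [Complex.dist_of_re_eq (by simp [axisPoint])]
    change dist (axisPoint (axisLevel z)).im (axisPoint (axisLevel w)).im ≤ _
    rw [i1, i2, Real.dist_eq, dist_eq_norm]
    exact abs_norm_sub_norm_le _ _
  rw [i1, i2]
  -- The projected points have imaginary parts `‖z‖` and `‖w‖`. Projecting does not increase the
  -- Euclidean distance, and the denominators gain a factor `cosh R` because `‖z‖ = cosh (axisDist
  -- z) · Im z`.
  have c1 : Real.cosh R * z.im ≤ ‖(z : ℂ)‖ := by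
    have := (Real.cosh_le_cosh (x := R) (y := axisDist z)).2
      (by rw [abs_of_nonneg hR]; exact hz.trans (le_abs_self _))
    rw [cosh_axisDist, le_div_iff₀ z.im_pos] at this
    exact this
  have c2 : Real.cosh R * w.im ≤ ‖(w : ℂ)‖ := by
    have := (Real.cosh_le_cosh (x := R) (y := axisDist w)).2
      (by rw [abs_of_nonneg hR]; exact hw.trans (le_abs_self _))
    rw [cosh_axisDist, le_div_iff₀ w.im_pos] at this
    exact this
  have hsq : Real.cosh R * √(z.im * w.im) ≤ √(‖(z : ℂ)‖ * ‖(w : ℂ)‖) := by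
    apply Real.le_sqrt_of_sq_le
    rw [mul_pow, Real.sq_sqrt (mul_pos z.im_pos w.im_pos).le]
    calc _ = (Real.cosh R * z.im) * (Real.cosh R * w.im) := by ring
      _ ≤ _ := mul_le_mul c1 c2 (by have := Real.cosh_pos R; have := w.im_pos; positivity)
        hz0.le
  have p1 : 0 < √(z.im * w.im) := Real.sqrt_pos.2 (mul_pos z.im_pos w.im_pos)
  have p2 : 0 < √(‖(z : ℂ)‖ * ‖(w : ℂ)‖) := Real.sqrt_pos.2 (mul_pos hz0 hw0)
  rw [mul_div_assoc', div_le_div_iff₀ (by positivity) (by positivity)]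
  have hd : 0 ≤ dist (z : ℂ) w := dist_nonneg
  have hC := Real.cosh_pos R
  calc _ ≤ Real.cosh R * dist (z : ℂ) w * (2 * √(z.im * w.im)) := by gcongr
    _ = dist (z : ℂ) w * (2 * (Real.cosh R * √(z.im * w.im))) := by ring
    _ ≤ _ := by gcongr

lemma abs_axisLevel_sub_le (z w : ℍ) : |axisLevel z - axisLevel w| ≤ dist z w := by
  have := sinh_axisLevel_le z w (R := 0) dist_nonneg dist_nonneg le_rfl
  rw [Real.cosh_zero, one_mul, Real.sinh_le_sinh] at this
  linarith

/-- The foot of the perpendicular moves no faster than the point itself; both motions count, hence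
the factor 2. -/
lemma axisDist_le (z w : ℍ) : axisDist z ≤ axisDist w + 2 * dist z w := by
  have e1 := dist_triangle4 z w (axisPoint (axisLevel w)) (axisPoint (axisLevel z))
  rw [dist_axisPoint, abs_sub_comm] at e1
  have := abs_axisLevel_sub_le z w
  unfold axisDist
  linarith

/-- Any two points can be moved to the imaginary axis. -/
lemma exists_smul_re_eq_zero (z w : ℍ) : ∃ g : SL(2, ℝ), (g • z).re = 0 ∧ (g • w).re = 0 := by
  obtain ⟨h, hh⟩ := MulAction.exists_smul_eq SL(2, ℝ) z UpperHalfPlane.I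
  set u := h • w with hu
  -- Once `z` is at `i`, rotations about `i` remain free. `F θ` is the numerator of the real part of
  -- the rotated `u`; it equals `u.re` at `0` and `-u.re` at `π/2`, so it vanishes in between.
  let F : ℝ → ℝ := fun θ => Real.cos θ * Real.sin θ * (u.re ^ 2 + u.im ^ 2 - 1) +
    (Real.cos θ ^ 2 - Real.sin θ ^ 2) * u.re
  have hF : Continuous F := by fun_prop
  obtain ⟨θ, -, hθ⟩ : ∃ θ ∈ uIcc 0 (Real.pi / 2), F θ = 0 := by
    have := intermediate_value_uIcc (a := 0) (b := Real.pi / 2) hF.continuousOn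
    apply this
    simp only [F, Real.cos_zero, Real.sin_zero, Real.cos_pi_div_two, Real.sin_pi_div_two]
    rw [mem_uIcc]
    rcases le_total 0 u.re with h0 | h0
    · right; constructor <;> linarith
    · left; constructor <;> linarith
  let g : SL(2, ℝ) := ⟨!![Real.cos θ, -Real.sin θ; Real.sin θ, Real.cos θ], by
    rw [Matrix.det_fin_two_of]; nlinarith [Real.cos_sq_add_sin_sq θ]⟩
  have hre : ∀ v : ℍ, (g • v).re = (Real.cos θ * Real.sin θ * (v.re ^ 2 + v.im ^ 2 - 1) +
    (Real.cos θ ^ 2 - Real.sin θ ^ 2) * v.re) /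
      Complex.normSq ((Real.sin θ : ℂ) * v + Real.cos θ) := by
    intro v
    rw [← UpperHalfPlane.coe_re, UpperHalfPlane.coe_specialLinearGroup_apply]
    simp only [g, Complex.div_re]
    simp [-Complex.ofReal_cos, -Complex.ofReal_sin]
    rw [← add_div]
    congr 1
    ring
  refine ⟨g * h, ?_, ?_⟩
  · rw [mul_smul, hh, hre]
    simp
  · rw [mul_smul, ← hu, hre]
    change F θ / _ = 0
    rw [hθ, zero_div]

/-- Any two points are joined by a geodesic. -/
lemma exists_geodesic_param (z w : ℍ) : ∃ c : ℝ → ℍ, c 0 = z ∧ c 1 = w ∧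
    ∀ s t, dist (c s) (c t) = dist z w * |s - t| := by
  obtain ⟨g, hz, hw⟩ := exists_smul_re_eq_zero z w
  set a := axisLevel (g • z)
  set b := axisLevel (g • w)
  refine ⟨fun t => g⁻¹ • axisPoint (a + t * (b - a)), ?_, ?_, fun s t => ?_⟩
  · simp [a, axisPoint_axisLevel hz]
  · simp [b, axisPoint_axisLevel hw]
  · have : dist z w = |a - b| := by
      rw [← dist_axisPoint, axisPoint_axisLevel hz, axisPoint_axisLevel hw, dist_smul]
    rw [dist_smul, dist_axisPoint, this, ← abs_mul, ← abs_neg]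
    congr 1
    ring

/-- The interval is cut into `⌊b - a⌋ + 1` pieces of length at most 1. It bounds the drift along the
axis of a stretch of path that stays far away from it. -/
lemma abs_sub_le_of_local {f : ℝ → ℝ} {a b η : ℝ} (hab : a ≤ b)
    (h : ∀ s ∈ Icc a b, ∀ t ∈ Icc a b, |s - t| ≤ 1 → |f s - f t| ≤ η) :
    |f a - f b| ≤ (b - a + 1) * η := by
  have hη : 0 ≤ η := (abs_nonneg _).trans (h a ⟨le_rfl, hab⟩ a ⟨le_rfl, hab⟩ (by simp))
  set N := ⌊b - a⌋₊ + 1 with hN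
  have hN0 : (0 : ℝ) < N := by positivity
  have hN1 : b - a ≤ N := by rw [hN]; push_cast; exact (Nat.lt_floor_add_one _).le
  have hN2 : (N : ℝ) ≤ b - a + 1 := by
    rw [hN]; push_cast; linarith [Nat.floor_le (sub_nonneg.2 hab)]
  let u : ℕ → ℝ := fun k => a + k * ((b - a) / N)
  have hu : ∀ k ≤ N, u k ∈ Icc a b := by
    intro k hk
    have hk' : (k : ℝ) ≤ N := by exact_mod_cast hk
    have h0 : 0 ≤ b - a := sub_nonneg.2 hab
    have h1 : (k : ℝ) * ((b - a) / N) ≤ b - a := by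
      rw [mul_div_assoc', div_le_iff₀ hN0]; nlinarith
    exact ⟨by have : (0 : ℝ) ≤ k * ((b - a) / N) := by positivity
              simp only [u]; linarith, by simp only [u]; linarith⟩
  have hs : ∀ k < N, dist (f (u k)) (f (u (k + 1))) ≤ η := by
    intro k hk
    rw [Real.dist_eq]
    apply h _ (hu k hk.le) _ (hu (k + 1) hk)
    have : u k - u (k + 1) = -((b - a) / N) := by simp only [u]; push_cast; ring
    rw [this, abs_neg, abs_of_nonneg (div_nonneg (sub_nonneg.2 hab) hN0.le),
      div_le_one hN0]
    exact hN1
  have := dist_le_range_sum_of_dist_le (f := fun k => f (u k)) N (d := fun _ => η)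
    (fun {k} hk => hs k hk)
  have e0 : u 0 = a := by simp [u]
  have e1 : u N = b := by simp only [u]; field_simp; ring
  simp only [e0, e1, Finset.sum_const, Finset.card_range, nsmul_eq_mul, Real.dist_eq] at this
  exact this.trans (mul_le_mul_of_nonneg_right hN2 hη)

/-! ### Bi-Lipschitz paths and the Morse lemma. -/

/-- A path `c` on `[0, r]` that is bi-Lipschitz with constant `K`. -/
def BiLipPath (K : ℝ) (r : ℝ) (c : ℝ → ℍ) : Prop :=
  ∀ s ∈ Icc 0 r, ∀ t ∈ Icc 0 r, |s - t| ≤ K * dist (c s) (c t) ∧ dist (c s) (c t) ≤ K * |s - t|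

lemma BiLipPath.continuousOn {K r : ℝ} {c : ℝ → ℍ} (h : BiLipPath K r c) :
    ContinuousOn c (Icc 0 r) := by
  have : LipschitzOnWith (Real.toNNReal K) c (Icc 0 r) := by
    apply LipschitzOnWith.of_dist_le_mul
    intro s hs t ht
    refine (h s hs t ht).2.trans ?_
    rw [Real.dist_eq]
    exact mul_le_mul_of_nonneg_right (Real.le_coe_toNNReal K) (abs_nonneg _)
  exact this.continuousOn

/-- A bi-Lipschitz path with endpoints on the axis stays close to the axis. -/
lemma exists_axisDist_le {K : ℝ} (hK : 1 ≤ K) : ∃ H : ℝ, 0 ≤ H ∧ ∀ (r : ℝ) (c : ℝ → ℍ),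
    BiLipPath K r c → (c 0).re = 0 → (c r).re = 0 → ∀ t ∈ Icc 0 r, axisDist (c t) ≤ H := by
  -- Beyond distance `R` the contraction of the projection is so strong that in unit time the path
  -- advances by at most `1 / (2 * K)` along the axis.
  obtain ⟨R, hR0, hR⟩ : ∃ R : ℝ, 0 ≤ R ∧ 4 * K * Real.sinh (K / 2) ≤ Real.cosh R := by
    refine ⟨4 * K * Real.sinh (K / 2), ?_, ?_⟩
    · have := Real.sinh_nonneg_iff.2 (by linarith : 0 ≤ K / 2); positivity
    · have := Real.add_one_le_exp (Real.log 1)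
      have h0 : 0 ≤ 4 * K * Real.sinh (K / 2) := by
        have := Real.sinh_nonneg_iff.2 (by linarith : 0 ≤ K / 2); positivity
      exact (Real.self_le_sinh_iff.2 h0).trans (Real.sinh_lt_cosh _).le
  -- An excursion beyond `R` lasts at most `4 * K * R + 1`; the path moves at speed at most `K`, and
  -- `axisDist` is 2-Lipschitz.
  refine ⟨R + 2 * (K * (4 * K * R + 1)), by positivity, ?_⟩
  intro r c hc h0 hr t0 ht0
  by_contra! hlt
  have hD : R < axisDist (c t0) := by nlinarith [mul_nonneg (by positivity : 0 ≤ K) hR0]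
  have hcont : ContinuousOn (fun t => axisDist (c t)) (Icc 0 r) :=
    continuous_axisDist.comp_continuousOn hc.continuousOn
  -- the last time before `t0` at distance `R`
  obtain ⟨t1, ht1, h1R, h1⟩ : ∃ t1 ∈ Icc 0 t0, axisDist (c t1) = R ∧
      ∀ t ∈ Icc t1 t0, R ≤ axisDist (c t) := by
    have hc1 : ContinuousOn (fun t => axisDist (c t)) (Icc 0 t0) :=
      hcont.mono (Icc_subset_Icc_right ht0.2)
    have hcpt : IsCompact {t | t ∈ Icc 0 t0 ∧ axisDist (c t) = R} := by
      have : {t | t ∈ Icc 0 t0 ∧ axisDist (c t) = R} =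
        Icc 0 t0 ∩ (fun t => axisDist (c t)) ⁻¹' {R} := rfl
      rw [this]
      exact isCompact_Icc.of_isClosed_subset
        (hc1.preimage_isClosed_of_isClosed isClosed_Icc isClosed_singleton) inter_subset_left
    have hne : {t | t ∈ Icc 0 t0 ∧ axisDist (c t) = R}.Nonempty := by
      have := intermediate_value_Icc ht0.1 hc1
      obtain ⟨t, ht, e⟩ := this ⟨by rw [axisDist_eq_zero h0]; exact hR0, hD.le⟩
      exact ⟨t, ht, e⟩
    obtain ⟨t1, ht1, hmax⟩ := hcpt.exists_isGreatest hne
    refine ⟨t1, ht1.1, ht1.2, fun t ht => ?_⟩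
    by_contra! hlt'
    obtain ⟨s, hs, e⟩ := intermediate_value_Icc ht.2
      (hc1.mono (Icc_subset_Icc_left (ht1.1.1.trans ht.1))) ⟨hlt'.le, hD.le⟩
    have hs1 : s ≤ t1 := hmax ⟨⟨(ht1.1.1.trans ht.1).trans hs.1, hs.2⟩, e⟩
    have : t = t1 := le_antisymm (hs.1.trans hs1) ht.1
    rw [this, ht1.2] at hlt'
    exact lt_irrefl _ hlt'
  obtain ⟨t2, ht2, h2R, h2⟩ : ∃ t2 ∈ Icc t0 r, axisDist (c t2) = R ∧
      ∀ t ∈ Icc t0 t2, R ≤ axisDist (c t) := by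
    have hc1 : ContinuousOn (fun t => axisDist (c t)) (Icc t0 r) :=
      hcont.mono (Icc_subset_Icc_left ht0.1)
    have hcpt : IsCompact {t | t ∈ Icc t0 r ∧ axisDist (c t) = R} := by
      have : {t | t ∈ Icc t0 r ∧ axisDist (c t) = R} =
        Icc t0 r ∩ (fun t => axisDist (c t)) ⁻¹' {R} := rfl
      rw [this]
      exact isCompact_Icc.of_isClosed_subset
        (hc1.preimage_isClosed_of_isClosed isClosed_Icc isClosed_singleton) inter_subset_left
    have hne : {t | t ∈ Icc t0 r ∧ axisDist (c t) = R}.Nonempty := by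
      have := intermediate_value_Icc' ht0.2 hc1
      obtain ⟨t, ht, e⟩ := this ⟨by rw [axisDist_eq_zero hr]; exact hR0, hD.le⟩
      exact ⟨t, ht, e⟩
    obtain ⟨t2, ht2, hmin⟩ := hcpt.exists_isLeast hne
    refine ⟨t2, ht2.1, ht2.2, fun t ht => ?_⟩
    by_contra! hlt'
    obtain ⟨s, hs, e⟩ := intermediate_value_Icc' ht.1
      (hc1.mono (Icc_subset_Icc_right (ht.2.trans ht2.1.2))) ⟨hlt'.le, hD.le⟩
    have hs1 : t2 ≤ s := hmin ⟨⟨hs.1, hs.2.trans (ht.2.trans ht2.1.2)⟩, e⟩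
    have : t = t2 := le_antisymm ht.2 (hs1.trans hs.2)
    rw [this, ht2.2] at hlt'
    exact lt_irrefl _ hlt'
  have hfar : ∀ t ∈ Icc t1 t2, R ≤ axisDist (c t) := by
    intro t ht
    rcases le_total t t0 with h | h
    · exact h1 t ⟨ht.1, h⟩
    · exact h2 t ⟨h, ht.2⟩
  have h12 : t1 ≤ t2 := ht1.2.trans ht2.1
  have hin : ∀ t ∈ Icc t1 t2, t ∈ Icc 0 r := fun t ht =>
    ⟨ht1.1.trans ht.1, ht.2.trans ht2.2⟩
  have hstep : ∀ s ∈ Icc t1 t2, ∀ t ∈ Icc t1 t2, |s - t| ≤ 1 →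
      |axisLevel (c s) - axisLevel (c t)| ≤ 1 / (2 * K) := by
    intro s hs t ht hst
    have hp := sinh_axisLevel_le (c s) (c t) (hfar s hs) (hfar t ht) hR0
    have hd : dist (c s) (c t) ≤ K :=
      (hc s (hin s hs) t (hin t ht)).2.trans (by nlinarith)
    have h3 : Real.sinh (dist (c s) (c t) / 2) ≤ Real.sinh (K / 2) :=
      Real.sinh_le_sinh.2 (by linarith)
    have h4 : |axisLevel (c s) - axisLevel (c t)| / 2 ≤
        Real.sinh (|axisLevel (c s) - axisLevel (c t)| / 2) :=
      Real.self_le_sinh_iff.2 (by positivity)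
    have hsp : 0 < Real.sinh (K / 2) := Real.sinh_pos_iff.2 (by linarith)
    set δ := |axisLevel (c s) - axisLevel (c t)|
    have hδ : 0 ≤ δ := abs_nonneg _
    have h5 : 4 * K * Real.sinh (K / 2) * (δ / 2) ≤ Real.sinh (K / 2) :=
      calc _ ≤ Real.cosh R * (δ / 2) := mul_le_mul_of_nonneg_right hR (by positivity)
        _ ≤ Real.cosh R * Real.sinh (δ / 2) :=
            mul_le_mul_of_nonneg_left h4 (Real.cosh_pos R).le
        _ ≤ _ := hp.trans h3
    have h6 : 4 * K * (δ / 2) ≤ 1 := by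
      by_contra! hcon
      nlinarith
    rw [le_div_iff₀ (by positivity)]
    linarith
  have hlev := abs_sub_le_of_local h12 hstep
  have hdist : dist (c t1) (c t2) ≤ 2 * R + (t2 - t1 + 1) * (1 / (2 * K)) := by
    have e1 := dist_triangle4 (c t1) (axisPoint (axisLevel (c t1))) (axisPoint (axisLevel (c t2)))
      (c t2)
    rw [dist_axisPoint, dist_comm (axisPoint (axisLevel (c t2))) (c t2)] at e1
    change dist (c t1) (c t2) ≤ axisDist (c t1) + _ + axisDist (c t2) at e1
    rw [h1R, h2R] at e1
    linarith
  -- The bi-Lipschitz lower bound compares the duration with a quantity that grows with slope only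
  -- 1/2 in the duration, so the duration is bounded.
  have hT : t2 - t1 ≤ 4 * K * R + 1 := by
    have e := (hc t1 (hin t1 ⟨le_rfl, h12⟩) t2 (hin t2 ⟨h12, le_rfl⟩)).1
    rw [abs_sub_comm, abs_of_nonneg (sub_nonneg.2 h12)] at e
    have e2 : t2 - t1 ≤ K * (2 * R + (t2 - t1 + 1) * (1 / (2 * K))) :=
      e.trans (mul_le_mul_of_nonneg_left hdist (by positivity))
    have e3 : K * (2 * R + (t2 - t1 + 1) * (1 / (2 * K))) = 2 * K * R + (t2 - t1 + 1) / 2 := by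
      field_simp
    rw [e3] at e2
    linarith
  have hfin := axisDist_le (c t0) (c t1)
  have hd := (hc t0 ht0 t1 (hin t1 ⟨le_rfl, h12⟩)).2
  rw [abs_of_nonneg (sub_nonneg.2 ht1.2)] at hd
  have : K * (t0 - t1) ≤ K * (4 * K * R + 1) :=
    mul_le_mul_of_nonneg_left (by linarith [ht2.1]) (by positivity)
  linarith

/-- Morse lemma: a bi-Lipschitz path stays close to the geodesic between its endpoints. -/
lemma exists_excess_le {K : ℝ} (hK : 1 ≤ K) : ∃ H : ℝ, 0 ≤ H ∧ ∀ (r : ℝ) (c : ℝ → ℍ),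
    BiLipPath K r c → ∀ t ∈ Icc 0 r, excess (c 0) (c t) (c r) ≤ H := by
  obtain ⟨H, hH0, hH⟩ := exists_axisDist_le hK
  refine ⟨2 * (K * (K * H)) + 2 * H, by positivity, ?_⟩
  intro r c hc t ht
  wlog hax : (c 0).re = 0 ∧ (c r).re = 0 generalizing c
  · obtain ⟨g, hg⟩ := exists_smul_re_eq_zero (c 0) (c r)
    have := this (fun t => g • c t) (fun s hs t ht => by simpa [dist_smul] using hc s hs t ht) hg
    simpa [excess, dist_smul] using this
  have hnear := hH r c hc hax.1 hax.2
  have h0 : (0 : ℝ) ∈ Icc 0 r := ⟨le_rfl, ht.1.trans ht.2⟩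
  have hr : r ∈ Icc 0 r := ⟨ht.1.trans ht.2, le_rfl⟩
  have hcont : ContinuousOn (fun t => axisLevel (c t)) (Icc 0 r) :=
    continuous_axisLevel.comp_continuousOn hc.continuousOn
  have e0 := axisPoint_axisLevel hax.1
  have er := axisPoint_axisLevel hax.2
  have tri : axisLevel (c t) ∈ uIcc (axisLevel (c 0)) (axisLevel (c r)) ∨
      axisLevel (c 0) ∈ uIcc (axisLevel (c t)) (axisLevel (c r)) ∨
      axisLevel (c r) ∈ uIcc (axisLevel (c 0)) (axisLevel (c t)) := by
    simp only [mem_uIcc]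
    rcases le_total (axisLevel (c t)) (axisLevel (c 0)) with a1 | a1 <;>
    rcases le_total (axisLevel (c t)) (axisLevel (c r)) with a2 | a2 <;>
    rcases le_total (axisLevel (c 0)) (axisLevel (c r)) with a3 | a3 <;> tauto
  have hKH : 0 ≤ K * (K * H) := by positivity
  rcases tri with h | h | h
  · have d1 := dist_triangle (c 0) (axisPoint (axisLevel (c t))) (c t)
    have d2 := dist_triangle (c t) (axisPoint (axisLevel (c t))) (c r)
    have d3 : dist (c 0) (axisPoint (axisLevel (c t))) + dist (axisPoint (axisLevel (c t))) (c r) =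
        dist (c 0) (c r) := by
      have := dist_axisPoint_add h
      rwa [e0, er] at this
    have d4 := hnear t ht
    unfold axisDist at d4
    rw [dist_comm (axisPoint (axisLevel (c t))) (c t)] at d1
    unfold excess
    linarith
  -- Here the path has overshot backwards beyond `c 0`. It must return to the level of `c 0` at some
  -- later time `s`, where it is within `H` of `c 0`; then `s`, and with it `t ≤ s`, is small. The
  -- third case is the mirror image at the other end.
  · obtain ⟨s, hs, es⟩ := intermediate_value_uIcc
      (hcont.mono (by rw [uIcc_of_le ht.2]; exact Icc_subset_Icc_left ht.1)) h
    rw [uIcc_of_le ht.2] at hs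
    have hs' : s ∈ Icc 0 r := ⟨ht.1.trans hs.1, hs.2⟩
    have d1 := hnear s hs'
    simp only at es
    rw [axisDist, es, e0] at d1
    have d2 := (hc s hs' 0 h0).1
    have d3 := (hc 0 h0 t ht).2
    rw [sub_zero, abs_of_nonneg hs'.1] at d2
    rw [zero_sub, abs_neg, abs_of_nonneg ht.1] at d3
    have d4 : K * t ≤ K * (K * H) := mul_le_mul_of_nonneg_left
      (hs.1.trans (d2.trans (mul_le_mul_of_nonneg_left d1 (by positivity)))) (by positivity)
    have d5 := dist_triangle (c t) (c 0) (c r)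
    rw [dist_comm (c t) (c 0)] at d5
    unfold excess
    linarith
  · obtain ⟨s, hs, es⟩ := intermediate_value_uIcc
      (hcont.mono (by rw [uIcc_of_le ht.1]; exact Icc_subset_Icc_right ht.2)) h
    rw [uIcc_of_le ht.1] at hs
    have hs' : s ∈ Icc 0 r := ⟨hs.1, hs.2.trans ht.2⟩
    have d1 := hnear s hs'
    simp only at es
    rw [axisDist, es, er] at d1
    have d2 := (hc s hs' r hr).1
    have d3 := (hc t ht r hr).2
    rw [abs_sub_comm, abs_of_nonneg (sub_nonneg.2 hs'.2)] at d2
    rw [abs_sub_comm, abs_of_nonneg (sub_nonneg.2 ht.2)] at d3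
    have d4 : K * (r - t) ≤ K * (K * H) := mul_le_mul_of_nonneg_left
      ((sub_le_sub_left hs.2 r).trans (d2.trans (mul_le_mul_of_nonneg_left d1 (by positivity))))
      (by positivity)
    have d5 := dist_triangle (c 0) (c r) (c t)
    rw [dist_comm (c r) (c t)] at d5
    unfold excess
    linarith

/-- A point of small excess is close to any bi-Lipschitz path between the endpoints. -/
lemma exists_dist_le_of_excess {K : ℝ} (hK : 1 ≤ K) (D : ℝ) : ∃ C : ℝ, ∀ (r : ℝ) (c : ℝ → ℍ),
    0 ≤ r → BiLipPath K r c → ∀ g, excess (c 0) g (c r) ≤ D → ∃ t ∈ Icc 0 r, dist g (c t) ≤ C := by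
  obtain ⟨H, hH0, hH⟩ := exists_excess_le hK
  refine ⟨2 * max D H + 2 * Real.log 5, fun r c hr hc g hg => ?_⟩
  have hcont : ContinuousOn (fun t => dist (c 0) (c t)) (Icc 0 r) :=
    (continuous_const.dist continuous_id).comp_continuousOn hc.continuousOn
  -- The point of the path is chosen by its distance from `c 0`. The minimum is needed because `g`
  -- may lie farther from `c 0` than the endpoint, by at most `D`.
  have hm : min (dist (c 0) g) (dist (c 0) (c r)) ∈
      Icc (dist (c 0) (c 0)) (dist (c 0) (c r)) := by
    rw [dist_self]
    exact ⟨le_min dist_nonneg dist_nonneg, min_le_right _ _⟩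
  obtain ⟨t, ht, et⟩ := intermediate_value_Icc hr hcont hm
  refine ⟨t, ht, dist_le_of_excess (hg.trans (le_max_left _ _))
    ((hH r c hc t ht).trans (le_max_right _ _)) ?_⟩
  simp only at et
  rw [et]
  have h1 : dist (c 0) g ≤ dist (c 0) (c r) + D := by
    unfold excess at hg
    linarith [dist_nonneg (x := g) (y := c r)]
  have hD : D ≤ max D H := le_max_left _ _
  have h2 : (0 : ℝ) ≤ max D H := hH0.trans (le_max_right _ _)
  rcases min_cases (dist (c 0) g) (dist (c 0) (c r)) with ⟨e, h⟩ | ⟨e, h⟩ <;> rw [e, abs_le] <;>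
    constructor <;> linarith

end Hyperbolic

/-! ### Systems of disjoint lines in the plane and their electric geometry -/

section Paths

variable {Y : Type*} {lines comps : Set (Set Y)}

lemma dGel_le {n : ℕ} {A l : ℕ → Set Y} {a b : Y} (h : IsElectricPath lines comps n A l a b) :
    dGel lines comps a b ≤ n :=
  iInf₂_le n ⟨A, l, h⟩

/-- Lengths of paths are integers, so a finite infimum is attained: otherwise the next integer would
be a lower bound. -/
lemma exists_path_of_dGel_ne_top {a b : Y} (h : dGel lines comps a b ≠ ⊤) :
    ∃ (n : ℕ) (A l : ℕ → Set Y), IsElectricPath lines comps n A l a b ∧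
      (n : ℕ∞) = dGel lines comps a b := by
  obtain ⟨n, hn⟩ := ENat.ne_top_iff_exists.1 h
  by_contra! hcon
  have h2 : ((n + 1 : ℕ) : ℕ∞) ≤ dGel lines comps a b := by
    refine le_iInf₂ fun m ⟨A, l, hm⟩ => ?_
    have h3 := dGel_le hm
    rw [← hn] at h3
    have h4 : n ≤ m := by exact_mod_cast h3
    have h5 : n ≠ m := by
      rintro rfl
      exact hcon n A l hm hn
    exact_mod_cast lt_of_le_of_ne h4 h5
  rw [← hn] at h2
  have : n + 1 ≤ n := by exact_mod_cast h2
  omega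

lemma IsElectricPath.prefix {n m : ℕ} {A l : ℕ → Set Y} {a b c : Y}
    (h : IsElectricPath lines comps n A l a b) (hm : m ≤ n) (hc : c ∈ A m) :
    IsElectricPath lines comps m A l a c :=
  ⟨fun k hk => h.1 k (hk.trans hm), h.2.1, hc, fun k hk => h.2.2.2 k (hk.trans_le hm)⟩

lemma IsElectricPath.tail {n m : ℕ} {A l : ℕ → Set Y} {a b c : Y}
    (h : IsElectricPath lines comps n A l a b) (hm : m ≤ n) (hc : c ∈ A m) :
    IsElectricPath lines comps (n - m) (fun k => A (k + m)) (fun k => l (k + m)) c b := by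
  refine ⟨fun k hk => h.1 _ (by omega), by simpa using hc, ?_, fun k hk => ?_⟩
  · simpa [Nat.sub_add_cancel hm] using h.2.2.1
  · have := h.2.2.2 (k + m) (by omega)
    rwa [show k + m + 1 = k + 1 + m by omega] at this

/-- The loop between two visits to the same component is cut out. This is what prevents shortest
paths from backtracking. -/
lemma IsElectricPath.splice {n i j : ℕ} {A l : ℕ → Set Y} {a b : Y}
    (h : IsElectricPath lines comps n A l a b) (hij : i ≤ j) (hj : j ≤ n) (he : A i = A j) :
    IsElectricPath lines comps (n - (j - i)) (fun k => if k ≤ i then A k else A (k + (j - i)))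
      (fun k => if k ≤ i then l k else l (k + (j - i))) a b := by
  refine ⟨fun k hk => ?_, by simpa using h.2.1, ?_, fun k hk => ?_⟩
  · simp only
    split_ifs with h1
    · exact h.1 k (by omega)
    · exact h.1 _ (by omega)
  · simp only
    split_ifs with h1
    · have e : n = j := by omega
      have e2 : n - (j - i) = i := by omega
      rw [e2, he, ← e]
      exact h.2.2.1
    · rw [show n - (j - i) + (j - i) = n by omega]
      exact h.2.2.1
  · simp only
    rcases lt_trichotomy k i with h1 | h1 | h1
    · rw [if_pos (by omega), if_pos (by omega), if_pos (by omega)]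
      exact h.2.2.2 k (by omega)
    · rw [if_neg (by omega), if_pos (by omega), if_neg (by omega), h1, he,
        show i + 1 + (j - i) = j + 1 by omega]
      exact h.2.2.2 j (by omega)
    · rw [if_neg (by omega), if_neg (by omega), if_neg (by omega),
        show k + 1 + (j - i) = k + (j - i) + 1 by omega]
      exact h.2.2.2 _ (by omega)

/-- In a path of least length no component occurs twice. -/
lemma IsElectricPath.injective_of_minimal {n i j : ℕ} {A l : ℕ → Set Y} {a b : Y}
    (h : IsElectricPath lines comps n A l a b) (hn : (n : ℕ∞) = dGel lines comps a b)
    (hij : i < j) (hj : j ≤ n) : A i ≠ A j := by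
  intro he
  have := dGel_le (h.splice hij.le hj he)
  rw [← hn] at this
  have : n ≤ n - (j - i) := by exact_mod_cast this
  omega

end Paths

section LineSystems

variable {Y : Type*} [TopologicalSpace Y]

/-- Points of the line `l` have arbitrarily small neighbourhoods whose trace on the side `U` is
connected and accumulates to the whole trace of `l`. -/
def IsHalf (l U : Set Y) : Prop :=
  ∀ z ∈ l, ∀ O ∈ nhds z, ∃ O' ∈ nhds z, O' ⊆ O ∧ IsPreconnected (O' ∩ U) ∧
    l ∩ O' ⊆ closure (O' ∩ U)

/-- `U` and `V` are the two sides of the line `l`. -/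
structure IsSides (l U V : Set Y) : Prop where
  nonempty : l.Nonempty
  preconnected : IsPreconnected l
  isOpen_left : IsOpen U
  isOpen_right : IsOpen V
  disjoint : Disjoint U V
  union_eq : U ∪ V = lᶜ
  half_left : IsHalf l U
  half_right : IsHalf l V

namespace IsSides

variable {l U V : Set Y}

lemma symm (h : IsSides l U V) : IsSides l V U where
  nonempty := h.nonempty
  preconnected := h.preconnected
  isOpen_left := h.isOpen_right
  isOpen_right := h.isOpen_left
  disjoint := h.disjoint.symm
  union_eq := by rw [union_comm, h.union_eq]
  half_left := h.half_right
  half_right := h.half_left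

lemma isClosed (h : IsSides l U V) : IsClosed l := by
  rw [← isOpen_compl_iff, ← h.union_eq]
  exact h.isOpen_left.union h.isOpen_right

lemma not_mem_right (h : IsSides l U V) {z : Y} (hz : z ∈ U) : z ∉ V :=
  fun hv => disjoint_left.1 h.disjoint hz hv

lemma not_mem_line (h : IsSides l U V) {z : Y} (hz : z ∈ U) : z ∉ l := by
  have : z ∈ U ∪ V := Or.inl hz
  rwa [h.union_eq] at this

lemma line_not_left (h : IsSides l U V) {z : Y} (hz : z ∈ l) : z ∉ U := fun hu =>
  h.not_mem_line hu hz

lemma mem_line_of (h : IsSides l U V) {z : Y} (hu : z ∉ U) (hv : z ∉ V) : z ∈ l := by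
  by_contra hl
  have : z ∈ U ∪ V := by rw [h.union_eq]; exact hl
  exact this.elim hu hv

lemma mem_left_of (h : IsSides l U V) {z : Y} (hl : z ∉ l) (hv : z ∉ V) : z ∈ U := by
  by_contra hu
  exact hl (h.mem_line_of hu hv)

lemma subset_or (h : IsSides l U V) {C : Set Y} (hC : IsPreconnected C) (hd : Disjoint C l) :
    C ⊆ U ∨ C ⊆ V := by
  have hsub : C ⊆ U ∪ V := by rw [h.union_eq]; exact disjoint_left.1 hd
  rcases C.eq_empty_or_nonempty with rfl | ⟨z, hz⟩
  · exact Or.inl (empty_subset _)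
  rcases hsub hz with hu | hv
  · exact Or.inl (hC.subset_left_of_subset_union h.isOpen_left h.isOpen_right h.disjoint hsub
      ⟨z, hz, hu⟩)
  · exact Or.inr (hC.subset_right_of_subset_union h.isOpen_left h.isOpen_right h.disjoint hsub
      ⟨z, hz, hv⟩)

/-- A connected set with points on both sides meets the line. -/
lemma inter_nonempty (h : IsSides l U V) {C : Set Y} (hC : IsPreconnected C) {x y : Y}
    (hx : x ∈ C) (hy : y ∈ C) (h1 : ¬ (x ∈ U ∧ y ∈ U)) (h2 : ¬ (x ∈ V ∧ y ∈ V)) :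
    (C ∩ l).Nonempty := by
  by_contra hne
  rw [not_nonempty_iff_eq_empty, ← disjoint_iff_inter_eq_empty] at hne
  rcases h.subset_or hC hne with hs | hs
  · exact h1 ⟨hs hx, hs hy⟩
  · exact h2 ⟨hs hx, hs hy⟩

end IsSides

lemma isHalf_of_plane (Φ : ℝ × ℝ ≃ₜ Y) :
    IsHalf (Φ '' (univ ×ˢ {0})) (Φ '' {p | 0 < p.2}) := by
  rintro _ ⟨⟨s, y⟩, ⟨-, hy⟩, rfl⟩ O hO
  obtain rfl : y = 0 := hy
  have hO' : Φ ⁻¹' O ∈ nhds (s, (0 : ℝ)) := Φ.continuous.continuousAt hO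
  obtain ⟨ε, hε, hb⟩ := Metric.mem_nhds_iff.1 hO'
  have hint : Φ '' Metric.ball (s, (0 : ℝ)) ε ∩ Φ '' {p | 0 < p.2} =
      Φ '' (Metric.ball s ε ×ˢ Ioo 0 ε) := by
    rw [← image_inter Φ.injective]
    congr 1
    ext ⟨a, b⟩
    simp only [← ball_prod_same, mem_inter_iff, mem_prod, Metric.mem_ball, mem_ofPred_eq, mem_Ioo,
      Real.dist_eq, sub_zero]
    constructor
    · rintro ⟨⟨h1, h2⟩, h3⟩
      exact ⟨h1, h3, (le_abs_self b).trans_lt h2⟩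
    · rintro ⟨h1, h2, h3⟩
      exact ⟨⟨h1, by rwa [abs_of_pos h2]⟩, h2⟩
  refine ⟨Φ '' Metric.ball (s, 0) ε, Φ.isOpenMap.image_mem_nhds (Metric.ball_mem_nhds _ hε), ?_,
      ?_, ?_⟩
  · rintro _ ⟨p, hp, rfl⟩
    exact hb hp
  · rw [hint]
    exact (((convex_ball s ε).prod (convex_Ioo 0 ε)).isPreconnected).image _
      Φ.continuous.continuousOn
  · rw [hint, ← image_inter Φ.injective, ← Φ.image_closure, closure_prod_eq, closure_Ioo hε.ne]
    apply image_mono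
    rintro ⟨a, b⟩ ⟨⟨-, hb0⟩, hab⟩
    obtain rfl : b = 0 := hb0
    rw [← ball_prod_same] at hab
    exact ⟨subset_closure hab.1, le_rfl, hε.le⟩

lemma exists_isSides (Φ : ℝ × ℝ ≃ₜ Y) : ∃ U V, IsSides (Φ '' (univ ×ˢ {0})) U V := by
  -- The lower side is the upper side of the chart reflected in the line, so only one half has to be
  -- treated.
  let Ψ : ℝ × ℝ ≃ₜ Y := ((Homeomorph.refl ℝ).prodCongr (Homeomorph.neg ℝ)).trans Φ
  have hΨ : ∀ p, Ψ p = Φ (p.1, -p.2) := fun p => rfl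
  have e1 : Φ '' (univ ×ˢ {0}) = Ψ '' (univ ×ˢ {0}) := by
    ext z
    constructor
    · rintro ⟨⟨a, b⟩, ⟨-, hb⟩, rfl⟩
      obtain rfl : b = 0 := hb
      exact ⟨(a, 0), ⟨trivial, rfl⟩, by simp [hΨ]⟩
    · rintro ⟨⟨a, b⟩, ⟨-, hb⟩, rfl⟩
      obtain rfl : b = 0 := hb
      exact ⟨(a, 0), ⟨trivial, rfl⟩, by simp [hΨ]⟩
  have e2 : Ψ '' {p | 0 < p.2} = Φ '' {p | p.2 < 0} := by
    ext z
    constructor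
    · rintro ⟨⟨a, b⟩, hb, rfl⟩
      exact ⟨(a, -b), by simpa using hb, rfl⟩
    · rintro ⟨⟨a, b⟩, hb, rfl⟩
      exact ⟨(a, -b), by simpa using hb, by simp [hΨ]⟩
  refine ⟨Φ '' {p | 0 < p.2}, Φ '' {p | p.2 < 0}, ?_, ?_, ?_, ?_, ?_, ?_, isHalf_of_plane Φ, ?_⟩
  · exact ⟨Φ (0, 0), (0, 0), ⟨trivial, rfl⟩, rfl⟩
  · exact (isPreconnected_univ.prod isPreconnected_singleton).image _ Φ.continuous.continuousOn
  · exact Φ.isOpenMap _ (isOpen_lt continuous_const continuous_snd)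
  · exact Φ.isOpenMap _ (isOpen_lt continuous_snd continuous_const)
  · rw [disjoint_image_iff Φ.injective, disjoint_left]
    intro p hp hp'
    exact lt_asymm (show 0 < p.2 from hp) hp'
  · rw [← image_union, ← image_compl_eq Φ.bijective]
    congr 1
    ext ⟨a, b⟩
    simp only [mem_union, mem_ofPred_eq, mem_compl_iff, mem_prod, mem_univ, true_and,
      mem_singleton_iff]
    constructor
    · rintro (h | h) <;> linarith [h.ne, h.ne']
    · intro h; exact (lt_or_gt_of_ne h).symm
  · rw [e1, ← e2]
    exact isHalf_of_plane Ψ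

/-! ### Line systems and their complementary components. -/

/-- A collection of properly embedded lines, every point having a neighbourhood that meets at most
one of them. -/
structure IsLineSystem (lines : Set (Set Y)) : Prop where
  sides : ∀ l ∈ lines, ∃ U V, IsSides l U V
  separated : ∀ z, ∃ O ∈ nhds z, ∀ l ∈ lines, ∀ l' ∈ lines,
    (l ∩ O).Nonempty → (l' ∩ O).Nonempty → l = l'

/-- The closures of the complementary components of the lines. -/
def lineComponents (lines : Set (Set Y)) : Set (Set Y) :=
  {A | ∃ x ∈ (⋃₀ lines)ᶜ, A = closure (connectedComponentIn (⋃₀ lines)ᶜ x)}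

/-- Two points lie in a common component. -/
def SameComponent (lines : Set (Set Y)) (x y : Y) : Prop :=
  ∃ A ∈ lineComponents lines, x ∈ A ∧ y ∈ A

lemma SameComponent.symm {lines : Set (Set Y)} {x y : Y} (h : SameComponent lines x y) :
    SameComponent lines y x := by
  obtain ⟨A, hA, hx, hy⟩ := h
  exact ⟨A, hA, hy, hx⟩

namespace IsLineSystem

variable {lines : Set (Set Y)}

/-- Each line is closed and, near any given point, at most one of them is seen. -/
lemma isClosed_sUnion (h : IsLineSystem lines) {F : Set (Set Y)} (hF : F ⊆ lines) :
    IsClosed (⋃₀ F) := by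
  rw [← isOpen_compl_iff, isOpen_iff_mem_nhds]
  intro z hz
  obtain ⟨O, hO, hs⟩ := h.separated z
  by_cases hne : ∃ l ∈ F, (l ∩ O).Nonempty
  · obtain ⟨l, hl, hlO⟩ := hne
    obtain ⟨U, V, hUV⟩ := h.sides l (hF hl)
    have hzl : lᶜ ∈ nhds z := hUV.isClosed.isOpen_compl.mem_nhds fun hzl => hz ⟨l, hl, hzl⟩
    filter_upwards [hO, hzl] with y hy hyl
    rintro ⟨l', hl', hyl'⟩
    have := hs l' (hF hl') l (hF hl) ⟨y, hyl', hy⟩ hlO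
    exact hyl (this ▸ hyl')
  · push Not at hne
    filter_upwards [hO] with y hy
    rintro ⟨l', hl', hyl'⟩
    exact (hne l' hl').subset ⟨hyl', hy⟩

lemma eq_of_mem (h : IsLineSystem lines) {l l' : Set Y} (hl : l ∈ lines) (hl' : l' ∈ lines)
    {z : Y} (hz : z ∈ l) (hz' : z ∈ l') : l = l' := by
  obtain ⟨O, hO, hs⟩ := h.separated z
  exact hs l hl l' hl' ⟨z, hz, mem_of_mem_nhds hO⟩ ⟨z, hz', mem_of_mem_nhds hO⟩

lemma component_disjoint {l : Set Y} (hl : l ∈ lines) (x : Y) :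
    Disjoint (connectedComponentIn (⋃₀ lines)ᶜ x) l := by
  rw [disjoint_left]
  intro z hz hzl
  exact connectedComponentIn_subset _ _ hz ⟨l, hl, hzl⟩

/-- A component lies on one closed side of every line. -/
lemma component_side {l U V A : Set Y} (hl : l ∈ lines)
    (hs : IsSides l U V) (hA : A ∈ lineComponents lines) : A ⊆ Vᶜ ∨ A ⊆ Uᶜ := by
  obtain ⟨x, hx, rfl⟩ := hA
  rcases hs.subset_or isPreconnected_connectedComponentIn (component_disjoint hl x) with h1 | h1
  · left
    exact closure_minimal (h1.trans hs.disjoint.subset_compl_right) hs.isOpen_right.isClosed_compl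
  · right
    exact closure_minimal (h1.trans hs.disjoint.subset_compl_left) hs.isOpen_left.isClosed_compl

/-- A component on the `U`-side whose closure contains `z ∈ l` contains the trace of `U` near
`z`. -/
lemma component_eq {U O C : Set Y} {z x : Y} (hO : O ∈ nhds z)
    (hC : ∃ x ∈ (⋃₀ lines)ᶜ, C = connectedComponentIn (⋃₀ lines)ᶜ x) (hOC : O ∩ U ⊆ C)
    (hzx : z ∈ closure (connectedComponentIn (⋃₀ lines)ᶜ x))
    (hsub : connectedComponentIn (⋃₀ lines)ᶜ x ⊆ U) :
    connectedComponentIn (⋃₀ lines)ᶜ x = C := by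
  obtain ⟨y, hyO, hy⟩ := mem_closure_iff_nhds.1 hzx O hO
  obtain ⟨x', hx', rfl⟩ := hC
  have h1 := hOC ⟨hyO, hsub hy⟩
  rw [connectedComponentIn_eq hy, connectedComponentIn_eq h1]

lemma isOpen_component [LocallyConnectedSpace Y] (h : IsLineSystem lines) (x : Y) :
    IsOpen (connectedComponentIn (⋃₀ lines)ᶜ x) :=
  (h.isClosed_sUnion le_rfl).isOpen_compl.connectedComponentIn

/-- Near a point of the line `l`, only `l` is met, and the trace of the side `U` lies in one
component. -/
lemma exists_box (h : IsLineSystem lines) {l U V : Set Y} (hl : l ∈ lines)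
    (hs : IsSides l U V) {z : Y} (hz : z ∈ l) : ∃ O ∈ nhds z, ∃ C : Set Y,
      (∃ x ∈ (⋃₀ lines)ᶜ, C = connectedComponentIn (⋃₀ lines)ᶜ x) ∧ O ∩ U ⊆ C ∧ C ⊆ U ∧
      l ∩ O ⊆ closure C ∧ ∀ l' ∈ lines, (l' ∩ O).Nonempty → l' = l := by
  obtain ⟨O, hO, hsep⟩ := h.separated z
  obtain ⟨O', hO', hsub, hpc, hcl⟩ := hs.half_left z hz O hO
  have hz' : z ∈ closure (O' ∩ U) := hcl ⟨hz, mem_of_mem_nhds hO'⟩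
  obtain ⟨x, hx⟩ := closure_nonempty_iff.1 ⟨z, hz'⟩
  have huniq : ∀ l' ∈ lines, (l' ∩ O').Nonempty → l' = l := by
    rintro l' hl' ⟨y, hy, hyO⟩
    exact hsep l' hl' l hl ⟨y, hy, hsub hyO⟩ ⟨z, hz, mem_of_mem_nhds hO⟩
  have hcompl : O' ∩ U ⊆ (⋃₀ lines)ᶜ := by
    rintro y ⟨hyO, hyU⟩ ⟨l', hl', hyl'⟩
    rw [huniq l' hl' ⟨y, hyl', hyO⟩] at hyl'
    exact hs.not_mem_line hyU hyl'
  have hsubC := hpc.subset_connectedComponentIn hx hcompl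
  refine ⟨O', hO', _, ⟨x, hcompl hx, rfl⟩, hsubC, ?_, hcl.trans (closure_mono hsubC), huniq⟩
  rcases hs.subset_or isPreconnected_connectedComponentIn (component_disjoint hl x) with h1 | h1
  · exact h1
  · exact absurd (h1 (hsubC hx)) (hs.not_mem_right hx.2)

/-- A component that meets a line contains it. -/
lemma line_subset [LocallyConnectedSpace Y] (h : IsLineSystem lines) {l A : Set Y} (hl : l ∈ lines)
    (hA : A ∈ lineComponents lines) {z : Y} (hz : z ∈ l) (hzA : z ∈ A) : l ⊆ A := by
  obtain ⟨U, V, hs⟩ := h.sides l hl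
  obtain ⟨x, hx, rfl⟩ := hA
  wlog hside : connectedComponentIn (⋃₀ lines)ᶜ x ⊆ U generalizing U V
  · refine this V U hs.symm ?_
    exact (hs.subset_or isPreconnected_connectedComponentIn (component_disjoint hl x)).resolve_left
      hside
  -- The part of `l` in the closed component is closed, and it is open in `l` since all of `l` near
  -- one of its points bounds the same component on the side `U`. As `l` is connected, that part is
  -- everything.
  have hopen : ∀ y ∈ l, y ∈ closure (connectedComponentIn (⋃₀ lines)ᶜ x) →
      ∃ O ∈ nhds y, l ∩ O ⊆ closure (connectedComponentIn (⋃₀ lines)ᶜ x) := by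
    intro y hy hyC
    obtain ⟨O, hO, C, hC, hOC, -, hcl, -⟩ := h.exists_box hl hs hy
    have := component_eq hO hC hOC hyC hside
    exact ⟨O, hO, this ▸ hcl⟩
  intro y hy
  by_contra hyA
  have := hs.preconnected
  let W : Set Y := interior {w | w ∈ l → w ∈ closure (connectedComponentIn (⋃₀ lines)ᶜ x)}
  have hW : ∀ w ∈ l, w ∈ closure (connectedComponentIn (⋃₀ lines)ᶜ x) → w ∈ W := by
    intro w hw hwC
    obtain ⟨O, hO, hsub⟩ := hopen w hw hwC
    rw [mem_interior_iff_mem_nhds]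
    filter_upwards [hO] with v hv hvl using hsub ⟨hvl, hv⟩
  obtain ⟨w, hw, hwW, hwA⟩ := this W (closure (connectedComponentIn (⋃₀ lines)ᶜ x))ᶜ isOpen_interior
    isClosed_closure.isOpen_compl
    (fun w hw => by
      by_cases hwC : w ∈ closure (connectedComponentIn (⋃₀ lines)ᶜ x)
      · exact Or.inl (hW w hw hwC)
      · exact Or.inr hwC) ⟨z, hz, hW z hz hzA⟩ ⟨y, hy, hyA⟩
  exact hwA (interior_subset hwW hw)

/-- There is only one component on a given side of a line that contains the line. -/
lemma component_unique [LocallyConnectedSpace Y] (h : IsLineSystem lines) {l U V A B : Set Y}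
    (hl : l ∈ lines)
    (hs : IsSides l U V) (hA : A ∈ lineComponents lines) (hB : B ∈ lineComponents lines)
    (hAV : A ⊆ Vᶜ) (hBV : B ⊆ Vᶜ) (hlA : l ⊆ A) (hlB : l ⊆ B) : A = B := by
  obtain ⟨x, hx, rfl⟩ := hA
  obtain ⟨y, hy, rfl⟩ := hB
  obtain ⟨z, hz⟩ := hs.nonempty
  obtain ⟨O, hO, C, hC, hOC, -, -, -⟩ := h.exists_box hl hs hz
  have key : ∀ w ∈ (⋃₀ lines)ᶜ, closure (connectedComponentIn (⋃₀ lines)ᶜ w) ⊆ Vᶜ →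
      l ⊆ closure (connectedComponentIn (⋃₀ lines)ᶜ w) →
      connectedComponentIn (⋃₀ lines)ᶜ w = C := by
    intro w hw hwV hlw
    refine component_eq hO hC hOC (hlw hz) ?_
    refine (hs.subset_or isPreconnected_connectedComponentIn
      (component_disjoint hl w)).resolve_right fun hV => ?_
    exact hwV (subset_closure (mem_connectedComponentIn hw)) (hV (mem_connectedComponentIn hw))
  rw [key x hx hAV hlA, key y hy hBV hlB]

/-- On each side of a line there is a component that contains the line. -/
lemma exists_component [LocallyConnectedSpace Y] (h : IsLineSystem lines) {l U V : Set Y}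
    (hl : l ∈ lines)
    (hs : IsSides l U V) : ∃ A ∈ lineComponents lines, A ⊆ Vᶜ ∧ l ⊆ A := by
  obtain ⟨z, hz⟩ := hs.nonempty
  obtain ⟨O, hO, C, ⟨x, hx, rfl⟩, hOC, hCU, hcl, -⟩ := h.exists_box hl hs hz
  have hA : closure (connectedComponentIn (⋃₀ lines)ᶜ x) ∈ lineComponents lines := ⟨x, hx, rfl⟩
  exact ⟨_, hA, closure_minimal (hCU.trans hs.disjoint.subset_compl_right)
    hs.isOpen_right.isClosed_compl, h.line_subset hl hA hz (hcl ⟨hz, mem_of_mem_nhds hO⟩)⟩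

/-- Complementary components are open, so one that accumulates at a point of another must coincide
with it. -/
lemma component_eq_of_not_mem [LocallyConnectedSpace Y] (h : IsLineSystem lines) {A : Set Y} {z : Y}
    (hA : A ∈ lineComponents lines) {y : Y} (hy : y ∈ connectedComponentIn (⋃₀ lines)ᶜ z)
    (hyA : y ∈ A) : A = closure (connectedComponentIn (⋃₀ lines)ᶜ z) := by
  obtain ⟨x, hx, rfl⟩ := hA
  obtain ⟨w, hw, hwx⟩ := mem_closure_iff_nhds.1 hyA _ ((h.isOpen_component z).mem_nhds hy)
  rw [connectedComponentIn_eq hw, connectedComponentIn_eq hwx]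

/-- Every point lies in some component. -/
lemma exists_mem_component [LocallyConnectedSpace Y] (h : IsLineSystem lines) (z : Y) :
    ∃ A ∈ lineComponents lines, z ∈ A := by
  by_cases hz : z ∈ ⋃₀ lines
  · obtain ⟨l, hl, hzl⟩ := hz
    obtain ⟨U, V, hs⟩ := h.sides l hl
    obtain ⟨A, hA, -, hlA⟩ := h.exists_component hl hs
    exact ⟨A, hA, hlA hzl⟩
  · exact ⟨_, ⟨z, hz, rfl⟩, subset_closure (mem_connectedComponentIn hz)⟩

/-- Every point has a neighbourhood that meets only the components through the point. -/
lemma exists_nhds_component [LocallyConnectedSpace Y] (h : IsLineSystem lines) (z : Y) : ∃ O ∈ nhds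
    z,
    ∀ A ∈ lineComponents lines, ∀ y ∈ O, y ∈ A → z ∈ A := by
  by_cases hz : z ∈ ⋃₀ lines
  · obtain ⟨l, hl, hzl⟩ := hz
    obtain ⟨U, V, hs⟩ := h.sides l hl
    obtain ⟨O1, hO1, C1, hC1, hOC1, hCU1, hcl1, hu⟩ := h.exists_box hl hs hzl
    obtain ⟨O2, hO2, C2, hC2, hOC2, hCU2, hcl2, -⟩ := h.exists_box hl hs.symm hzl
    refine ⟨interior (O1 ∩ O2), interior_mem_nhds.2 (Filter.inter_mem hO1 hO2), ?_⟩
    intro A hA y hy hyA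
    by_cases hyl : y ∈ l
    · exact h.line_subset hl hA hyl hyA hzl
    have hyO := interior_subset hy
    obtain ⟨x, hx, rfl⟩ := hA
    obtain ⟨w, hw, hwx⟩ := mem_closure_iff_nhds.1 hyA _ (isOpen_interior.mem_nhds hy)
    have hwO := interior_subset hw
    have hwl : w ∉ l := fun hwl => disjoint_left.1 (component_disjoint hl x) hwx hwl
    by_cases hwU : w ∈ U
    · obtain ⟨x', hx', rfl⟩ := hC1
      rw [connectedComponentIn_eq hwx, ← connectedComponentIn_eq (hOC1 ⟨hwO.1, hwU⟩)]
      exact hcl1 ⟨hzl, mem_of_mem_nhds hO1⟩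
    · have hwV : w ∈ V := hs.symm.mem_left_of hwl hwU
      obtain ⟨x', hx', rfl⟩ := hC2
      rw [connectedComponentIn_eq hwx, ← connectedComponentIn_eq (hOC2 ⟨hwO.2, hwV⟩)]
      exact hcl2 ⟨hzl, mem_of_mem_nhds hO2⟩
  · refine ⟨_, (h.isOpen_component z).mem_nhds (mem_connectedComponentIn hz), ?_⟩
    intro A hA y hy hyA
    rw [h.component_eq_of_not_mem hA hy hyA]
    exact subset_closure (mem_connectedComponentIn hz)

/-- Two components through a point agree or share a line. -/
lemma eq_or_exists_line [LocallyConnectedSpace Y] (h : IsLineSystem lines) {A B : Set Y}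
    (hA : A ∈ lineComponents lines)
    (hB : B ∈ lineComponents lines) {z : Y} (hzA : z ∈ A) (hzB : z ∈ B) :
    A = B ∨ ∃ l ∈ lines, l ⊆ A ∩ B := by
  by_cases hz : z ∈ ⋃₀ lines
  · obtain ⟨l, hl, hzl⟩ := hz
    exact Or.inr ⟨l, hl, subset_inter (h.line_subset hl hA hzl hzA) (h.line_subset hl hB hzl hzB)⟩
  · left
    rw [h.component_eq_of_not_mem hA (mem_connectedComponentIn hz) hzA,
      h.component_eq_of_not_mem hB (mem_connectedComponentIn hz) hzB]

/-- Any two points are joined by an electric path. -/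
lemma dGel_ne_top [LocallyConnectedSpace Y] [PreconnectedSpace Y] (h : IsLineSystem lines)
    (x y : Y) :
    dGel lines (lineComponents lines) x y ≠ ⊤ := by
  -- The set of points reachable from `x` is open and closed, because near any point only the
  -- components through that point are seen; the plane is connected.
  let R : Set Y := {y | ∃ n A l, IsElectricPath lines (lineComponents lines) n A l x y}
  have hstep : ∀ z w, z ∈ R → ∀ B ∈ lineComponents lines, z ∈ B → w ∈ B → w ∈ R := by
    rintro z w ⟨n, A, l, hp⟩ B hB hz hw
    rcases h.eq_or_exists_line (hp.1 n le_rfl) hB hp.2.2.1 hz with rfl | ⟨m, hm, hmAB⟩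
    · exact ⟨n, A, l, hp.1, hp.2.1, hw, hp.2.2.2⟩
    · refine ⟨n + 1, fun k => if k ≤ n then A k else B, fun k => if k ≤ n then l k else m,
        fun k hk => ?_, ?_, ?_, fun k hk => ?_⟩
      · simp only
        split_ifs with h1
        · exact hp.1 k h1
        · exact hB
      · simpa using hp.2.1
      · simpa using hw
      · simp only
        rcases Nat.lt_succ_iff_lt_or_eq.1 hk with h1 | rfl
        · rw [if_pos (by omega), if_pos (by omega), if_pos (by omega)]
          exact hp.2.2.2 k h1
        · rw [if_neg (by omega), if_pos (by omega), if_neg (by omega)]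
          exact ⟨hm, hmAB⟩
  have hopen : IsOpen R := by
    rw [isOpen_iff_mem_nhds]
    intro z hz
    obtain ⟨O, hO, hOB⟩ := h.exists_nhds_component z
    filter_upwards [hO] with w hw
    obtain ⟨B, hB, hwB⟩ := h.exists_mem_component w
    exact hstep z w hz B hB (hOB B hB w hw hwB) hwB
  have hclosed : IsClosed R := by
    rw [← isOpen_compl_iff, isOpen_iff_mem_nhds]
    intro z hz
    obtain ⟨O, hO, hOB⟩ := h.exists_nhds_component z
    filter_upwards [hO] with w hw hwR
    obtain ⟨B, hB, hwB⟩ := h.exists_mem_component w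
    exact hz (hstep w z hwR B hB hwB (hOB B hB w hw hwB))
  have hx : x ∈ R := by
    obtain ⟨B, hB, hxB⟩ := h.exists_mem_component x
    exact ⟨0, fun _ => B, fun _ => ∅, fun _ _ => hB, hxB, hxB, fun k hk => absurd hk (by omega)⟩
  have hR : R = univ := IsClopen.eq_univ ⟨hclosed, hopen⟩ ⟨x, hx⟩
  obtain ⟨n, A, l, hp⟩ : y ∈ R := hR ▸ mem_univ y
  exact ne_top_of_le_ne_top (ENat.natCast_ne_top n) (dGel_le hp)

lemma exists_minimal_path [LocallyConnectedSpace Y] [PreconnectedSpace Y] (h : IsLineSystem lines)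
    (x y : Y) :
    ∃ (n : ℕ) (A l : ℕ → Set Y), IsElectricPath lines (lineComponents lines) n A l x y ∧
      (n : ℕ∞) = dGel lines (lineComponents lines) x y :=
  exists_path_of_dGel_ne_top (h.dGel_ne_top x y)

lemma sameComponent_of_dGel_eq_zero {x y : Y}
    (h0 : dGel lines (lineComponents lines) x y = 0) : SameComponent lines x y := by
  obtain ⟨n, A, l, hp, hn⟩ := exists_path_of_dGel_ne_top (h0 ▸ ENat.zero_ne_top)
  rw [h0] at hn
  obtain rfl : n = 0 := by exact_mod_cast hn
  exact ⟨A 0, hp.1 0 le_rfl, hp.2.1, hp.2.2.1⟩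

lemma _root_.SameComponent.dGel_eq_zero {x y : Y} (h : SameComponent lines x y) :
    dGel lines (lineComponents lines) x y = 0 := by
  obtain ⟨A, hA, hx, hy⟩ := h
  have hp : IsElectricPath lines (lineComponents lines) 0 (fun _ => A) (fun _ => ∅) x y :=
    ⟨fun _ _ => hA, hx, hy, fun k hk => absurd hk (by omega)⟩
  simpa using dGel_le hp

/-- Crossing from one side of `l` to the other happens through `l`. -/
lemma eq_of_cross (h : IsLineSystem lines) {l l' U V A B : Set Y} (hl : l ∈ lines)
    (hs : IsSides l U V) (hl' : l' ∈ lines) (hB : B ∈ lineComponents lines) (hlAB : l' ⊆ A ∩ B)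
    (hA : A ⊆ Vᶜ) (hBV : ¬ B ⊆ Vᶜ) : l' = l := by
  obtain ⟨_, _, hs'⟩ := h.sides l' hl'
  obtain ⟨z, hz⟩ := hs'.nonempty
  by_contra hne
  have hzl : z ∉ l := fun hzl => hne (h.eq_of_mem hl' hl hz hzl)
  have hzU := hs.mem_left_of hzl (hA (hlAB hz).1)
  exact (component_side hl hs hB).resolve_left hBV (hlAB hz).2 hzU

/-- A path of components that passes from one side of `l` to the other crosses `l`. -/
lemma exists_cross [LocallyConnectedSpace Y] (h : IsLineSystem lines) {l U V : Set Y}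
    (hl : l ∈ lines)
    (hs : IsSides l U V) {n : ℕ} {A m : ℕ → Set Y} {x y : Y}
    (hp : IsElectricPath lines (lineComponents lines) n A m x y) {i j : ℕ} (hij : i ≤ j)
    (hj : j ≤ n) (hi : A i ⊆ Vᶜ) (hjV : ¬ A j ⊆ Vᶜ) :
    ∃ k, i ≤ k ∧ k < j ∧ A k ⊆ Vᶜ ∧ ¬ A (k + 1) ⊆ Vᶜ ∧ m (k + 1) = l := by
  have : ∃ k, i ≤ k ∧ k < j ∧ A k ⊆ Vᶜ ∧ ¬ A (k + 1) ⊆ Vᶜ := by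
    by_contra! hcon
    have : ∀ d, i + d ≤ j → A (i + d) ⊆ Vᶜ := by
      intro d
      induction d with
      | zero => intro _; exact hi
      | succ d ih => intro hd; exact hcon (i + d) (by omega) (by omega) (ih (by omega))
    exact hjV (by simpa [Nat.add_sub_cancel' hij] using this (j - i) (by omega))
  obtain ⟨k, h1, h2, h3, h4⟩ := this
  have h5 := hp.2.2.2 k (by omega)
  exact ⟨k, h1, h2, h3, h4, h.eq_of_cross hl hs h5.1 (hp.1 (k + 1) (by omega)) h5.2 h3 h4⟩

lemma exists_cross_back [LocallyConnectedSpace Y] (h : IsLineSystem lines) {l U V : Set Y}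
    (hl : l ∈ lines)
    (hs : IsSides l U V) {n : ℕ} {A m : ℕ → Set Y} {x y : Y}
    (hp : IsElectricPath lines (lineComponents lines) n A m x y) {i j : ℕ} (hij : i ≤ j)
    (hj : j ≤ n) (hi : ¬ A i ⊆ Vᶜ) (hjV : A j ⊆ Vᶜ) :
    ∃ k, i ≤ k ∧ k < j ∧ ¬ A k ⊆ Vᶜ ∧ A (k + 1) ⊆ Vᶜ ∧ m (k + 1) = l := by
  have : ∃ k, i ≤ k ∧ k < j ∧ ¬ A k ⊆ Vᶜ ∧ A (k + 1) ⊆ Vᶜ := by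
    by_contra! hcon
    have : ∀ d, i + d ≤ j → ¬ A (i + d) ⊆ Vᶜ := by
      intro d
      induction d with
      | zero => intro _; exact hi
      | succ d ih => intro hd; exact hcon (i + d) (by omega) (by omega) (ih (by omega))
    exact this (j - i) (by omega) (by simpa [Nat.add_sub_cancel' hij] using hjV)
  obtain ⟨k, h1, h2, h3, h4⟩ := this
  have h5 := hp.2.2.2 k (by omega)
  exact ⟨k, h1, h2, h3, h4, h.eq_of_cross hl hs h5.1 (hp.1 k (by omega))
    (by rw [inter_comm]; exact h5.2) h4 h3⟩

lemma subset_compl_right_of_mem {l U V A : Set Y} (hl : l ∈ lines) (hs : IsSides l U V)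
    (hA : A ∈ lineComponents lines) {z : Y} (hz : z ∈ A) (hzU : z ∈ U) : A ⊆ Vᶜ :=
  (component_side hl hs hA).resolve_right fun hA' => hA' hz hzU

/-- A shortest path between two points on one side of a line stays on that side. -/
lemma minimal_path_side [LocallyConnectedSpace Y] (h : IsLineSystem lines) {l U V : Set Y}
    (hl : l ∈ lines)
    (hs : IsSides l U V) {n : ℕ} {A m : ℕ → Set Y} {x y : Y}
    (hp : IsElectricPath lines (lineComponents lines) n A m x y)
    (hn : (n : ℕ∞) = dGel lines (lineComponents lines) x y) (hx : x ∈ U) (hy : y ∈ U) {k : ℕ}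
    (hk : k ≤ n) : A k ⊆ Vᶜ := by
  by_contra hkV
  obtain ⟨i, -, hik, hi, -, hli⟩ := h.exists_cross hl hs hp (Nat.zero_le k) hk
    (subset_compl_right_of_mem hl hs (hp.1 0 (Nat.zero_le _)) hp.2.1 hx) hkV
  obtain ⟨j, hkj, hjn, -, hj, hlj⟩ := h.exists_cross_back hl hs hp hk le_rfl hkV
    (subset_compl_right_of_mem hl hs (hp.1 n le_rfl) hp.2.2.1 hy)
  have h1 := (hp.2.2.2 i (by omega)).2
  have h2 := (hp.2.2.2 j (by omega)).2
  rw [hli] at h1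
  rw [hlj] at h2
  -- The path leaves through `l` and comes back through `l`. Before and after, it is in the unique
  -- component on the near side containing `l`, so a component is repeated.
  exact hp.injective_of_minimal hn (i := i) (j := j + 1) (by omega) (by omega)
    (h.component_unique hl hs (hp.1 i (by omega)) (hp.1 (j + 1) (by omega)) hi hj
      (h1.trans inter_subset_left) (h2.trans inter_subset_right))

/-- Points in different components are separated by a line adjacent to the first of them. -/
lemma exists_separating [LocallyConnectedSpace Y] [PreconnectedSpace Y] (h : IsLineSystem lines)
    {q p : Y}
    (hqp : ¬ SameComponent lines q p) : ∃ l ∈ lines, ∃ U V, IsSides l U V ∧ q ∈ U ∧ p ∈ V ∧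
      ∃ B ∈ lineComponents lines, q ∈ B ∧ l ⊆ B := by
  obtain ⟨n, A, m, hp, hn⟩ := h.exists_minimal_path q p
  have hn0 : 0 < n := by
    rcases Nat.eq_zero_or_pos n with rfl | h0
    · exact absurd ⟨A 0, hp.1 0 le_rfl, hp.2.1, hp.2.2.1⟩ hqp
    · exact h0
  obtain ⟨hm, hmAB⟩ := hp.2.2.2 0 hn0
  have hA0 := hp.1 0 (Nat.zero_le _)
  have hA1 := hp.1 1 hn0
  obtain ⟨U, V, hs, hAV⟩ : ∃ U V, IsSides (m 1) U V ∧ A 0 ⊆ Vᶜ := by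
    obtain ⟨U, V, hs⟩ := h.sides _ hm
    rcases component_side hm hs hA0 with h1 | h1
    · exact ⟨U, V, hs, h1⟩
    · exact ⟨V, U, hs.symm, h1⟩
  have hm0 : m 1 ⊆ A 0 := hmAB.trans inter_subset_left
  have hm1 : m 1 ⊆ A 1 := hmAB.trans inter_subset_right
  -- The separating line is the first one that a shortest path from `q` to `p` crosses. Crossing it
  -- back would mean entering `A 0` a second time.
  have hall : ∀ j, 1 ≤ j → j ≤ n → ¬ A j ⊆ Vᶜ := by
    intro j h1 hj hjV
    have hA1V : ¬ A 1 ⊆ Vᶜ := fun h1V => hp.injective_of_minimal hn zero_lt_one hn0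
      (h.component_unique hm hs hA0 hA1 hAV h1V hm0 hm1)
    obtain ⟨k, hk1, hkj, -, hk, hlk⟩ := h.exists_cross_back hm hs hp h1 hj hA1V hjV
    have h2 := (hp.2.2.2 k (by omega)).2
    rw [hlk] at h2
    exact hp.injective_of_minimal hn (i := 0) (j := k + 1) (by omega) (by omega)
      (h.component_unique hm hs hA0 (hp.1 (k + 1) (by omega)) hAV hk hm0
        (h2.trans inter_subset_right))
  refine ⟨m 1, hm, U, V, hs, hs.mem_left_of (fun hq => ?_) (hAV hp.2.1),
    hs.symm.mem_left_of (fun hpm => hqp ⟨A 0, hA0, hp.2.1, hm0 hpm⟩) ?_, A 0, hA0, hp.2.1, hm0⟩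
  · have := dGel_le (hp.tail hn0 (hm1 hq))
    rw [← hn] at this
    have : n ≤ n - 1 := by exact_mod_cast this
    omega
  · exact (component_side hm hs (hp.1 n le_rfl)).resolve_left (hall n hn0 le_rfl) hp.2.2.1

/-- A point beyond the line `l` is electrically farther away than the points of `l`. -/
lemma dGel_lt [LocallyConnectedSpace Y] [PreconnectedSpace Y] (h : IsLineSystem lines)
    {l U V : Set Y} (hl : l ∈ lines)
    (hs : IsSides l U V) {x q w : Y} (hx : x ∈ U) (hq : q ∈ V) (hw : w ∈ l) :
    dGel lines (lineComponents lines) x w < dGel lines (lineComponents lines) x q := by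
  obtain ⟨n, A, m, hp, hn⟩ := h.exists_minimal_path x q
  obtain ⟨k, -, hkn, -, -, hlk⟩ := h.exists_cross hl hs hp (Nat.zero_le n) le_rfl
    (subset_compl_right_of_mem hl hs (hp.1 0 (Nat.zero_le _)) hp.2.1 hx)
    (fun hV => hV hp.2.2.1 hq)
  have h1 := (hp.2.2.2 k hkn).2
  rw [hlk] at h1
  rw [← hn]
  exact (dGel_le (hp.prefix hkn.le (h1 hw).1)).trans_lt (by exact_mod_cast hkn)

/-- A point on the same closed side of every line as a component belongs to it. -/
lemma mem_component_of_sides [LocallyConnectedSpace Y] [PreconnectedSpace Y]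
    (h : IsLineSystem lines) {A : Set Y}
    (hA : A ∈ lineComponents lines) {z : Y}
    (hz : ∀ l ∈ lines, ∀ U V, IsSides l U V → A ⊆ Vᶜ → z ∈ Vᶜ) : z ∈ A := by
  obtain ⟨x, hx, rfl⟩ := hA
  have hA' : closure (connectedComponentIn (⋃₀ lines)ᶜ x) ∈ lineComponents lines := ⟨x, hx, rfl⟩
  by_contra hzA
  have hns : ¬ SameComponent lines x z := by
    rintro ⟨B, hB, hxB, hzB⟩
    rw [h.component_eq_of_not_mem hB (mem_connectedComponentIn hx) hxB] at hzB
    exact hzA hzB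
  obtain ⟨l, hl, U, V, hs, hxU, hzV, -⟩ := h.exists_separating hns
  exact hz l hl U V hs (subset_compl_right_of_mem hl hs hA'
    (subset_closure (mem_connectedComponentIn hx)) hxU) hzV

/-- Electric balls are closed. -/
lemma isClosed_dGel_le [LocallyConnectedSpace Y] (h : IsLineSystem lines) (x : Y) (m : ℕ∞) :
    IsClosed {y | dGel lines (lineComponents lines) x y ≤ m} := by
  rw [← isOpen_compl_iff, isOpen_iff_mem_nhds]
  intro z hz
  obtain ⟨O, hO, hOB⟩ := h.exists_nhds_component z
  filter_upwards [hO] with w hw hwm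
  -- Components through `w` near `z` also contain `z`, so a path to `w` is a path to `z`: the
  -- electric distance is lower semicontinuous.
  refine hz (le_trans ?_ (show dGel lines (lineComponents lines) x w ≤ m from hwm))
  by_cases htop : dGel lines (lineComponents lines) x w = ⊤
  · rw [htop]; exact le_top
  obtain ⟨n, A, l, hp, hn⟩ := exists_path_of_dGel_ne_top htop
  rw [← hn]
  exact dGel_le (hp.prefix le_rfl (hOB _ (hp.1 n le_rfl) w hw hp.2.2.1))

end IsLineSystem

end LineSystems

/-! ### Geodesic metrics on the plane that are bi-Lipschitz to the hyperbolic metric -/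

section SheetMetrics

/-- `r` is a length metric on `ℍ` that is `K`-bi-Lipschitz to the pullback of the hyperbolic metric
by `f`. -/
structure IsSheetMetric (K : ℝ) (f : ℍ ≃ₜ ℍ) (r : ℍ → ℍ → ℝ) : Prop where
  one_le : 1 ≤ K
  symm : ∀ z w, r z w = r w z
  triangle : ∀ x y z, r x z ≤ r x y + r y z
  lower : ∀ z w, dist (f z) (f w) ≤ K * r z w
  upper : ∀ z w, r z w ≤ K * dist (f z) (f w)
  approx : ∀ a b, ∀ ε > 0, ∃ c : ℝ → ℍ, ContinuousOn c (Icc 0 1) ∧ c 0 = a ∧ c 1 = b ∧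
    ∀ s ∈ Icc (0 : ℝ) 1, ∀ t ∈ Icc (0 : ℝ) 1, s ≤ t →
      r a (c s) + r (c s) (c t) + r (c t) b ≤ r a b + ε

/-- Geodesic segments of a real-valued distance. -/
def IsGeod (r : ℍ → ℍ → ℝ) (s : Set ℍ) (u v : ℍ) : Prop :=
  ∃ (T : ℝ) (c : ℝ → ℍ), 0 ≤ T ∧ c 0 = u ∧ c T = v ∧
    (∀ t ∈ Icc 0 T, ∀ t' ∈ Icc 0 T, r (c t) (c t') = |t - t'|) ∧ s = c '' Icc 0 T

namespace IsSheetMetric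

variable {K : ℝ} {f : ℍ ≃ₜ ℍ} {r : ℍ → ℍ → ℝ}

lemma pos (h : IsSheetMetric K f r) : 0 < K := zero_lt_one.trans_le h.one_le

lemma nonneg (h : IsSheetMetric K f r) (z w : ℍ) : 0 ≤ r z w := by
  have := dist_nonneg.trans (h.lower z w)
  exact (mul_nonneg_iff_of_pos_left h.pos).1 this

lemma self (h : IsSheetMetric K f r) (z : ℍ) : r z z = 0 :=
  le_antisymm (by simpa using h.upper z z) (h.nonneg z z)

lemma eq_of_zero (h : IsSheetMetric K f r) {z w : ℍ} (h0 : r z w = 0) : z = w := by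
  have := h.lower z w
  rw [h0, mul_zero] at this
  exact f.injective (dist_le_zero.1 this)

lemma continuous (h : IsSheetMetric K f r) : Continuous fun p : ℍ × ℍ => r p.1 p.2 := by
  rw [continuous_iff_continuousAt]
  intro p
  rw [ContinuousAt, tendsto_iff_dist_tendsto_zero]
  have hg : Filter.Tendsto (fun q : ℍ × ℍ => K * dist (f q.1) (f p.1) + K * dist (f q.2) (f p.2))
      (nhds p) (nhds 0) := by
    have : Continuous fun q : ℍ × ℍ => K * dist (f q.1) (f p.1) + K * dist (f q.2) (f p.2) := by
      have := f.continuous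
      fun_prop
    simpa using this.tendsto p
  refine squeeze_zero (fun _ => dist_nonneg) (fun q => ?_) hg
  have h1 := h.triangle q.1 p.1 q.2
  have h2 := h.triangle p.1 p.2 q.2
  have h3 := h.triangle p.1 q.1 p.2
  have h4 := h.triangle q.1 q.2 p.2
  have h5 := h.upper q.1 p.1
  have h6 := h.upper q.2 p.2
  rw [h.symm p.1 q.1] at h3
  rw [h.symm p.2 q.2] at h2
  rw [Real.dist_eq, abs_le]
  constructor <;> linarith

lemma continuous_left (h : IsSheetMetric K f r) (a : ℍ) : Continuous (r a) :=
  h.continuous.comp (Continuous.prodMk_right a)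

lemma isCompact_ball (h : IsSheetMetric K f r) (a : ℍ) (R : ℝ) : IsCompact {z | r a z ≤ R} := by
  have hc : IsClosed {z | r a z ≤ R} := isClosed_le (h.continuous_left a) continuous_const
  have hk : IsCompact (f ⁻¹' Metric.closedBall (f a) (K * R)) :=
    f.isCompact_preimage.2 (isCompact_closedBall _ _)
  refine hk.of_isClosed_subset hc fun z hz => ?_
  rw [mem_preimage, Metric.mem_closedBall, dist_comm]
  exact (h.lower a z).trans (mul_le_mul_of_nonneg_left hz h.pos.le)

/-- If some stretch were shortened, the triangle inequality would make the endpoints closer than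
`T`. -/
lemma eq_abs_of_le (h : IsSheetMetric K f r) {c : ℝ → ℍ} {T : ℝ} (hT : T ≤ r (c 0) (c T))
    (hle : ∀ t ∈ Icc 0 T, ∀ t' ∈ Icc 0 T, t ≤ t' → r (c t) (c t') ≤ t' - t) :
    ∀ t ∈ Icc 0 T, ∀ t' ∈ Icc 0 T, r (c t) (c t') = |t - t'| := by
  intro t ht t' ht'
  wlog htt : t ≤ t' generalizing t t'
  · rw [h.symm, abs_sub_comm]
    exact this t' ht' t ht (le_of_not_ge htt)
  have h0 : (0 : ℝ) ∈ Icc 0 T := ⟨le_rfl, ht.1.trans ht.2⟩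
  have hT' : T ∈ Icc 0 T := ⟨ht.1.trans ht.2, le_rfl⟩
  have h1 := hle t ht t' ht' htt
  have h2 := hle 0 h0 t ht ht.1
  have h3 := hle t' ht' T hT' ht'.2
  have h4 := h.triangle (c 0) (c t) (c T)
  have h5 := h.triangle (c t) (c t') (c T)
  rw [abs_sub_comm, abs_of_nonneg (sub_nonneg.2 htt)]
  linarith

/-- The metric is geodesic. -/
lemma exists_geod (h : IsSheetMetric K f r) (a b : ℍ) : ∃ s, IsGeod r s a b := by
  set T := r a b with hT
  -- From an almost shortest curve, `g t` picks a point at distance exactly `t` from `a`. It need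
  -- not be continuous in `t`, as only the limit of these maps matters.
  have hstep : ∀ N : ℕ, ∃ g : ℝ → ℍ, ∀ t ∈ Icc 0 T, r a (g t) = t ∧
      r (g t) b ≤ T - t + 1 / ((N : ℝ) + 1) ∧
      ∀ t' ∈ Icc 0 T, t ≤ t' → r (g t) (g t') ≤ t' - t + 1 / ((N : ℝ) + 1) := by
    intro N
    have hε : 0 < 1 / ((N : ℝ) + 1) := by positivity
    obtain ⟨c, hc, h0, h1, hcc⟩ := h.approx a b _ hε
    have hcont : ContinuousOn (fun τ => r a (c τ)) (Icc 0 1) :=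
      (h.continuous_left a).comp_continuousOn hc
    have hex : ∀ t, ∃ τ, t ∈ Icc 0 T → τ ∈ Icc (0 : ℝ) 1 ∧ r a (c τ) = t := by
      intro t
      by_cases ht : t ∈ Icc 0 T
      · have := intermediate_value_Icc zero_le_one hcont (by
          simp only [h0, h1, h.self]; exact ht : t ∈ Icc (r a (c 0)) (r a (c 1)))
        obtain ⟨τ, hτ, e⟩ := this
        exact ⟨τ, fun _ => ⟨hτ, e⟩⟩
      · exact ⟨0, fun h => absurd h ht⟩
    choose τ hτ using hex
    refine ⟨fun t => c (τ t), fun t ht => ⟨(hτ t ht).2, ?_, fun t' ht' htt => ?_⟩⟩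
    · have := hcc _ (hτ t ht).1 _ (hτ t ht).1 le_rfl
      rw [(hτ t ht).2, h.self] at this
      linarith
    · have e1 := (hτ t ht).2
      have e2 := (hτ t' ht').2
      rcases le_total (τ t) (τ t') with hle | hle
      · have := hcc _ (hτ t ht).1 _ (hτ t' ht').1 hle
        have h3 := h.triangle a (c (τ t')) b
        linarith
      · have := hcc _ (hτ t' ht').1 _ (hτ t ht).1 hle
        have h3 := h.triangle a (c (τ t)) b
        rw [h.symm (c (τ t')) (c (τ t))] at this
        linarith
  choose g hg using hstep
  -- Closed balls are compact, so pointwise limits along one ultrafilter exist for all `t` at once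
  -- and no subsequence has to be extracted.
  have hlim : ∀ t, ∃ z, t ∈ Icc 0 T →
      Filter.Tendsto (fun N => g N t) (Filter.hyperfilter ℕ) (nhds z) := by
    intro t
    by_cases ht : t ∈ Icc 0 T
    · have hmem : ((Filter.hyperfilter ℕ).map (fun N => g N t) : Filter ℍ) ≤
          Filter.principal {z | r a z ≤ T} := by
        rw [Filter.le_principal_iff]
        exact Filter.Eventually.of_forall (p := fun N => r a (g N t) ≤ T) fun N => by
          rw [(hg N t ht).1]; exact ht.2
      obtain ⟨z, -, hz⟩ := (h.isCompact_ball a T).ultrafilter_le_nhds _ hmem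
      exact ⟨z, fun _ => hz⟩
    · exact ⟨a, fun h => absurd h ht⟩
  choose c hc using hlim
  have hT0 : 0 ≤ T := h.nonneg a b
  have hzero : Filter.Tendsto (fun N : ℕ => 1 / ((N : ℝ) + 1)) (Filter.hyperfilter ℕ) (nhds 0) :=
    tendsto_one_div_add_atTop_nhds_zero_nat.mono_left
      (by rw [← Nat.cofinite_eq_atTop]; exact Filter.hyperfilter_le_cofinite)
  have c0 : c 0 = a := by
    have h1 := (hc 0 ⟨le_rfl, hT0⟩)
    have h2 : (fun N => g N 0) = fun _ => a := by
      ext1 N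
      exact (h.eq_of_zero (hg N 0 ⟨le_rfl, hT0⟩).1).symm
    rw [h2] at h1
    exact (tendsto_nhds_unique h1 tendsto_const_nhds)
  have cT : c T = b := by
    apply h.eq_of_zero
    apply le_antisymm _ (h.nonneg _ _)
    have h1 : Filter.Tendsto (fun N => r (g N T) b) (Filter.hyperfilter ℕ) (nhds (r (c T) b)) := by
      have : Continuous fun z => r z b := h.continuous.comp (Continuous.prodMk_left b)
      exact (this.tendsto _).comp (hc T ⟨hT0, le_rfl⟩)
    refine le_of_tendsto_of_tendsto' h1 hzero fun N => ?_
    simpa using (hg N T ⟨hT0, le_rfl⟩).2.1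
  refine ⟨_, T, c, hT0, c0, cT, h.eq_abs_of_le (by rw [c0, cT]) ?_, rfl⟩
  intro t ht t' ht' htt
  have h1 : Filter.Tendsto (fun N => r (g N t) (g N t')) (Filter.hyperfilter ℕ)
      (nhds (r (c t) (c t'))) :=
    (h.continuous.tendsto (c t, c t')).comp ((hc t ht).prodMk_nhds (hc t' ht'))
  have h2 := (tendsto_const_nhds (x := t' - t)).add hzero
  rw [add_zero] at h2
  exact le_of_tendsto_of_tendsto' h1 h2 fun N => (hg N t ht).2.2 t' ht' htt

lemma biLipPath (h : IsSheetMetric K f r) {T : ℝ} {c : ℝ → ℍ}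
    (hc : ∀ t ∈ Icc 0 T, ∀ t' ∈ Icc 0 T, r (c t) (c t') = |t - t'|) :
    BiLipPath K T (fun t => f (c t)) := by
  intro s hs t ht
  rw [← hc s hs t ht]
  exact ⟨h.upper _ _, h.lower _ _⟩

lemma continuousOn_path (h : IsSheetMetric K f r) {T : ℝ} {c : ℝ → ℍ}
    (hc : ∀ t ∈ Icc 0 T, ∀ t' ∈ Icc 0 T, r (c t) (c t') = |t - t'|) :
    ContinuousOn c (Icc 0 T) := by
  have := f.symm.continuous.comp_continuousOn (h.biLipPath hc).continuousOn
  simpa [Function.comp_def] using this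

end IsSheetMetric

namespace IsGeod

variable {K : ℝ} {f : ℍ ≃ₜ ℍ} {r : ℍ → ℍ → ℝ} {s : Set ℍ} {u v : ℍ}

lemma left_mem (hs : IsGeod r s u v) : u ∈ s := by
  obtain ⟨T, c, hT, h0, -, -, rfl⟩ := hs
  exact ⟨0, ⟨le_rfl, hT⟩, h0⟩

lemma right_mem (hs : IsGeod r s u v) : v ∈ s := by
  obtain ⟨T, c, hT, -, h0, -, rfl⟩ := hs
  exact ⟨T, ⟨hT, le_rfl⟩, h0⟩

lemma isCompact (hs : IsGeod r s u v) (h : IsSheetMetric K f r) : IsCompact s := by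
  obtain ⟨T, c, hT, -, -, hc, rfl⟩ := hs
  exact isCompact_Icc.image_of_continuousOn (h.continuousOn_path hc)

lemma isPreconnected (hs : IsGeod r s u v) (h : IsSheetMetric K f r) : IsPreconnected s := by
  obtain ⟨T, c, hT, -, -, hc, rfl⟩ := hs
  exact isPreconnected_Icc.image _ (h.continuousOn_path hc)

lemma subset_ball (hs : IsGeod r s u v) : s ⊆ {z | r u z ≤ r u v} := by
  obtain ⟨T, c, hT, h0, h1, hc, rfl⟩ := hs
  rintro _ ⟨t, ht, rfl⟩
  rw [mem_ofPred_eq, ← h0, ← h1, hc 0 ⟨le_rfl, hT⟩ t ht, hc 0 ⟨le_rfl, hT⟩ T ⟨hT, le_rfl⟩,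
    zero_sub, zero_sub, abs_neg, abs_neg, abs_of_nonneg ht.1, abs_of_nonneg hT]
  exact ht.2

lemma _root_.isGeod_image_Icc {T : ℝ} {c : ℝ → ℍ}
    (hc : ∀ t ∈ Icc 0 T, ∀ t' ∈ Icc 0 T, r (c t) (c t') = |t - t'|) {t1 t2 : ℝ} (h0 : 0 ≤ t1)
    (h12 : t1 ≤ t2) (h2 : t2 ≤ T) : IsGeod r (c '' Icc t1 t2) (c t1) (c t2) := by
  refine ⟨t2 - t1, fun t => c (t + t1), sub_nonneg.2 h12, by simp, by simp, ?_, ?_⟩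
  · intro t ht t' ht'
    rw [hc _ ⟨by linarith [ht.1], by linarith [ht.2]⟩ _ ⟨by linarith [ht'.1], by linarith [ht'.2]⟩]
    congr 1; ring
  · ext z
    constructor
    · rintro ⟨t, ht, rfl⟩
      exact ⟨t - t1, ⟨by linarith [ht.1], by linarith [ht.2]⟩, by simp⟩
    · rintro ⟨t, ht, rfl⟩
      exact ⟨t + t1, ⟨by linarith [ht.1], by linarith [ht.2]⟩, rfl⟩

lemma symm (hs : IsGeod r s u v) : IsGeod r s v u := by
  obtain ⟨T, c, hT, h0, h1, hc, rfl⟩ := hs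
  refine ⟨T, fun t => c (T - t), hT, by simpa using h1, by simpa using h0, ?_, ?_⟩
  · intro t ht t' ht'
    rw [hc _ ⟨by linarith [ht.2], by linarith [ht.1]⟩ _ ⟨by linarith [ht'.2], by linarith [ht'.1]⟩,
      ← abs_neg]
    congr 1; ring
  · ext z
    constructor
    · rintro ⟨t, ht, rfl⟩
      exact ⟨T - t, ⟨by linarith [ht.2], by linarith [ht.1]⟩, by simp⟩
    · rintro ⟨t, ht, rfl⟩
      exact ⟨T - t, ⟨by linarith [ht.2], by linarith [ht.1]⟩, rfl⟩

/-- A point of a geodesic segment divides it. -/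
lemma split (hs : IsGeod r s u v) {p : ℍ} (hp : p ∈ s) : ∃ s1 s2, IsGeod r s1 u p ∧
    IsGeod r s2 p v ∧ s = s1 ∪ s2 ∧ r u p + r p v = r u v := by
  obtain ⟨T, c, hT, h0, h1, hc, rfl⟩ := hs
  obtain ⟨t, ht, rfl⟩ := hp
  refine ⟨c '' Icc 0 t, c '' Icc t T, ?_, ?_, ?_, ?_⟩
  · rw [← h0]; exact isGeod_image_Icc hc le_rfl ht.1 ht.2
  · rw [← h1]; exact isGeod_image_Icc hc ht.1 ht.2 le_rfl
  · rw [← image_union, Icc_union_Icc_eq_Icc ht.1 ht.2]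
  · have a0 : (0 : ℝ) ∈ Icc 0 T := ⟨le_rfl, hT⟩
    have aT : T ∈ Icc 0 T := ⟨hT, le_rfl⟩
    rw [← h0, ← h1, hc 0 a0 t ht, hc t ht T aT, hc 0 a0 T aT, zero_sub, zero_sub, abs_neg, abs_neg,
      abs_of_nonneg ht.1, abs_of_nonneg hT, abs_sub_comm, abs_of_nonneg (sub_nonneg.2 ht.2)]
    ring

lemma concat (h : IsSheetMetric K f r) {s1 s2 : Set ℍ} {w : ℍ} (hs1 : IsGeod r s1 u w)
    (hs2 : IsGeod r s2 w v) (hw : r u w + r w v = r u v) : IsGeod r (s1 ∪ s2) u v := by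
  obtain ⟨T1, c1, hT1, a0, a1, hc1, rfl⟩ := hs1
  obtain ⟨T2, c2, hT2, b0, b1, hc2, rfl⟩ := hs2
  have e1 : r u w = T1 := by
    rw [← a0, ← a1, hc1 0 ⟨le_rfl, hT1⟩ T1 ⟨hT1, le_rfl⟩, zero_sub, abs_neg, abs_of_nonneg hT1]
  have e2 : r w v = T2 := by
    rw [← b0, ← b1, hc2 0 ⟨le_rfl, hT2⟩ T2 ⟨hT2, le_rfl⟩, zero_sub, abs_neg, abs_of_nonneg hT2]
  set c : ℝ → ℍ := fun t => if t ≤ T1 then c1 t else c2 (t - T1) with hcdef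
  have hcl : ∀ t, t ≤ T1 → c t = c1 t := fun t ht => if_pos ht
  have hcr : ∀ t, T1 ≤ t → c t = c2 (t - T1) := by
    intro t ht
    rcases ht.eq_or_lt with rfl | hlt
    · rw [hcl _ le_rfl, a1, sub_self, b0]
    · exact if_neg (not_le.2 hlt)
  have hc0 : c 0 = u := by rw [hcl 0 hT1, a0]
  have hcT : c (T1 + T2) = v := by rw [hcr _ (by linarith), add_sub_cancel_left, b1]
  refine ⟨T1 + T2, c, by positivity, hc0, hcT, h.eq_abs_of_le ?_ ?_, ?_⟩
  · rw [hc0, hcT]; linarith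
  · intro t ht t' ht' htt
    rcases le_total t' T1 with h1 | h1
    · rw [hcl t (htt.trans h1), hcl t' h1, hc1 t ⟨ht.1, htt.trans h1⟩ t' ⟨ht'.1, h1⟩,
        abs_sub_comm, abs_of_nonneg (sub_nonneg.2 htt)]
    · rcases le_total T1 t with h2 | h2
      · rw [hcr t h2, hcr t' h1, hc2 _ ⟨by linarith, by linarith [ht.2]⟩ _
          ⟨by linarith, by linarith [ht'.2]⟩, abs_sub_comm, abs_of_nonneg (by linarith)]
        linarith
      · have := h.triangle (c t) w (c t')
        have i1 : r (c t) w = T1 - t := by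
          rw [hcl t h2, ← a1, hc1 t ⟨ht.1, h2⟩ T1 ⟨hT1, le_rfl⟩, abs_sub_comm,
            abs_of_nonneg (by linarith)]
        have i2 : r w (c t') = t' - T1 := by
          rw [hcr t' h1, ← b0, hc2 0 ⟨le_rfl, hT2⟩ _ ⟨by linarith, by linarith [ht'.2]⟩,
            abs_sub_comm, sub_zero, abs_of_nonneg (by linarith)]
        linarith
  · have : Icc 0 (T1 + T2) = Icc 0 T1 ∪ Icc T1 (T1 + T2) :=
      (Icc_union_Icc_eq_Icc hT1 (by linarith)).symm
    rw [this, image_union]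
    congr 1
    · exact image_congr fun t ht => (hcl t ht.2).symm
    · ext z
      constructor
      · rintro ⟨t, ht, rfl⟩
        exact ⟨t + T1, ⟨by linarith [ht.1], by linarith [ht.2]⟩, by
          rw [hcr _ (by linarith [ht.1]), add_sub_cancel_right]⟩
      · rintro ⟨t, ht, rfl⟩
        exact ⟨t - T1, ⟨by linarith [ht.1], by linarith [ht.2]⟩, (hcr t ht.1).symm⟩

end IsGeod

/-! ### Coarse centers and nearest-point projections. -/

/-- `p` is a coarse center of the triangle `x, a, b`. -/
def IsCoarseCenter (D : ℝ) (x a b p : ℍ) : Prop :=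
  excess x p a ≤ D ∧ excess x p b ≤ D ∧ excess a p b ≤ D

lemma IsCoarseCenter.dist_le {D : ℝ} {x a b p q : ℍ} (hp : IsCoarseCenter D x a b p)
    (hq : IsCoarseCenter D x a b q) : dist p q ≤ D + 2 * Real.log 5 :=
  dist_le_of_centers hp.1 hp.2.1 hp.2.2 hq.1 hq.2.1 hq.2.2

/-- Each excess at a vertex changes by at most twice the displacement of that vertex. This carries
the coarse Lipschitz dependence of projections on the projected point. -/
lemma IsCoarseCenter.move {D : ℝ} {x y a b p : ℍ} (hp : IsCoarseCenter D x a b p) :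
    IsCoarseCenter (D + 2 * dist x y) y a b p := by
  obtain ⟨h1, h2, h3⟩ := hp
  unfold IsCoarseCenter excess at *
  have e1 := dist_triangle y x p
  have e2 := dist_triangle x y a
  have e3 := dist_triangle x y b
  rw [dist_comm y x] at e1
  have := dist_nonneg (x := x) (y := y)
  refine ⟨by linarith, by linarith, by linarith⟩

lemma IsCoarseCenter.mono {D D' : ℝ} {x a b p : ℍ} (hp : IsCoarseCenter D x a b p)
    (h : D ≤ D') : IsCoarseCenter D' x a b p :=
  ⟨hp.1.trans h, hp.2.1.trans h, hp.2.2.trans h⟩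

/-- Points of geodesics have small excess. -/
lemma exists_excess_le_of_geod {K : ℝ} (hK : 1 ≤ K) : ∃ D : ℝ, 0 ≤ D ∧ ∀ (f : ℍ ≃ₜ ℍ)
    (r : ℍ → ℍ → ℝ), IsSheetMetric K f r → ∀ s u v p, IsGeod r s u v → p ∈ s →
      excess (f u) (f p) (f v) ≤ D := by
  obtain ⟨H, hH0, hH⟩ := exists_excess_le hK
  refine ⟨H, hH0, ?_⟩
  rintro f r h s u v p ⟨T, c, hT, rfl, rfl, hc, rfl⟩ ⟨t, ht, rfl⟩
  exact hH T _ (h.biLipPath hc) t ht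

/-- Points of small excess are close to geodesics. -/
lemma exists_near_geod {K : ℝ} (hK : 1 ≤ K) (D : ℝ) : ∃ C : ℝ, ∀ (f : ℍ ≃ₜ ℍ)
    (r : ℍ → ℍ → ℝ), IsSheetMetric K f r → ∀ s u v p, IsGeod r s u v →
      excess (f u) (f p) (f v) ≤ D → ∃ q ∈ s, r p q ≤ C := by
  obtain ⟨C, hC⟩ := exists_dist_le_of_excess hK D
  refine ⟨K * C, ?_⟩
  rintro f r h s u v p ⟨T, c, hT, rfl, rfl, hc, rfl⟩ he
  obtain ⟨t, ht, hd⟩ := hC T _ hT (h.biLipPath hc) (f p) he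
  exact ⟨c t, ⟨t, ht, rfl⟩, (h.upper _ _).trans (mul_le_mul_of_nonneg_left hd h.pos.le)⟩

/-- Geodesics from `x` to a geodesic segment pass close to the nearest points of `x`. -/
lemma exists_excess_le_of_nearest {K : ℝ} (hK : 1 ≤ K) : ∃ D : ℝ, 0 ≤ D ∧ ∀ (f : ℍ ≃ₜ ℍ)
    (r : ℍ → ℍ → ℝ), IsSheetMetric K f r → ∀ s a b x p v, IsGeod r s a b → p ∈ s →
      (∀ q ∈ s, r x p ≤ r x q) → v ∈ s → excess (f x) (f p) (f v) ≤ D := by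
  -- For points before and after `p` on the broken path, minimality bounds the distance of the first
  -- one to `p` by their mutual distance, and hence that of the second one to `p` by twice it. So
  -- length is at most 3 times distance, which gives the constant `3 * K`.
  obtain ⟨H, hH0, hH⟩ := exists_excess_le (K := 3 * K) (by linarith)
  refine ⟨H, hH0, ?_⟩
  intro f r h s a b x p v hs hp hmin hv
  obtain ⟨s2, hs2, hss2⟩ : ∃ s2, IsGeod r s2 p v ∧ s2 ⊆ s := by
    obtain ⟨s1, s2, h1, h2, rfl, -⟩ := hs.split hp
    rcases hv with hv | hv
    · obtain ⟨t1, t2, -, h4, rfl, -⟩ := h1.split hv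
      exact ⟨t2, h4.symm, subset_union_right.trans subset_union_left⟩
    · obtain ⟨t1, t2, h3, -, rfl, -⟩ := h2.split hv
      exact ⟨t1, h3, subset_union_left.trans subset_union_right⟩
  obtain ⟨s1, T1, c1, hT1, a0, a1, hc1, rfl⟩ := h.exists_geod x p
  obtain ⟨T2, c2, hT2, b0, b1, hc2, rfl⟩ := hs2
  set c : ℝ → ℍ := fun t => if t ≤ T1 then c1 t else c2 (t - T1) with hcdef
  have hcl : ∀ t, t ≤ T1 → c t = c1 t := fun t ht => if_pos ht
  have hcr : ∀ t, T1 ≤ t → c t = c2 (t - T1) := by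
    intro t ht
    rcases ht.eq_or_lt with rfl | hlt
    · rw [hcl _ le_rfl, a1, sub_self, b0]
    · exact if_neg (not_le.2 hlt)
  have key : ∀ t ∈ Icc 0 (T1 + T2), ∀ t' ∈ Icc 0 (T1 + T2), t ≤ t' →
      r (c t) (c t') ≤ t' - t ∧ t' - t ≤ 3 * r (c t) (c t') := by
    intro t ht t' ht' htt
    rcases le_total t' T1 with h1 | h1
    · rw [hcl t (htt.trans h1), hcl t' h1, hc1 t ⟨ht.1, htt.trans h1⟩ t' ⟨ht'.1, h1⟩,
        abs_sub_comm, abs_of_nonneg (sub_nonneg.2 htt)]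
      constructor <;> linarith
    · rcases le_total T1 t with h2 | h2
      · rw [hcr t h2, hcr t' h1, hc2 _ ⟨by linarith, by linarith [ht.2]⟩ _
          ⟨by linarith, by linarith [ht'.2]⟩, abs_sub_comm, abs_of_nonneg (by linarith)]
        constructor <;> linarith
      · have i1 : r (c t) p = T1 - t := by
          rw [hcl t h2, ← a1, hc1 t ⟨ht.1, h2⟩ T1 ⟨hT1, le_rfl⟩, abs_sub_comm,
            abs_of_nonneg (by linarith)]
        have i2 : r p (c t') = t' - T1 := by
          rw [hcr t' h1, ← b0, hc2 0 ⟨le_rfl, hT2⟩ _ ⟨by linarith, by linarith [ht'.2]⟩,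
            abs_sub_comm, sub_zero, abs_of_nonneg (by linarith)]
        have i3 : r x (c t) = t := by
          rw [hcl t h2, ← a0, hc1 0 ⟨le_rfl, hT1⟩ t ⟨ht.1, h2⟩, zero_sub, abs_neg,
            abs_of_nonneg ht.1]
        have i4 : r x p = T1 := by
          rw [← a0, ← a1, hc1 0 ⟨le_rfl, hT1⟩ T1 ⟨hT1, le_rfl⟩, zero_sub, abs_neg,
            abs_of_nonneg hT1]
        have i5 : r x p ≤ r x (c t') := by
          apply hmin
          rw [hcr t' h1]
          exact hss2 ⟨_, ⟨by linarith, by linarith [ht'.2]⟩, rfl⟩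
        have j1 := h.triangle (c t) p (c t')
        have j2 := h.triangle x (c t) (c t')
        have j3 := h.triangle p (c t) (c t')
        rw [h.symm p (c t)] at j3
        constructor <;> linarith
  have hbl : BiLipPath (3 * K) (T1 + T2) (fun t => f (c t)) := by
    intro t ht t' ht'
    wlog htt : t ≤ t' generalizing t t'
    · rw [abs_sub_comm, dist_comm]
      exact this t' ht' t ht (le_of_not_ge htt)
    obtain ⟨k1, k2⟩ := key t ht t' ht' htt
    have h1 := h.lower (c t) (c t')
    have h2 := h.upper (c t) (c t')
    rw [abs_sub_comm, abs_of_nonneg (sub_nonneg.2 htt)]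
    have hK0 := h.pos
    have : K * r (c t) (c t') ≤ K * (t' - t) := mul_le_mul_of_nonneg_left k1 hK0.le
    have : 0 ≤ K * (t' - t) := mul_nonneg hK0.le (sub_nonneg.2 htt)
    constructor <;> linarith
  have := hH _ _ hbl T1 ⟨hT1, by linarith⟩
  simp only [hcl 0 hT1, hcl T1 le_rfl, hcr (T1 + T2) (by linarith), add_sub_cancel_left, a0, a1,
    b1] at this
  exact this

/-- Nearest points on geodesic segments are coarse centers. -/
lemma exists_isCoarseCenter {K : ℝ} (hK : 1 ≤ K) : ∃ D : ℝ, 0 ≤ D ∧ ∀ (f : ℍ ≃ₜ ℍ)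
    (r : ℍ → ℍ → ℝ), IsSheetMetric K f r → ∀ s a b x p, IsGeod r s a b → p ∈ s →
      (∀ q ∈ s, r x p ≤ r x q) → IsCoarseCenter D (f x) (f a) (f b) (f p) := by
  obtain ⟨D1, h10, h1⟩ := exists_excess_le_of_nearest hK
  obtain ⟨D2, h20, h2⟩ := exists_excess_le_of_geod hK
  refine ⟨max D1 D2, le_max_of_le_left h10, ?_⟩
  intro f r h s a b x p hs hp hmin
  exact ⟨(h1 f r h s a b x p a hs hp hmin hs.left_mem).trans (le_max_left _ _),
    (h1 f r h s a b x p b hs hp hmin hs.right_mem).trans (le_max_left _ _),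
    (h2 f r h s a b p hs hp).trans (le_max_right _ _)⟩

end SheetMetrics

/-! ### Electro-ambient quasigeodesics and electric projections in a sheet -/

section SplitSheets

/-- The extended distance attached to a real-valued one. -/
def toEDist (r : ℍ → ℍ → ℝ) (z w : ℍ) : ℝ≥0∞ := ENNReal.ofReal (r z w)

/-- A sheet of a split block: the lines are geodesic and have cocompact stabilizers. -/
structure IsSplitSheet (K : ℝ) (f : ℍ ≃ₜ ℍ) (r : ℍ → ℍ → ℝ) (lines : Set (Set ℍ)) : Prop where
  metric : IsSheetMetric K f r
  system : IsLineSystem lines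
  geod : ∀ l ∈ lines, ∀ u ∈ l, ∀ v ∈ l, ∃ s ⊆ l, IsGeod r s u v
  periodic : ∀ l ∈ lines, ∃ κ ⊆ l, IsCompact κ ∧ ∀ p ∈ l, ∃ φ : ℍ ≃ ℍ,
    (∀ z w, r (φ z) (φ w) = r z w) ∧ φ '' l = l ∧ (∀ l' ∈ lines, φ '' l' ∈ lines) ∧ φ p ∈ κ

lemma IsSheetMetric.isGeodesicSegment_iff {K : ℝ} {f : ℍ ≃ₜ ℍ} {r : ℍ → ℍ → ℝ}
    (h : IsSheetMetric K f r) {s : Set ℍ} {u v : ℍ} :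
    IsGeodesicSegment (toEDist r) s u v ↔ IsGeod r s u v := by
  unfold IsGeodesicSegment IsGeod toEDist
  simp only [ENNReal.ofReal_eq_ofReal_iff (h.nonneg _ _) (abs_nonneg _)]

lemma IsSheetMetric.toEDist_le_iff {K : ℝ} {f : ℍ ≃ₜ ℍ} {r : ℍ → ℍ → ℝ}
    (h : IsSheetMetric K f r) {x y z w : ℍ} : toEDist r x y ≤ toEDist r z w ↔ r x y ≤ r z w :=
  ENNReal.ofReal_le_ofReal_iff (h.nonneg _ _)

/-- The distance between a compact and a closed set is attained. -/
lemma IsSheetMetric.exists_min_dist {K : ℝ} {f : ℍ ≃ₜ ℍ} {r : ℍ → ℍ → ℝ}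
    (h : IsSheetMetric K f r) {κ Λ : Set ℍ} (hκ : IsCompact κ) (hκ0 : κ.Nonempty)
    (hΛ : IsClosed Λ) (hΛ0 : Λ.Nonempty) :
    ∃ p ∈ κ, ∃ q ∈ Λ, ∀ p' ∈ κ, ∀ q' ∈ Λ, r p q ≤ r p' q' := by
  obtain ⟨p0, hp0⟩ := hκ0
  obtain ⟨q0, hq0⟩ := hΛ0
  obtain ⟨m, hm, hmax⟩ := hκ.exists_isMaxOn ⟨p0, hp0⟩ (h.continuous_left p0).continuousOn
  have hmax' : ∀ p ∈ κ, r p0 p ≤ r p0 m := fun p hp => hmax hp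
  have hm0 := h.nonneg p0 m
  have hc : IsCompact (κ ×ˢ (Λ ∩ {z | r p0 z ≤ r p0 q0 + r p0 m})) :=
    hκ.prod ((h.isCompact_ball p0 _).inter_left hΛ)
  obtain ⟨⟨p, q⟩, ⟨hp, hq, -⟩, hmin⟩ := hc.exists_isMinOn
    ⟨(p0, q0), hp0, hq0, show r p0 q0 ≤ _ by linarith⟩ h.continuous.continuousOn
  refine ⟨p, hp, q, hq, fun p' hp' q' hq' => ?_⟩
  by_cases hb : r p0 q' ≤ r p0 q0 + r p0 m
  · exact hmin (show (p', q') ∈ _ from ⟨hp', hq', hb⟩)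
  · have h1 : r p q ≤ r p0 q0 :=
      hmin (show (p0, q0) ∈ _ from ⟨hp0, hq0, show r p0 q0 ≤ _ by linarith⟩)
    have h2 := h.triangle p0 p' q'
    have h3 := hmax' p' hp'
    linarith

lemma IsLineSystem.finite_meeting {lines : Set (Set ℍ)} (h : IsLineSystem lines) {S : Set ℍ}
    (hS : IsCompact S) : {l | l ∈ lines ∧ (l ∩ S).Nonempty}.Finite := by
  refine hS.induction_on (p := fun S => {l | l ∈ lines ∧ (l ∩ S).Nonempty}.Finite) ?_ ?_ ?_ ?_
  · simp
  · intro s t hst ht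
    exact ht.subset fun l hl => ⟨hl.1, hl.2.mono (inter_subset_inter_right _ hst)⟩
  · intro s t hs ht
    refine (hs.union ht).subset fun l hl => ?_
    obtain ⟨hl, z, hz, hzs | hzt⟩ := hl
    · exact Or.inl ⟨hl, z, hz, hzs⟩
    · exact Or.inr ⟨hl, z, hz, hzt⟩
  · intro z _
    obtain ⟨O, hO, hs⟩ := h.separated z
    refine ⟨O, mem_nhdsWithin_of_mem_nhds hO, Set.Subsingleton.finite ?_⟩
    intro l hl l' hl'
    exact hs l hl.1 l' hl'.1 hl.2 hl'.2

namespace IsSplitSheet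

variable {K : ℝ} {f : ℍ ≃ₜ ℍ} {r : ℍ → ℍ → ℝ} {lines : Set (Set ℍ)}

/-- The distance between two lines is attained. -/
lemma exists_min_dist_lines (h : IsSplitSheet K f r lines) {l l' : Set ℍ} (hl : l ∈ lines)
    (hl' : l' ∈ lines) : ∃ p ∈ l, ∃ q ∈ l', ∀ p' ∈ l, ∀ q' ∈ l', r p q ≤ r p' q' := by
  obtain ⟨κ, hκl, hκ, hφ⟩ := h.periodic l hl
  -- Lines are not compact, so one end is moved into the compact piece `κ` by an isometry preserving
  -- `l`. The other end then ranges over all images of `l'` under such isometries, whose union is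
  -- closed by local finiteness.
  let G : Set (ℍ ≃ ℍ) := {φ | (∀ z w, r (φ z) (φ w) = r z w) ∧ φ '' l = l ∧
    ∀ l' ∈ lines, φ '' l' ∈ lines}
  let F : Set (Set ℍ) := {m | ∃ φ ∈ G, m = φ '' l'}
  have hF : F ⊆ lines := by
    rintro _ ⟨φ, hφ, rfl⟩
    exact hφ.2.2 l' hl'
  obtain ⟨U, V, hs⟩ := h.system.sides l hl
  obtain ⟨z, hz⟩ := hs.nonempty
  obtain ⟨U', V', hs'⟩ := h.system.sides l' hl'
  obtain ⟨z', hz'⟩ := hs'.nonempty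
  obtain ⟨φ0, h1, h2, h3, h4⟩ := hφ z hz
  obtain ⟨p, hp, q, ⟨_, ⟨φ, hφG, rfl⟩, ⟨q, hq, rfl⟩⟩, hmin⟩ := h.metric.exists_min_dist hκ ⟨_, h4⟩
    (h.system.isClosed_sUnion hF) ⟨φ0 z', φ0 '' l', ⟨φ0, ⟨h1, h2, h3⟩, rfl⟩, z', hz', rfl⟩
  obtain ⟨p, hp', rfl⟩ : p ∈ φ '' l := hφG.2.1.symm ▸ hκl hp
  refine ⟨p, hp', q, hq, fun u hu v hv => ?_⟩
  obtain ⟨ψ, g1, g2, g3, g4⟩ := hφ u hu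
  rw [← hφG.1, ← g1 u v]
  exact hmin _ g4 _ ⟨_, ⟨ψ, ⟨g1, g2, g3⟩, rfl⟩, v, hv, rfl⟩

lemma exists_min_dist_gate (h : IsSplitSheet K f r lines) {n : ℕ} {A l : ℕ → Set ℍ} {a b : ℍ}
    (hp : IsElectricPath lines (lineComponents lines) n A l a b) {k : ℕ} (hk : k ≤ n) :
    ∃ u ∈ gate n l a b k, ∃ v ∈ gate n l a b (k + 1), u ∈ A k ∧ v ∈ A k ∧
      ∀ p ∈ gate n l a b k, ∀ q ∈ gate n l a b (k + 1), r u v ≤ r p q := by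
  have hsub1 : gate n l a b k ⊆ A k := by
    unfold gate
    split_ifs with h1
    · subst h1; exact singleton_subset_iff.2 hp.2.1
    · have := (hp.2.2.2 (k - 1) (by omega)).2
      rw [Nat.sub_add_cancel (by omega)] at this
      exact this.trans inter_subset_right
  have hsub2 : gate n l a b (k + 1) ⊆ A k := by
    unfold gate
    rw [if_neg (by omega)]
    split_ifs with h1
    · exact (hp.2.2.2 k (by omega)).2.trans inter_subset_left
    · obtain rfl : k = n := by omega
      exact singleton_subset_iff.2 hp.2.2.1
  suffices hmain : ∃ u ∈ gate n l a b k, ∃ v ∈ gate n l a b (k + 1),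
      ∀ p ∈ gate n l a b k, ∀ q ∈ gate n l a b (k + 1), r u v ≤ r p q by
    obtain ⟨u, hu, v, hv, hm⟩ := hmain
    exact ⟨u, hu, v, hv, hsub1 hu, hsub2 hv, hm⟩
  have hclosed : ∀ m ∈ lines, IsClosed m ∧ m.Nonempty := by
    intro m hm
    obtain ⟨U, V, hs⟩ := h.system.sides m hm
    exact ⟨hs.isClosed, hs.nonempty⟩
  have hG : ∀ j ≤ n + 1, gate n l a b j ∈ lines ∨ ∃ z, gate n l a b j = {z} := by
    intro j hj
    unfold gate
    split_ifs with h1 h2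
    · exact Or.inr ⟨a, rfl⟩
    · left
      have := (hp.2.2.2 (j - 1) (by omega)).1
      rwa [Nat.sub_add_cancel (by omega)] at this
    · exact Or.inr ⟨b, rfl⟩
  rcases hG k (by omega) with h1 | ⟨z, h1⟩
  · rcases hG (k + 1) (by omega) with h2 | ⟨w, h2⟩
    · exact h.exists_min_dist_lines h1 h2
    · obtain ⟨q, hq, p, hp, hmin⟩ := h.metric.exists_min_dist (isCompact_singleton (x := w))
        (singleton_nonempty w) (hclosed _ h1).1 (hclosed _ h1).2
      rw [h2]
      refine ⟨p, hp, q, hq, fun p' hp' q' hq' => ?_⟩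
      rw [h.metric.symm p q, h.metric.symm p' q']
      exact hmin q' hq' p' hp'
  · rw [h1]
    rcases hG (k + 1) (by omega) with h2 | ⟨w, h2⟩
    · exact h.metric.exists_min_dist (isCompact_singleton (x := z)) (singleton_nonempty z)
        (hclosed _ h2).1 (hclosed _ h2).2
    · rw [h2]
      exact h.metric.exists_min_dist (isCompact_singleton (x := z)) (singleton_nonempty z)
        isClosed_singleton (singleton_nonempty w)

/-- A geodesic between points on one closed side of the line `l` can be replaced by one that stays
on that side, by following `l` where the geodesic lies beyond `l`. -/
lemma exists_surgery (h : IsSplitSheet K f r lines) {s l : Set ℍ} {u v : ℍ}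
    (hs : IsGeod r s u v) (hl : l ∈ lines) : ∃ s', IsGeod r s' u v ∧ s' ⊆ s ∪ l ∧
      (Disjoint s l → s' = s) ∧ ∀ U V, IsSides l U V → u ∈ Vᶜ → v ∈ Vᶜ → s' ⊆ Vᶜ := by
  obtain ⟨U0, V0, hs0⟩ := h.system.sides l hl
  have key : ∀ (S : Set ℍ) (z : ℍ) U V, IsSides l U V → IsPreconnected S → Disjoint S l → z ∈ S →
      z ∈ Vᶜ → S ⊆ Vᶜ := by
    intro S z U V hUV hS hd hz hzV
    exact ((hUV.subset_or hS hd).resolve_right fun hV => hzV (hV hz)).trans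
      hUV.disjoint.subset_compl_right
  by_cases hd : Disjoint s l
  · exact ⟨s, hs, subset_union_left, fun _ => rfl, fun U V hUV hu _ =>
      key s u U V hUV (hs.isPreconnected h.metric) hd hs.left_mem hu⟩
  obtain ⟨T, c, hT, h0, h1, hc, rfl⟩ := hs
  have hcont := h.metric.continuousOn_path hc
  have hZ : IsCompact (Icc 0 T ∩ c ⁻¹' l) := isCompact_Icc.of_isClosed_subset
    (hcont.preimage_isClosed_of_isClosed isClosed_Icc hs0.isClosed) inter_subset_left
  have hZ0 : (Icc 0 T ∩ c ⁻¹' l).Nonempty := by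
    obtain ⟨_, ⟨t, ht, rfl⟩, htl⟩ := not_disjoint_iff.1 hd
    exact ⟨t, ht, htl⟩
  obtain ⟨t1, ⟨ht1, ht1l⟩, hmin⟩ := hZ.exists_isLeast hZ0
  obtain ⟨t2, ⟨ht2, ht2l⟩, hmax⟩ := hZ.exists_isGreatest hZ0
  have h12 : t1 ≤ t2 := hmin ⟨ht2, ht2l⟩
  -- Between the first and the last hit the geodesic is replaced by a piece of `l` of the same
  -- length, since `l` is geodesic as well.
  obtain ⟨σ, hσl, hσ⟩ := h.geod l hl _ ht1l _ ht2l
  have g1 := isGeod_image_Icc hc le_rfl ht1.1 ht1.2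
  have g2 := isGeod_image_Icc hc ht2.1 ht2.2 le_rfl
  have a0 : (0 : ℝ) ∈ Icc 0 T := ⟨le_rfl, hT⟩
  have aT : T ∈ Icc 0 T := ⟨hT, le_rfl⟩
  have d : ∀ t ∈ Icc 0 T, ∀ t' ∈ Icc 0 T, t ≤ t' → r (c t) (c t') = t' - t := by
    intro t ht t' ht' htt
    rw [hc t ht t' ht', abs_sub_comm, abs_of_nonneg (sub_nonneg.2 htt)]
  have g12 := IsGeod.concat h.metric g1 hσ (by
    rw [d 0 a0 t1 ht1 ht1.1, d t1 ht1 t2 ht2 h12, d 0 a0 t2 ht2 ht2.1]; ring)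
  have g := IsGeod.concat h.metric g12 g2 (by
    rw [d 0 a0 t2 ht2 ht2.1, d t2 ht2 T aT ht2.2, d 0 a0 T aT hT]; ring)
  rw [h0, h1] at g
  refine ⟨_, g, ?_, fun hd' => absurd hd' hd, ?_⟩
  · refine union_subset (union_subset ?_ (hσl.trans subset_union_right)) ?_
    · exact (image_mono (Icc_subset_Icc_right ht1.2)).trans subset_union_left
    · exact (image_mono (Icc_subset_Icc_left ht2.1)).trans subset_union_left
  · intro U V hUV hu hv
    have hlV : l ⊆ Vᶜ := fun z hz => hUV.symm.line_not_left hz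
    refine union_subset (union_subset ?_ (hσl.trans hlV)) ?_
    · rw [← Ico_union_right ht1.1, image_union, image_singleton]
      refine union_subset ?_ (singleton_subset_iff.2 (hlV ht1l))
      rcases ht1.1.eq_or_lt with e | hlt
      · rw [← e, Ico_self, image_empty]; exact empty_subset _
      refine key _ u U V hUV (isPreconnected_Ico.image _ (hcont.mono ?_)) ?_ ⟨0, ⟨le_rfl, hlt⟩, h0⟩
          hu
      · exact fun t ht => ⟨ht.1, ht.2.le.trans ht1.2⟩
      · rw [disjoint_left]
        rintro _ ⟨t, ht, rfl⟩ htl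
        exact absurd (hmin ⟨⟨ht.1, ht.2.le.trans ht1.2⟩, htl⟩) (not_le.2 ht.2)
    · rw [← Ioc_union_left ht2.2, image_union, image_singleton]
      refine union_subset ?_ (singleton_subset_iff.2 (hlV ht2l))
      rcases ht2.2.eq_or_lt with e | hlt
      · rw [← e, Ioc_self, image_empty]; exact empty_subset _
      refine key _ v U V hUV (isPreconnected_Ioc.image _ (hcont.mono ?_)) ?_ ⟨T, ⟨hlt, le_rfl⟩, h1⟩
          hv
      · exact fun t ht => ⟨ht2.1.trans ht.1.le, ht.2⟩
      · rw [disjoint_left]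
        rintro _ ⟨t, ht, rfl⟩ htl
        exact absurd (hmax ⟨⟨ht2.1.trans ht.1.le, ht.2⟩, htl⟩) (not_le.2 ht.1)

/-- Two points of a component are joined by a geodesic inside the component. -/
lemma exists_geod_component (h : IsSplitSheet K f r lines) {A : Set ℍ}
    (hA : A ∈ lineComponents lines) {u v : ℍ} (hu : u ∈ A) (hv : v ∈ A) :
    ∃ s ⊆ A, IsGeod r s u v := by
  -- Every geodesic from `u` to `v` stays in this compact ball, which only finitely many lines meet;
  -- surgery is performed along them one after the other.
  have hfin := h.system.finite_meeting (h.metric.isCompact_ball u (r u v))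
  obtain ⟨s, hs, hside⟩ : ∃ s, IsGeod r s u v ∧
      ∀ l ∈ {l | l ∈ lines ∧ (l ∩ {z | r u z ≤ r u v}).Nonempty}, ∀ U V, IsSides l U V →
        A ⊆ Vᶜ → s ⊆ Vᶜ := by
    have hsub : {l | l ∈ lines ∧ (l ∩ {z | r u z ≤ r u v}).Nonempty} ⊆ lines := fun l hl => hl.1
    generalize {l | l ∈ lines ∧ (l ∩ {z | r u z ≤ r u v}).Nonempty} = F at hfin hsub
    induction F, hfin using Set.Finite.induction_on with
    | empty =>
      obtain ⟨s, hs⟩ := h.metric.exists_geod u v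
      exact ⟨s, hs, fun l hl => absurd hl (notMem_empty l)⟩
    | @insert l0 F _ _ ih =>
      obtain ⟨s, hs, hside⟩ := ih ((subset_insert _ _).trans hsub)
      have hl0 := hsub (mem_insert l0 F)
      obtain ⟨s', hs', hsl, hdis, hV⟩ := h.exists_surgery hs hl0
      refine ⟨s', hs', ?_⟩
      intro l hl U V hUV hAV
      rcases eq_or_ne l l0 with rfl | hne
      · exact hV U V hUV (hAV hu) (hAV hv)
      have hlF : l ∈ F := hl.resolve_left hne
      have hsV := hside l hlF U V hUV hAV
      by_cases hd : Disjoint s l0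
      · rw [hdis hd]; exact hsV
      obtain ⟨z, hzs, hzl⟩ := not_disjoint_iff.1 hd
      obtain ⟨U0, V0, hs0⟩ := h.system.sides l0 hl0
      -- Surgery along `l0` does not undo what was achieved for `l`: the inserted piece lies on
      -- `l0`, which is disjoint from `l` and meets `s`, hence lies on the same side of `l`.
      have hl0V : l0 ⊆ Vᶜ := by
        have hdl : Disjoint l0 l := disjoint_left.2 fun y hy hy' =>
          hne (h.system.eq_of_mem (hsub hl) hl0 hy' hy)
        exact ((hUV.subset_or hs0.preconnected hdl).resolve_right fun hl0V =>
          hsV hzs (hl0V hzl)).trans hUV.disjoint.subset_compl_right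
      exact hsl.trans (union_subset hsV hl0V)
  refine ⟨s, fun z hz => h.system.mem_component_of_sides hA fun l hl U V hUV hAV => ?_, hs⟩
  by_cases hmeet : (l ∩ {z | r u z ≤ r u v}).Nonempty
  · exact hside l ⟨hl, hmeet⟩ U V hUV hAV hz
  · have hd : Disjoint s l := disjoint_left.2 fun y hy hyl => hmeet ⟨y, hyl, hs.subset_ball hy⟩
    exact ((hUV.subset_or (hs.isPreconnected h.metric) hd).resolve_right fun hV =>
      hAV hu (hV hs.left_mem)).trans hUV.disjoint.subset_compl_right hz

/-- Electro-ambient quasigeodesics exist. -/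
lemma exists_isElectroAmbient (h : IsSplitSheet K f r lines) (a b : ℍ) :
    ∃ μ, IsElectroAmbient (toEDist r) lines (lineComponents lines) a b μ := by
  obtain ⟨n, A, l, hp, hn⟩ := h.system.exists_minimal_path a b
  have hex : ∀ k, ∃ u v, k ≤ n → u ∈ gate n l a b k ∧ v ∈ gate n l a b (k + 1) ∧ u ∈ A k ∧
      v ∈ A k ∧ ∀ p ∈ gate n l a b k, ∀ q ∈ gate n l a b (k + 1), r u v ≤ r p q := by
    intro k
    by_cases hk : k ≤ n
    · obtain ⟨u, hu, v, hv, h1, h2, h3⟩ := h.exists_min_dist_gate hp hk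
      exact ⟨u, v, fun _ => ⟨hu, hv, h1, h2, h3⟩⟩
    · exact ⟨a, a, fun hk' => absurd hk' hk⟩
  choose u v huv using hex
  have hseg : ∀ k, ∃ s, k ≤ n → s ⊆ A k ∧ IsGeod r s (u k) (v k) := by
    intro k
    by_cases hk : k ≤ n
    · obtain ⟨s, h1, h2⟩ := h.exists_geod_component (hp.1 k hk) (huv k hk).2.2.1
        (huv k hk).2.2.2.1
      exact ⟨s, fun _ => ⟨h1, h2⟩⟩
    · exact ⟨∅, fun hk' => absurd hk' hk⟩
  choose seg hseg using hseg
  have hint : ∀ k, ∃ s, k < n → s ⊆ l (k + 1) ∧ IsGeod r s (v k) (u (k + 1)) := by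
    intro k
    by_cases hk : k < n
    · have g : gate n l a b (k + 1) = l (k + 1) := by
        unfold gate
        rw [if_neg (by omega), if_pos (by omega)]
      obtain ⟨s, h1, h2⟩ := h.geod _ (hp.2.2.2 k hk).1 (v k) (g ▸ (huv k hk.le).2.1)
        (u (k + 1)) (g ▸ (huv (k + 1) hk).1)
      exact ⟨s, fun _ => ⟨h1, h2⟩⟩
    · exact ⟨∅, fun hk' => absurd hk' hk⟩
  choose int hint using hint
  refine ⟨_, n, A, l, u, v, seg, int, hp, hn, fun k hk => ⟨(huv k hk).1, (huv k hk).2.1, ?_, ?_,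
    (hseg k hk).1⟩, fun k hk => ⟨?_, (hint k hk).1⟩, rfl⟩
  · intro p hp q hq
    exact h.metric.toEDist_le_iff.2 ((huv k hk).2.2.2.2 p hp q hq)
  · exact h.metric.isGeodesicSegment_iff.2 (hseg k hk).2
  · exact h.metric.isGeodesicSegment_iff.2 (hint k hk).2

end IsSplitSheet

/-! ### Electric traces and electric projections. -/

/-- The features of an electro-ambient quasigeodesic on which electric projections depend. -/
structure IsElectricTrace (lines : Set (Set ℍ)) (a b : ℍ) (μ : Set ℍ) : Prop where
  preconnected : IsPreconnected μ
  left_mem : a ∈ μ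
  right_mem : b ∈ μ
  side : ∀ l ∈ lines, ∀ U V, IsSides l U V → a ∈ U → b ∈ U → μ ⊆ Vᶜ

/-- The pieces are compact geodesics and consecutive pieces share an endpoint. The side condition
holds because each piece lies in a component of a shortest path, and such paths stay on one side by
`minimal_path_side`. -/
lemma IsSplitSheet.trace {K : ℝ} {f : ℍ ≃ₜ ℍ} {r : ℍ → ℍ → ℝ} {lines : Set (Set ℍ)}
    (h : IsSplitSheet K f r lines) {a b : ℍ} {μ : Set ℍ}
    (hμ : IsElectroAmbient (toEDist r) lines (lineComponents lines) a b μ) :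
    IsCompact μ ∧ IsElectricTrace lines a b μ := by
  obtain ⟨n, A, l, u, v, seg, int, hp, hn, hseg, hint, rfl⟩ := hμ
  have hseg' : ∀ k ≤ n, IsGeod r (seg k) (u k) (v k) := fun k hk =>
    h.metric.isGeodesicSegment_iff.1 (hseg k hk).2.2.2.1
  have hint' : ∀ k < n, IsGeod r (int k) (v k) (u (k + 1)) := fun k hk =>
    h.metric.isGeodesicSegment_iff.1 (hint k hk).1
  have hu0 : u 0 = a := by
    have := (hseg 0 (Nat.zero_le _)).1
    simpa [gate] using this
  have hvn : v n = b := by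
    have := (hseg n le_rfl).2.1
    simpa [gate] using this
  refine ⟨?_, ?_, ?_, ?_, ?_⟩
  · exact ((Set.finite_le_nat n).isCompact_biUnion fun k hk =>
      (hseg' k hk).isCompact h.metric).union
      ((Set.finite_lt_nat n).isCompact_biUnion fun k hk => (hint' k hk).isCompact h.metric)
  · have : ∀ m ≤ n, IsPreconnected ((⋃ k ≤ m, seg k) ∪ ⋃ k < m, int k) := by
      intro m
      induction m with
      | zero =>
        intro _
        simpa using (hseg' 0 (Nat.zero_le _)).isPreconnected h.metric
      | succ m ih =>
        intro hm
        have e : (⋃ k ≤ m + 1, seg k) ∪ ⋃ k < m + 1, int k =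
            (((⋃ k ≤ m, seg k) ∪ ⋃ k < m, int k) ∪ int m) ∪ seg (m + 1) := by
          rw [biUnion_le_succ, biUnion_lt_succ]
          ac_rfl
        rw [e]
        have hv : v m ∈ ((⋃ k ≤ m, seg k) ∪ ⋃ k < m, int k) :=
          Or.inl (mem_biUnion (show m ≤ m from le_rfl) (hseg' m (by omega)).right_mem)
        have h1 := (ih (by omega)).union (v m) hv (hint' m (by omega)).left_mem
          ((hint' m (by omega)).isPreconnected h.metric)
        exact h1.union (u (m + 1)) (Or.inr (hint' m (by omega)).right_mem)
          (hseg' (m + 1) hm).left_mem ((hseg' (m + 1) hm).isPreconnected h.metric)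
    exact this n le_rfl
  · rw [← hu0]
    exact Or.inl (mem_biUnion (show 0 ≤ n from Nat.zero_le _) (hseg' 0 (Nat.zero_le _)).left_mem)
  · rw [← hvn]
    exact Or.inl (mem_biUnion (show n ≤ n from le_rfl) (hseg' n le_rfl).right_mem)
  · intro m hm U V hUV ha hb
    have hA : ∀ k ≤ n, A k ⊆ Vᶜ := fun k hk => h.system.minimal_path_side hm hUV hp hn ha hb hk
    refine union_subset (iUnion₂_subset fun k hk => (hseg k hk).2.2.2.2.trans (hA k hk))
      (iUnion₂_subset fun k hk => (hint k hk).2.trans ?_)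
    exact ((hp.2.2.2 k hk).2.trans inter_subset_left).trans (hA k hk.le)

/-- Electric projections to compact sets exist. -/
lemma IsSplitSheet.exists_nearest {K : ℝ} {f : ℍ ≃ₜ ℍ} {r : ℍ → ℍ → ℝ} {lines : Set (Set ℍ)}
    (h : IsSplitSheet K f r lines) {μ : Set ℍ} (hμ : IsCompact μ) (h0 : μ.Nonempty) (x : ℍ) :
    ∃ p, IsElectricNearestPoint (toEDist r) lines (lineComponents lines) μ x p := by
  obtain ⟨p0, hp0, hmin⟩ : ∃ p0 ∈ μ, ∀ q ∈ μ, dGel lines (lineComponents lines) x p0 ≤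
      dGel lines (lineComponents lines) x q := by
    obtain ⟨m, ⟨p0, hp0, rfl⟩, hm⟩ := WellFounded.has_min (wellFounded_lt (α := ℕ∞))
      ((fun q => dGel lines (lineComponents lines) x q) '' μ) (h0.image _)
    exact ⟨p0, hp0, fun q hq => not_lt.1 (hm _ ⟨q, hq, rfl⟩)⟩
  have hc := hμ.inter_right (h.system.isClosed_dGel_le x (dGel lines (lineComponents lines) x p0))
  obtain ⟨p, ⟨hp, hpm⟩, hpmin⟩ := hc.exists_isMinOn
    ⟨p0, hp0, show dGel lines (lineComponents lines) x p0 ≤ _ from le_rfl⟩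
    (h.metric.continuous_left x).continuousOn
  have he : dGel lines (lineComponents lines) x p = dGel lines (lineComponents lines) x p0 :=
    le_antisymm hpm (hmin p hp)
  refine ⟨p, hp, fun q hq => ?_⟩
  rcases (hmin q hq).lt_or_eq with hlt | heq
  · exact Or.inl (he ▸ hlt)
  · exact Or.inr ⟨he.trans heq, h.metric.toEDist_le_iff.2 (hpmin ⟨hq, heq.ge⟩)⟩

lemma IsElectricNearestPoint.dGel_le {Y : Type*} {d : Y → Y → ℝ≥0∞} {lines comps : Set (Set Y)}
    {μ : Set Y} {x p q : Y} (hp : IsElectricNearestPoint d lines comps μ x p) (hq : q ∈ μ) :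
    dGel lines comps x p ≤ dGel lines comps x q := by
  rcases hp.2 q hq with h | h
  · exact h.le
  · exact h.1.le

lemma IsLineSystem.sameComponent_self {lines : Set (Set ℍ)} (h : IsLineSystem lines) (x : ℍ) :
    SameComponent lines x x := by
  obtain ⟨A, hA, hx⟩ := h.exists_mem_component x
  exact ⟨A, hA, hx, hx⟩

/-- Electric projections of two points of one component are electrically close. -/
lemma IsLineSystem.electric_projections_close {lines : Set (Set ℍ)} (h : IsLineSystem lines)
    {a b : ℍ} {μ μ' : Set ℍ} (hμ : IsElectricTrace lines a b μ) (hμ' : IsElectricTrace lines a b μ')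
    {x y p q : ℍ} (hxy : SameComponent lines x y) (hp : p ∈ μ) (hq : q ∈ μ')
    (hpm : ∀ w ∈ μ, dGel lines (lineComponents lines) x p ≤ dGel lines (lineComponents lines) x w)
    (hqm : ∀ w ∈ μ', dGel lines (lineComponents lines) y q ≤
      dGel lines (lineComponents lines) y w) :
    ∃ u v, SameComponent lines p u ∧ SameComponent lines u v ∧ SameComponent lines v q := by
  by_cases hqp : SameComponent lines q p
  · exact ⟨p, p, h.sameComponent_self p, h.sameComponent_self p, hqp.symm⟩
  obtain ⟨l, hl, U, V, hs, hqU, hpV, B, hB, hqB, hlB⟩ := h.exists_separating hqp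
  -- If both ends were on one side of `l`, the whole rung would be; but one rung contains `p` and
  -- the other contains `q`. So both rungs meet `l`.
  have n1 : ¬ (a ∈ U ∧ b ∈ U) := fun hab => hμ.side l hl U V hs hab.1 hab.2 hp hpV
  have n2 : ¬ (a ∈ V ∧ b ∈ V) := fun hab => hμ'.side l hl V U hs.symm hab.1 hab.2 hq hqU
  obtain ⟨w, hw, hwl⟩ := hs.inter_nonempty hμ.preconnected hμ.left_mem hμ.right_mem n1 n2
  obtain ⟨w', hw', hwl'⟩ := hs.inter_nonempty hμ'.preconnected hμ'.left_mem hμ'.right_mem n1 n2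
  obtain ⟨A, hA, hxA, hyA⟩ := hxy
  -- The common component of `x` and `y` lies on one closed side of `l`. If that is the side of `q`,
  -- then `x` projects across `l` to `p`, which is possible only for `x` on `l`; if it is the side
  -- of `p`, the same holds for `y`.
  rcases component_side hl hs hA with hside | hside
  · by_cases hxl : x ∈ l
    · have h0 : dGel lines (lineComponents lines) x p = 0 := by
        have h1 : dGel lines (lineComponents lines) x w = 0 :=
          SameComponent.dGel_eq_zero ⟨B, hB, hlB hxl, hlB hwl⟩
        exact le_antisymm (h1 ▸ hpm w hw) bot_le
      exact ⟨x, x, (sameComponent_of_dGel_eq_zero h0).symm, h.sameComponent_self x,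
        ⟨B, hB, hlB hxl, hqB⟩⟩
    · exact absurd (hpm w hw)
        (not_le.2 (h.dGel_lt hl hs (hs.mem_left_of hxl (hside hxA)) hpV hwl))
  · by_cases hyl : y ∈ l
    · have hlA := h.line_subset hl hA hyl hyA
      have h0 : dGel lines (lineComponents lines) x p = 0 := by
        have h1 : dGel lines (lineComponents lines) x w = 0 :=
          SameComponent.dGel_eq_zero ⟨A, hA, hxA, hlA hwl⟩
        exact le_antisymm (h1 ▸ hpm w hw) bot_le
      exact ⟨x, y, (sameComponent_of_dGel_eq_zero h0).symm, ⟨A, hA, hxA, hyA⟩,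
        ⟨B, hB, hlB hyl, hqB⟩⟩
    · exact absurd (hqm w' hw')
        (not_le.2 (h.dGel_lt hl hs.symm (hs.symm.mem_left_of hyl (hside hyA)) hqU hwl'))

/-- Nearest points on the geodesic are close to the component of the electric projection. -/
lemma exists_nearest_close_electric {K : ℝ} (hK : 1 ≤ K) : ∃ C : ℝ, 0 ≤ C ∧ ∀ (f : ℍ ≃ₜ ℍ)
    (r : ℍ → ℍ → ℝ) (lines : Set (Set ℍ)), IsSplitSheet K f r lines → ∀ a b s μ x p q,
      IsGeod r s a b → IsElectricTrace lines a b μ → p ∈ s → (∀ w ∈ s, r x p ≤ r x w) → q ∈ μ →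
      (∀ w ∈ μ, dGel lines (lineComponents lines) x q ≤ dGel lines (lineComponents lines) x w) →
      ∃ t, r p t ≤ C ∧ SameComponent lines t q := by
  obtain ⟨D1, -, hD1⟩ := exists_excess_le_of_geod hK
  obtain ⟨D2, -, hD2⟩ := exists_excess_le_of_nearest hK
  obtain ⟨C, hC⟩ := exists_near_geod hK (max D1 D2)
  refine ⟨max C 0, le_max_right _ _, ?_⟩
  intro f r lines h a b s μ x p q hs hμ hp hmin hq hqmin
  have hr := h.metric
  by_cases hqp : SameComponent lines q p
  · exact ⟨p, by rw [hr.self]; exact le_max_right _ _, hqp.symm⟩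
  obtain ⟨l, hl, U, V, hUV, hqU, hpV, B, hB, hqB, hlB⟩ := h.system.exists_separating hqp
  -- it is enough to bound the excess of `p` between two points of `l`
  have fin : ∀ w ∈ l, ∀ w' ∈ l, excess (f w) (f p) (f w') ≤ max D1 D2 →
      ∃ t, r p t ≤ max C 0 ∧ SameComponent lines t q := by
    intro w hw w' hw' he
    obtain ⟨σ, hσl, hσ⟩ := h.geod l hl w hw w' hw'
    obtain ⟨t, ht, htC⟩ := hC f r hr σ w w' p hσ he
    exact ⟨t, htC.trans (le_max_left _ _), B, hB, hlB (hσl ht), hqB⟩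
  have n2 : ¬ (a ∈ V ∧ b ∈ V) := fun hab => hμ.side l hl V U hUV.symm hab.1 hab.2 hq hqU
  obtain ⟨s1, s2, g1, g2, hs12, hadd⟩ := hs.split hp
  -- If both ends lie on the side of `q`, the geodesic crosses `l` before and after `p`, and `p`
  -- lies on a geodesic between the two crossings.
  by_cases n1 : a ∈ U ∧ b ∈ U
  · obtain ⟨w1, hw1, hwl1⟩ := hUV.inter_nonempty (g1.isPreconnected hr) g1.left_mem g1.right_mem
      (fun h => hUV.symm.not_mem_right hpV h.2) (fun h => hUV.not_mem_right n1.1 h.1)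
    obtain ⟨w2, hw2, hwl2⟩ := hUV.inter_nonempty (g2.isPreconnected hr) g2.left_mem g2.right_mem
      (fun h => hUV.symm.not_mem_right hpV h.1) (fun h => hUV.not_mem_right n1.2 h.2)
    obtain ⟨_, t1, -, k1, -, e1⟩ := g1.split hw1
    obtain ⟨t2, _, k2, -, -, e2⟩ := g2.split hw2
    have k := IsGeod.concat hr k1 k2 (by
      have i1 := hr.triangle w1 p w2
      have i2 := hr.triangle a w1 b
      have i3 := hr.triangle w1 w2 b
      linarith)
    exact fin w1 hwl1 w2 hwl2
      ((hD1 f r hr _ _ _ p k (Or.inl k1.right_mem)).trans (le_max_left _ _))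
  · obtain ⟨v, hv, hvl⟩ := hUV.inter_nonempty (hs.isPreconnected hr) hs.left_mem hs.right_mem n1 n2
    obtain ⟨w, hw, hwl⟩ := hUV.inter_nonempty hμ.preconnected hμ.left_mem hμ.right_mem n1 n2
    -- Beyond `l`, the point `w` of the rung would be electrically closer to `x` than `q`. Hence the
    -- geodesic from `x` to `p` crosses `l` at a point `w'` for which `p` is still a nearest point
    -- of the segment.
    have hxV : x ∉ V := fun hxV =>
      absurd (hqmin w hw) (not_le.2 (h.system.dGel_lt hl hUV.symm hxV hqU hwl))
    obtain ⟨τ, hτ⟩ := hr.exists_geod x p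
    obtain ⟨w', hw', hwl'⟩ := hUV.inter_nonempty (hτ.isPreconnected hr) hτ.left_mem hτ.right_mem
      (fun h => hUV.symm.not_mem_right hpV h.2) (fun h => hxV h.1)
    obtain ⟨_, _, -, -, -, e⟩ := hτ.split hw'
    refine fin w' hwl' v hvl ((hD2 f r hr s a b w' p v hs hp (fun z hz => ?_) hv).trans
      (le_max_right _ _))
    have := hmin z hz
    have := hr.triangle x w' z
    linarith

end SplitSheets

/-! ### Path metrics and electrocution -/

section PathMetrics

variable {X : Type*} [MetricSpace X] {A B : Set X} {x y z : X}

lemma inducedEDist_le_of_curve {c : ℝ → X} {a b : ℝ} (hab : a ≤ b)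
    (hc : ContinuousOn c (Icc a b)) (hA : MapsTo c (Icc a b) A) :
    inducedEDist A (c a) (c b) ≤ eVariationOn c (Icc a b) := by
  have hφ : ∀ t ∈ Icc (0 : ℝ) 1, a + t * (b - a) ∈ Icc a b := fun t ht =>
    ⟨by nlinarith [ht.1, sub_nonneg.2 hab], by nlinarith [ht.2, sub_nonneg.2 hab]⟩
  refine (iInf₂_le (fun t => c (a + t * (b - a))) ⟨?_, fun t ht => hA (hφ t ht), by simp,
    by simp⟩).trans ?_
  · refine eVariationOn.comp_le_of_monotoneOn c (fun t => a + t * (b - a)) ?_ hφ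
    intro s _ t _ hst
    simp only
    nlinarith [sub_nonneg.2 hab]
  · exact hc.comp (by fun_prop) hφ

lemma exists_curve_of_inducedEDist_lt {R : ℝ≥0∞} (h : inducedEDist A x y < R) :
    ∃ c : ℝ → X, ContinuousOn c (Icc 0 1) ∧ MapsTo c (Icc 0 1) A ∧ c 0 = x ∧ c 1 = y ∧
      eVariationOn c (Icc 0 1) < R := by
  obtain ⟨c, hc⟩ := iInf_lt_iff.1 h
  obtain ⟨h1, h2⟩ := iInf_lt_iff.1 hc
  exact ⟨c, h1.1, h1.2.1, h1.2.2.1, h1.2.2.2, h2⟩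

lemma edist_le_inducedEDist : edist x y ≤ inducedEDist A x y := by
  refine le_iInf₂ fun c hc => ?_
  rw [← hc.2.2.1, ← hc.2.2.2]
  exact eVariationOn.edist_le c ⟨le_rfl, zero_le_one⟩ ⟨zero_le_one, le_rfl⟩

lemma inducedEDist_mono (h : A ⊆ B) : inducedEDist B x y ≤ inducedEDist A x y :=
  le_iInf₂ fun c hc => iInf₂_le c ⟨hc.1, hc.2.1.mono_right h, hc.2.2⟩

lemma inducedEDist_comm : inducedEDist A x y = inducedEDist A y x := by
  have key : ∀ x y : X, inducedEDist A x y ≤ inducedEDist A y x := by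
    intro x y
    refine le_iInf₂ fun c hc => ?_
    have hφ : ∀ t ∈ Icc (0 : ℝ) 1, 1 - t ∈ Icc (0 : ℝ) 1 := fun t ht =>
      ⟨by linarith [ht.2], by linarith [ht.1]⟩
    refine (iInf₂_le (fun t => c (1 - t)) ⟨hc.1.comp (by fun_prop) hφ,
      fun t ht => hc.2.1 (hφ t ht), by simpa using hc.2.2.2, by simpa using hc.2.2.1⟩).trans ?_
    refine eVariationOn.comp_le_of_antitoneOn c (fun t => 1 - t) ?_ hφ
    intro s _ t _ hst
    simp only
    linarith
  exact le_antisymm (key x y) (key y x)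

lemma inducedEDist_triangle : inducedEDist A x z ≤ inducedEDist A x y + inducedEDist A y z := by
  refine ENNReal.le_of_forall_pos_le_add fun ε hε htop => ?_
  have hε' : (0 : ℝ≥0∞) < (ε / 2 : ℝ≥0) := by
    rw [ENNReal.coe_pos]; positivity
  have hx : inducedEDist A x y < inducedEDist A x y + (ε / 2 : ℝ≥0) :=
    ENNReal.lt_add_right (ne_top_of_le_ne_top htop.ne le_self_add) hε'.ne'
  have hy : inducedEDist A y z < inducedEDist A y z + (ε / 2 : ℝ≥0) :=
    ENNReal.lt_add_right (ne_top_of_le_ne_top htop.ne le_add_self) hε'.ne'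
  obtain ⟨c1, a1, a2, a3, a4, a5⟩ := exists_curve_of_inducedEDist_lt hx
  obtain ⟨c2, b1, b2, b3, b4, b5⟩ := exists_curve_of_inducedEDist_lt hy
  set c : ℝ → X := fun t => if t ≤ 1 then c1 t else c2 (t - 1) with hcdef
  have hcl : EqOn c c1 (Icc 0 1) := fun t ht => if_pos ht.2
  have hcr : EqOn c (fun t => c2 (t - 1)) (Icc 1 2) := by
    intro t ht
    rcases ht.1.eq_or_lt with rfl | hlt
    · simp [hcdef, a4, b3]
    · exact if_neg (not_le.2 hlt)
  have hφ : ∀ t ∈ Icc (1 : ℝ) 2, t - 1 ∈ Icc (0 : ℝ) 1 := fun t ht =>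
    ⟨by linarith [ht.1], by linarith [ht.2]⟩
  have hun : Icc (0 : ℝ) 2 = Icc 0 1 ∪ Icc 1 2 :=
    (Icc_union_Icc_eq_Icc zero_le_one one_le_two).symm
  have k1 : ContinuousOn c (Icc 0 2) := by
    rw [hun]
    exact (a1.congr hcl).union_of_isClosed ((b1.comp (by fun_prop) hφ).congr hcr)
      isClosed_Icc isClosed_Icc
  have k2 : MapsTo c (Icc 0 2) A := by
    rw [hun]
    rintro t (ht | ht)
    · rw [hcl ht]; exact a2 ht
    · rw [hcr ht]; exact b2 (hφ t ht)
  have k3 := inducedEDist_le_of_curve zero_le_two k1 k2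
  rw [hcl ⟨le_rfl, zero_le_one⟩, hcr ⟨one_le_two, le_rfl⟩, a3] at k3
  have e2 : c2 (2 - 1) = z := by norm_num [b4]
  simp only [e2] at k3
  have k4 : eVariationOn c (Icc 0 2) = eVariationOn c (Icc 0 1) + eVariationOn c (Icc 1 2) := by
    have := eVariationOn.Icc_add_Icc c (s := univ) zero_le_one one_le_two (mem_univ (1 : ℝ))
    simpa using this.symm
  rw [k4, eVariationOn.congr hcl, eVariationOn.congr hcr] at k3
  have k5 : eVariationOn (fun t => c2 (t - 1)) (Icc 1 2) ≤ eVariationOn c2 (Icc 0 1) :=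
    eVariationOn.comp_le_of_monotoneOn c2 (fun t => t - 1)
      (fun s _ t _ hst => by simp only; linarith) hφ
  calc inducedEDist A x z ≤ eVariationOn c1 (Icc 0 1) + eVariationOn c2 (Icc 0 1) :=
        k3.trans (add_le_add le_rfl k5)
    _ ≤ (inducedEDist A x y + (ε / 2 : ℝ≥0)) + (inducedEDist A y z + (ε / 2 : ℝ≥0)) :=
        add_le_add a5.le b5.le
    _ = inducedEDist A x y + inducedEDist A y z + ε := by
        rw [add_add_add_comm, ← ENNReal.coe_add, add_halves]

/-- Subdivision of a curve at two times. -/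
lemma inducedEDist_add_le {c : ℝ → X} (hc : ContinuousOn c (Icc 0 1)) (hA : MapsTo c (Icc 0 1) A)
    {s t : ℝ} (hs : s ∈ Icc (0 : ℝ) 1) (ht : t ∈ Icc (0 : ℝ) 1) (hst : s ≤ t) :
    inducedEDist A (c 0) (c s) + inducedEDist A (c s) (c t) + inducedEDist A (c t) (c 1) ≤
      eVariationOn c (Icc 0 1) := by
  have e1 := eVariationOn.Icc_add_Icc c (s := univ) hs.1 hst (mem_univ s)
  have e2 := eVariationOn.Icc_add_Icc c (s := univ) (hs.1.trans hst) ht.2 (mem_univ t)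
  simp only [univ_inter] at e1 e2
  rw [← e2, ← e1]
  refine add_le_add (add_le_add ?_ ?_) ?_
  · exact inducedEDist_le_of_curve hs.1 (hc.mono (Icc_subset_Icc_right hs.2))
      (hA.mono_left (Icc_subset_Icc_right hs.2))
  · exact inducedEDist_le_of_curve hst (hc.mono (Icc_subset_Icc hs.1 ht.2))
      (hA.mono_left (Icc_subset_Icc hs.1 ht.2))
  · exact inducedEDist_le_of_curve ht.2 (hc.mono (Icc_subset_Icc_left ht.1))
      (hA.mono_left (Icc_subset_Icc_left ht.1))

lemma inducedEDist_le_of_lipschitz {c : ℝ → X} {L : ℝ≥0} (hA : MapsTo c (Icc 0 1) A)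
    (hL : ∀ s ∈ Icc (0 : ℝ) 1, ∀ t ∈ Icc (0 : ℝ) 1, edist (c s) (c t) ≤ L * edist s t) :
    inducedEDist A (c 0) (c 1) ≤ L := by
  have hlip : LipschitzOnWith L c (Icc 0 1) := fun s hs t ht => hL s hs t ht
  refine (inducedEDist_le_of_curve zero_le_one hlip.continuousOn hA).trans ?_
  have := hlip.comp_eVariationOn_le (mapsTo_id _)
  refine this.trans ?_
  have hid : eVariationOn (id : ℝ → ℝ) (Icc 0 1) ≤ ENNReal.ofReal (1 - 0) := by
    have := (monotoneOn_id (s := Icc (0 : ℝ) 1)).eVariationOn_eq (a := 0) (b := 1)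
      ⟨le_rfl, zero_le_one⟩ ⟨zero_le_one, le_rfl⟩
    rw [inter_self] at this
    exact this.le
  calc (L : ℝ≥0∞) * eVariationOn (id : ℝ → ℝ) (Icc 0 1) ≤ L * ENNReal.ofReal (1 - 0) := by gcongr
    _ = L := by simp

end PathMetrics

/-! ### The pseudometric of finite chains with free or priced jumps. -/

section Electrocute

variable {X : Type*} {d : X → X → ℝ≥0∞} {w : ℝ≥0∞} {H : Set (Set X)} {x y z : X}

lemma electrocute_le_step : electrocute d w H x y ≤ electricStep d w H x y := by
  refine (iInf_le_of_le 1 (iInf₂_le (fun k => if k = 0 then x else y) ⟨rfl, rfl⟩)).trans ?_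
  simp

lemma electrocute_le : electrocute d w H x y ≤ d x y :=
  electrocute_le_step.trans (min_le_left _ _)

lemma electrocute_le_of_mem {S : Set X} (hS : S ∈ H) (hx : x ∈ S) (hy : y ∈ S) :
    electrocute d w H x y ≤ w :=
  electrocute_le_step.trans ((min_le_right _ _).trans (iInf₂_le_of_le S hS (iInf_le _ ⟨hx, hy⟩)))

lemma exists_chain_of_electrocute_lt {R : ℝ≥0∞} (h : electrocute d w H x y < R) :
    ∃ (n : ℕ) (p : ℕ → X), p 0 = x ∧ p n = y ∧
      ∑ k ∈ Finset.range n, electricStep d w H (p k) (p (k + 1)) < R := by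
  obtain ⟨n, hn⟩ := iInf_lt_iff.1 h
  obtain ⟨p, hp⟩ := iInf_lt_iff.1 hn
  obtain ⟨h1, h2⟩ := iInf_lt_iff.1 hp
  exact ⟨n, p, h1.1, h1.2, h2⟩

lemma electrocute_chain_le {n : ℕ} {p : ℕ → X} (h0 : p 0 = x) (hn : p n = y) :
    electrocute d w H x y ≤ ∑ k ∈ Finset.range n, electricStep d w H (p k) (p (k + 1)) :=
  iInf_le_of_le n (iInf₂_le p ⟨h0, hn⟩)

lemma electrocute_triangle :
    electrocute d w H x z ≤ electrocute d w H x y + electrocute d w H y z := by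
  refine ENNReal.le_of_forall_pos_le_add fun ε hε htop => ?_
  have hε' : (0 : ℝ≥0∞) < (ε / 2 : ℝ≥0) := by
    rw [ENNReal.coe_pos]; positivity
  have hx : electrocute d w H x y < electrocute d w H x y + (ε / 2 : ℝ≥0) :=
    ENNReal.lt_add_right (ne_top_of_le_ne_top htop.ne le_self_add) hε'.ne'
  have hy : electrocute d w H y z < electrocute d w H y z + (ε / 2 : ℝ≥0) :=
    ENNReal.lt_add_right (ne_top_of_le_ne_top htop.ne le_add_self) hε'.ne'
  obtain ⟨n, p, p0, pn, hp⟩ := exists_chain_of_electrocute_lt hx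
  obtain ⟨m, q, q0, qm, hq⟩ := exists_chain_of_electrocute_lt hy
  set c : ℕ → X := fun k => if k ≤ n then p k else q (k - n) with hc
  have hcr : ∀ k, c (n + k) = q k := by
    intro k
    rcases Nat.eq_zero_or_pos k with rfl | hk
    · simp [hc, pn, q0]
    · simp only [hc]
      rw [if_neg (by omega), Nat.add_sub_cancel_left]
  have h1 : electrocute d w H x z ≤
      ∑ k ∈ Finset.range (n + m), electricStep d w H (c k) (c (k + 1)) :=
    electrocute_chain_le (by simp [hc, p0]) (by rw [hcr, qm])
  rw [Finset.sum_range_add] at h1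
  have h2 : ∑ k ∈ Finset.range n, electricStep d w H (c k) (c (k + 1)) =
      ∑ k ∈ Finset.range n, electricStep d w H (p k) (p (k + 1)) := by
    refine Finset.sum_congr rfl fun k hk => ?_
    have hk' := Finset.mem_range.1 hk
    simp only [hc]
    rw [if_pos (by omega), if_pos (by omega)]
  have h3 : ∑ k ∈ Finset.range m, electricStep d w H (c (n + k)) (c (n + k + 1)) =
      ∑ k ∈ Finset.range m, electricStep d w H (q k) (q (k + 1)) := by
    refine Finset.sum_congr rfl fun k _ => ?_
    rw [hcr, add_assoc, hcr]
  rw [h2, h3] at h1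
  calc electrocute d w H x z ≤ (electrocute d w H x y + (ε / 2 : ℝ≥0)) +
        (electrocute d w H y z + (ε / 2 : ℝ≥0)) := h1.trans (add_le_add hp.le hq.le)
    _ = electrocute d w H x y + electrocute d w H y z + ε := by
        rw [add_add_add_comm, ← ENNReal.coe_add, add_halves]

lemma electricStep_comm (hd : ∀ x y, d x y = d y x) :
    electricStep d w H x y = electricStep d w H y x := by
  unfold electricStep
  rw [hd x y]
  simp only [and_comm]

lemma electrocute_comm (hd : ∀ x y, d x y = d y x) :
    electrocute d w H x y = electrocute d w H y x := by
  have key : ∀ x y, electrocute d w H x y ≤ electrocute d w H y x := by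
    intro x y
    refine le_iInf fun n => le_iInf₂ fun p hp => ?_
    refine (electrocute_chain_le (n := n) (p := fun k => p (n - k)) (by simp [hp.2])
      (by simp [hp.1])).trans ?_
    rw [← Finset.sum_range_reflect]
    refine (Finset.sum_congr rfl fun k hk => ?_).le
    have hk' := Finset.mem_range.1 hk
    rw [electricStep_comm hd, show n - (n - 1 - k) = k + 1 by omega,
      show n - (n - 1 - k + 1) = k by omega]
  exact le_antisymm (key x y) (key y x)

end Electrocute

/-! ### Transport of electric notions along an injection -/

section Transport

variable {X : Type*} {ι : ℍ → X} {d : X → X → ℝ≥0∞} {r : ℍ → ℍ → ℝ} {lines comps : Set (Set ℍ)}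

lemma IsElectricPath.image {n : ℕ} {A l : ℕ → Set ℍ} {a b : ℍ}
    (h : IsElectricPath lines comps n A l a b) :
    IsElectricPath (Set.image ι '' lines) (Set.image ι '' comps) n (fun k => ι '' A k)
        (fun k => ι '' l k)
      (ι a) (ι b) :=
  ⟨fun k hk => ⟨_, h.1 k hk, rfl⟩, ⟨a, h.2.1, rfl⟩, ⟨b, h.2.2.1, rfl⟩, fun k hk =>
    ⟨⟨_, (h.2.2.2 k hk).1, rfl⟩, subset_inter
      (image_mono ((h.2.2.2 k hk).2.trans inter_subset_left))
      (image_mono ((h.2.2.2 k hk).2.trans inter_subset_right))⟩⟩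

lemma IsElectricPath.preimage (hι : Function.Injective ι) {n : ℕ} {A l : ℕ → Set X} {a b : ℍ}
    (h : IsElectricPath (Set.image ι '' lines) (Set.image ι '' comps) n A l (ι a) (ι b)) :
    IsElectricPath lines comps n (fun k => ι ⁻¹' A k) (fun k => ι ⁻¹' l k) a b := by
  refine ⟨fun k hk => ?_, h.2.1, h.2.2.1, fun k hk => ⟨?_, preimage_mono (h.2.2.2 k hk).2⟩⟩
  · obtain ⟨B, hB, e⟩ := h.1 k hk
    simp only [← e, preimage_image_eq _ hι]
    exact hB
  · obtain ⟨B, hB, e⟩ := (h.2.2.2 k hk).1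
    simp only [← e, preimage_image_eq _ hι]
    exact hB

/-- The sheet geometry is developed on the plane while rungs live in the model; this is applied with
`ι` the inclusion `M.pt n` of a sheet. -/
lemma dGel_image (hι : Function.Injective ι) (a b : ℍ) :
    dGel (Set.image ι '' lines) (Set.image ι '' comps) (ι a) (ι b) = dGel lines comps a b := by
  apply le_antisymm
  · refine le_iInf₂ fun n ⟨A, l, h⟩ => dGel_le (IsElectricPath.image h)
  · refine le_iInf₂ fun n ⟨A, l, h⟩ => dGel_le (IsElectricPath.preimage hι h)

lemma IsGeodesicSegment.image (hd : ∀ z w, d (ι z) (ι w) = toEDist r z w) {s : Set ℍ} {u v : ℍ}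
    (h : IsGeodesicSegment (toEDist r) s u v) : IsGeodesicSegment d (ι '' s) (ι u) (ι v) := by
  obtain ⟨T, c, hT, h0, h1, hc, rfl⟩ := h
  refine ⟨T, fun t => ι (c t), hT, congrArg ι h0, congrArg ι h1, fun t ht t' ht' => ?_, ?_⟩
  · rw [hd, hc t ht t' ht']
  · rw [← image_comp]; rfl

lemma IsGeodesicSegment.preimage (hι : Function.Injective ι)
    (hd : ∀ z w, d (ι z) (ι w) = toEDist r z w) {s : Set X} {u v : ℍ}
    (h : IsGeodesicSegment d s (ι u) (ι v)) (hs : s ⊆ range ι) :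
    IsGeodesicSegment (toEDist r) (ι ⁻¹' s) u v := by
  obtain ⟨T, c, hT, h0, h1, hc, rfl⟩ := h
  have hex : ∀ t, ∃ z, t ∈ Icc 0 T → ι z = c t := by
    intro t
    by_cases ht : t ∈ Icc 0 T
    · obtain ⟨z, hz⟩ := hs ⟨t, ht, rfl⟩
      exact ⟨z, fun _ => hz⟩
    · exact ⟨u, fun h => absurd h ht⟩
  choose g hg using hex
  refine ⟨T, g, hT, hι ?_, hι ?_, fun t ht t' ht' => ?_, ?_⟩
  · rw [hg 0 ⟨le_rfl, hT⟩, h0]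
  · rw [hg T ⟨hT, le_rfl⟩, h1]
  · rw [← hd, hg t ht, hg t' ht', hc t ht t' ht']
  · ext z
    constructor
    · rintro ⟨t, ht, e⟩
      exact ⟨t, ht, hι (by rw [hg t ht, e])⟩
    · rintro ⟨t, ht, rfl⟩
      exact ⟨t, ht, (hg t ht).symm⟩

lemma gate_preimage (hι : Function.Injective ι) (n : ℕ) (l : ℕ → Set X) (a b : ℍ) (k : ℕ) :
    ι ⁻¹' gate n l (ι a) (ι b) k = gate n (fun k => ι ⁻¹' l k) a b k := by
  unfold gate
  split_ifs
  · rw [← image_singleton, preimage_image_eq _ hι]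
  · rfl
  · rw [← image_singleton, preimage_image_eq _ hι]

lemma gate_image (n : ℕ) (l : ℕ → Set ℍ) (a b : ℍ) (k : ℕ) :
    gate n (fun k => ι '' l k) (ι a) (ι b) k = ι '' gate n l a b k := by
  unfold gate
  split_ifs
  · rw [image_singleton]
  · rfl
  · rw [image_singleton]

lemma IsElectroAmbient.image (hι : Function.Injective ι)
    (hd : ∀ z w, d (ι z) (ι w) = toEDist r z w) {a b : ℍ} {μ : Set ℍ}
    (h : IsElectroAmbient (toEDist r) lines comps a b μ) :
    IsElectroAmbient d (Set.image ι '' lines) (Set.image ι '' comps) (ι a) (ι b) (ι '' μ) := by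
  obtain ⟨n, A, l, u, v, seg, int, hp, hn, hseg, hint, rfl⟩ := h
  refine ⟨n, _, _, fun k => ι (u k), fun k => ι (v k), fun k => ι '' seg k, fun k => ι '' int k,
    hp.image, by rw [dGel_image hι, hn], fun k hk => ⟨?_, ?_, ?_, ?_, ?_⟩, fun k hk => ⟨?_, ?_⟩, ?_⟩
  · rw [gate_image]; exact ⟨_, (hseg k hk).1, rfl⟩
  · rw [gate_image]; exact ⟨_, (hseg k hk).2.1, rfl⟩
  · rw [gate_image, gate_image]
    rintro _ ⟨p, hp, rfl⟩ _ ⟨q, hq, rfl⟩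
    rw [hd, hd]
    exact (hseg k hk).2.2.1 p hp q hq
  · exact (hseg k hk).2.2.2.1.image hd
  · exact image_mono (hseg k hk).2.2.2.2
  · exact (hint k hk).1.image hd
  · exact image_mono (hint k hk).2
  · simp only [image_union, image_iUnion]

lemma IsElectroAmbient.preimage (hι : Function.Injective ι)
    (hd : ∀ z w, d (ι z) (ι w) = toEDist r z w) {a b : ℍ} {μ : Set X}
    (h : IsElectroAmbient d (Set.image ι '' lines) (Set.image ι '' comps) (ι a) (ι b) μ) :
    μ ⊆ range ι ∧ IsElectroAmbient (toEDist r) lines comps a b (ι ⁻¹' μ) := by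
  obtain ⟨n, A, l, u, v, seg, int, hp, hn, hseg, hint, rfl⟩ := h
  have hA : ∀ k ≤ n, A k ⊆ range ι := by
    intro k hk
    obtain ⟨B, -, e⟩ := hp.1 k hk
    rw [← e]
    exact image_subset_range _ _
  have hl : ∀ k < n, l (k + 1) ⊆ range ι := fun k hk =>
    ((hp.2.2.2 k hk).2.trans inter_subset_left).trans (hA k hk.le)
  have hsegr : ∀ k ≤ n, seg k ⊆ range ι := fun k hk => (hseg k hk).2.2.2.2.trans (hA k hk)
  have hintr : ∀ k < n, int k ⊆ range ι := fun k hk => (hint k hk).2.trans (hl k hk)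
  -- The corner points are constrained only for indices up to `n`; beyond that the pullback takes
  -- the dummy value `a`.
  have hu : ∀ k, ∃ z, k ≤ n → ι z = u k := by
    intro k
    by_cases hk : k ≤ n
    · obtain ⟨T, c, hT, h0, -, -, e⟩ := (hseg k hk).2.2.2.1
      obtain ⟨z, hz⟩ := hsegr k hk (e ▸ ⟨0, ⟨le_rfl, hT⟩, h0⟩ : u k ∈ seg k)
      exact ⟨z, fun _ => hz⟩
    · exact ⟨a, fun h => absurd h hk⟩
  have hv : ∀ k, ∃ z, k ≤ n → ι z = v k := by
    intro k
    by_cases hk : k ≤ n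
    · obtain ⟨T, c, hT, -, h0, -, e⟩ := (hseg k hk).2.2.2.1
      obtain ⟨z, hz⟩ := hsegr k hk (e ▸ ⟨T, ⟨hT, le_rfl⟩, h0⟩ : v k ∈ seg k)
      exact ⟨z, fun _ => hz⟩
    · exact ⟨a, fun h => absurd h hk⟩
  choose u' hu' using hu
  choose v' hv' using hv
  refine ⟨union_subset (iUnion₂_subset hsegr) (iUnion₂_subset hintr), n, _, _, u', v',
    fun k => ι ⁻¹' seg k, fun k => ι ⁻¹' int k, hp.preimage hι, by rw [hn, dGel_image hι],
    fun k hk => ⟨?_, ?_, ?_, ?_, ?_⟩, fun k hk => ⟨?_, ?_⟩, ?_⟩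
  · rw [← gate_preimage hι, mem_preimage, hu' k hk]; exact (hseg k hk).1
  · rw [← gate_preimage hι, mem_preimage, hv' k hk]; exact (hseg k hk).2.1
  · intro p hp q hq
    rw [← gate_preimage hι] at hp hq
    rw [← hd, ← hd, hu' k hk, hv' k hk]
    exact (hseg k hk).2.2.1 _ hp _ hq
  · have := (hseg k hk).2.2.2.1
    rw [← hu' k hk, ← hv' k hk] at this
    exact this.preimage hι hd (hsegr k hk)
  · exact preimage_mono (hseg k hk).2.2.2.2
  · have := (hint k hk).1
    rw [← hv' k hk.le, ← hu' (k + 1) hk] at this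
    exact this.preimage hι hd (hintr k hk)
  · exact preimage_mono (hint k hk).2
  · simp only [preimage_union, preimage_iUnion]

lemma isElectricNearestPoint_image_iff (hι : Function.Injective ι)
    (hd : ∀ z w, d (ι z) (ι w) = toEDist r z w) {μ : Set X} (hμ : μ ⊆ range ι) {x p : ℍ} :
    IsElectricNearestPoint d (Set.image ι '' lines) (Set.image ι '' comps) μ (ι x) (ι p) ↔
      IsElectricNearestPoint (toEDist r) lines comps (ι ⁻¹' μ) x p := by
  unfold IsElectricNearestPoint
  refine and_congr Iff.rfl ⟨fun h q hq => ?_, fun h q hq => ?_⟩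
  · have := h (ι q) hq
    rwa [dGel_image hι, dGel_image hι, hd, hd] at this
  · obtain ⟨q, rfl⟩ := hμ hq
    have := h q hq
    rwa [dGel_image hι, dGel_image hι, hd, hd]

lemma isNearestPoint_image_iff (hd : ∀ z w, d (ι z) (ι w) = toEDist r z w) {μ : Set X}
    (hμ : μ ⊆ range ι) {x p : ℍ} :
    IsNearestPoint d μ (ι x) (ι p) ↔ IsNearestPoint (toEDist r) (ι ⁻¹' μ) x p := by
  unfold IsNearestPoint
  refine and_congr Iff.rfl ⟨fun h q hq => ?_, fun h q hq => ?_⟩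
  · have := h (ι q) hq
    rwa [hd, hd] at this
  · obtain ⟨q, rfl⟩ := hμ hq
    have := h q hq
    rwa [hd, hd]

end Transport

/-! ### Sheets of a marked model -/

namespace MarkedModel

variable {Γ : Subgroup SL(2, ℝ)} {X : Type*} [MetricSpace X] (M : MarkedModel Γ X)

lemma zero_mem_J : (0 : ℝ) ∈ M.J := by
  rcases M.J_eq with h | h <;> rw [h] <;> simp

open Classical in
/-- The point over `z` at height `t` (at height `0` if there is no height `t`). -/
def pt (t : ℝ) (z : ℍ) : X :=
  if h : t ∈ M.J then M.mark (z, ⟨t, h⟩) else M.mark (z, ⟨0, M.zero_mem_J⟩)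

variable {M}

lemma pt_of_mem {t : ℝ} (h : t ∈ M.J) (z : ℍ) : M.pt t z = M.mark (z, ⟨t, h⟩) := dif_pos h

@[simp] lemma base_pt (t : ℝ) (z : ℍ) : M.base (M.pt t z) = z := by
  unfold pt base
  split_ifs <;> simp

lemma height_pt {t : ℝ} (h : t ∈ M.J) (z : ℍ) : M.height (M.pt t z) = t := by
  rw [pt_of_mem h]
  simp [height]

lemma height_mem (p : X) : M.height p ∈ M.J := (M.mark.symm p).2.2

lemma pt_height_base (p : X) : M.pt (M.height p) (M.base p) = p := by
  rw [pt_of_mem (height_mem p)]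
  exact M.mark.apply_symm_apply p

lemma pt_injective (t : ℝ) : Function.Injective (M.pt t) := fun z w h => by
  simpa using congrArg M.base h

lemma continuous_base : Continuous M.base := continuous_fst.comp M.mark.symm.continuous

lemma continuous_height : Continuous M.height :=
  continuous_subtype_val.comp (continuous_snd.comp M.mark.symm.continuous)

lemma continuous_pt (t : ℝ) : Continuous (M.pt t) := by
  by_cases h : t ∈ M.J
  · have : M.pt t = fun z => M.mark (z, ⟨t, h⟩) := funext (pt_of_mem h)
    rw [this]
    exact M.mark.continuous.comp (Continuous.prodMk_left _)
  · have : M.pt t = fun z => M.mark (z, ⟨0, M.zero_mem_J⟩) := funext fun z => dif_neg h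
    rw [this]
    exact M.mark.continuous.comp (Continuous.prodMk_left _)

lemma mem_sheet_iff {n : ℤ} {p : X} : p ∈ M.sheet n ↔ M.height p = n := by
  simp [sheet, region]

lemma mem_J_of_mem_sheet {n : ℤ} {p : X} (h : p ∈ M.sheet n) : (n : ℝ) ∈ M.J := by
  rw [← mem_sheet_iff.1 h]
  exact height_mem p

lemma pt_mem_sheet {n : ℤ} (hn : (n : ℝ) ∈ M.J) (z : ℍ) : M.pt n z ∈ M.sheet n :=
  mem_sheet_iff.2 (height_pt hn z)

lemma pt_base_of_mem_sheet {n : ℤ} {p : X} (h : p ∈ M.sheet n) : M.pt n (M.base p) = p := by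
  rw [← mem_sheet_iff.1 h, pt_height_base]

lemma sheet_eq_range {n : ℤ} (hn : (n : ℝ) ∈ M.J) : M.sheet n = range (M.pt n) := by
  ext p
  constructor
  · intro h
    exact ⟨_, pt_base_of_mem_sheet h⟩
  · rintro ⟨z, rfl⟩
    exact pt_mem_sheet hn z

lemma region_singleton {t : ℝ} (ht : t ∈ M.J) (A : Set ℍ) : M.region A {t} = M.pt t '' A := by
  ext p
  constructor
  · rintro ⟨h1, h2⟩
    refine ⟨_, h1, ?_⟩
    obtain rfl : M.height p = t := h2
    exact pt_height_base p
  · rintro ⟨z, hz, rfl⟩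
    exact ⟨by simpa using hz, height_pt ht z⟩

lemma atLevel_eq {n : ℤ} (hn : (n : ℝ) ∈ M.J) (F : Set (Set ℍ)) :
    M.atLevel n F = Set.image (M.pt n) '' F :=
  image_congr fun A _ => region_singleton hn A

lemma amalgamationComponents_eq (i : ℤ) :
    M.amalgamationComponents i = lineComponents (M.splitLines i) := rfl

/-- The distance of the sheet at level `n` as a function on `ℍ`. -/
def sheetR (M : MarkedModel Γ X) (n : ℤ) (z w : ℍ) : ℝ := (M.sheetDist n (M.pt n z)
    (M.pt n w)).toReal

/-- The action of a deck transformation. -/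
def deck (M : MarkedModel Γ X) (γ : SL(2, ℝ)) (p : X) : X := M.pt (M.height p) (γ • M.base p)

lemma dist_deck {γ : SL(2, ℝ)} (hγ : γ ∈ Γ) (p q : X) :
    dist (M.deck γ p) (M.deck γ q) = dist p q := by
  unfold deck
  rw [pt_of_mem (height_mem p), pt_of_mem (height_mem q), M.deck_isometry γ hγ,
    ← pt_of_mem, ← pt_of_mem, pt_height_base, pt_height_base]

lemma deck_pt {t : ℝ} (ht : t ∈ M.J) (γ : SL(2, ℝ)) (z : ℍ) :
    M.deck γ (M.pt t z) = M.pt t (γ • z) := by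
  rw [deck, height_pt ht, base_pt]

lemma height_deck (γ : SL(2, ℝ)) (p : X) : M.height (M.deck γ p) = M.height p :=
  height_pt (height_mem p) _

lemma sheetDist_deck_le {γ : SL(2, ℝ)} (hγ : γ ∈ Γ) (n : ℤ) (p q : X) :
    M.sheetDist n (M.deck γ p) (M.deck γ q) ≤ M.sheetDist n p q := by
  have hlip : LipschitzWith 1 (M.deck γ) :=
    LipschitzWith.of_dist_le_mul fun p q => by simp [dist_deck hγ]
  refine le_iInf₂ fun c hc => ?_
  refine (iInf₂_le (fun t => M.deck γ (c t)) ⟨hlip.continuous.comp_continuousOn hc.1, fun t ht =>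
      ?_,
    by simp only [hc.2.2.1], by simp only [hc.2.2.2]⟩).trans ?_
  · have := (hlip.lipschitzOnWith (s := univ)).comp_eVariationOn_le (g := c) (s := Icc 0 1)
      (mapsTo_univ _ _)
    rwa [ENNReal.coe_one, one_mul] at this
  · rw [mem_sheet_iff, height_deck]
    exact mem_sheet_iff.1 (hc.2.1 ht)

lemma sheetR_smul {n : ℤ} (hn : (n : ℝ) ∈ M.J) {γ : SL(2, ℝ)} (hγ : γ ∈ Γ) (z w : ℍ) :
    M.sheetR n (γ • z) (γ • w) = M.sheetR n z w := by
  unfold sheetR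
  congr 1
  rw [← deck_pt hn, ← deck_pt hn]
  apply le_antisymm (sheetDist_deck_le hγ n _ _)
  have := sheetDist_deck_le (M := M) (Γ.inv_mem hγ) n (M.deck γ (M.pt n z)) (M.deck γ (M.pt n w))
  simpa only [deck_pt hn, inv_smul_smul] using this

/-- Without an admissible curve inside the sheet the infimum is over an empty family and equals `⊤`.
-/
lemma mem_sheet_of_sheetDist_ne_top {n : ℤ} {p q : X} (h : M.sheetDist n p q ≠ ⊤) :
    q ∈ M.sheet n := by
  obtain ⟨c, -, h2, -, h3, -⟩ := exists_curve_of_inducedEDist_lt (lt_top_iff_ne_top.2 h)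
  rw [← h3]
  exact h2 ⟨zero_le_one, le_rfl⟩

lemma geodesicSegment_subset_sheet {n : ℤ} {s : Set X} {u v : X}
    (h : IsGeodesicSegment (M.sheetDist n) s u v) : s ⊆ M.sheet n := by
  obtain ⟨T, c, hT, -, -, hc, rfl⟩ := h
  rintro _ ⟨t, ht, rfl⟩
  apply mem_sheet_of_sheetDist_ne_top (p := c 0)
  rw [hc 0 ⟨le_rfl, hT⟩ t ht]
  exact ENNReal.ofReal_ne_top

/-- `f` is `K`-bi-Lipschitz from the sheet at level `n` to `ℍ`. -/
def SheetBiLip (M : MarkedModel Γ X) (K : ℝ≥0) (n : ℤ) (f : ℍ ≃ₜ ℍ) : Prop :=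
  ∀ z w, edist (f z) (f w) ≤ K * M.sheetDist n (M.pt n z) (M.pt n w) ∧
    M.sheetDist n (M.pt n z) (M.pt n w) ≤ K * edist (f z) (f w)

lemma SheetBiLip.sheetDist_eq {K : ℝ≥0} {n : ℤ} {f : ℍ ≃ₜ ℍ} (h : M.SheetBiLip K n f) (z w : ℍ) :
    M.sheetDist n (M.pt n z) (M.pt n w) = toEDist (M.sheetR n) z w := by
  rw [toEDist, sheetR, ENNReal.ofReal_toReal]
  exact ne_top_of_le_ne_top (ENNReal.mul_ne_top ENNReal.coe_ne_top (edist_ne_top _ _)) (h z w).2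

lemma SheetBiLip.isSheetMetric {K : ℝ≥0} {n : ℤ} {f : ℍ ≃ₜ ℍ} (h : M.SheetBiLip K n f)
    (hK : 1 ≤ K) : IsSheetMetric K f (M.sheetR n) := by
  have htop : ∀ z w, M.sheetDist n (M.pt n z) (M.pt n w) ≠ ⊤ := fun z w =>
    ne_top_of_le_ne_top (ENNReal.mul_ne_top ENNReal.coe_ne_top (edist_ne_top _ _)) (h z w).2
  refine ⟨by exact_mod_cast hK, fun z w => ?_, fun x y z => ?_, fun z w => ?_, fun z w => ?_, ?_⟩
  · unfold sheetR sheetDist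
    rw [inducedEDist_comm]
  · unfold sheetR
    rw [← ENNReal.toReal_add (htop _ _) (htop _ _)]
    exact ENNReal.toReal_mono (ENNReal.add_ne_top.2 ⟨htop _ _, htop _ _⟩) inducedEDist_triangle
  · have := ENNReal.toReal_mono (ENNReal.mul_ne_top ENNReal.coe_ne_top (htop _ _)) (h z w).1
    rwa [ENNReal.toReal_mul, ENNReal.coe_toReal, ← dist_edist] at this
  · have := ENNReal.toReal_mono (ENNReal.mul_ne_top ENNReal.coe_ne_top (edist_ne_top _ _)) (h z w).2
    rwa [ENNReal.toReal_mul, ENNReal.coe_toReal, ← dist_edist] at this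
  · intro a b ε hε
    have hlt : M.sheetDist n (M.pt n a) (M.pt n b) <
        M.sheetDist n (M.pt n a) (M.pt n b) + ENNReal.ofReal ε :=
      ENNReal.lt_add_right (htop _ _) (ENNReal.ofReal_pos.2 hε).ne'
    obtain ⟨c, h1, h2, h3, h4, h5⟩ := exists_curve_of_inducedEDist_lt hlt
    have hpt : ∀ t ∈ Icc (0 : ℝ) 1, M.pt n (M.base (c t)) = c t := fun t ht =>
      pt_base_of_mem_sheet (h2 ht)
    refine ⟨fun t => M.base (c t), continuous_base.comp_continuousOn h1, by simp [h3], by simp [h4],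
      fun s hs t ht hst => ?_⟩
    have h6 := (inducedEDist_add_le h1 h2 hs ht hst).trans h5.le
    rw [h3, h4] at h6
    change M.sheetDist n _ _ + M.sheetDist n _ _ + M.sheetDist n _ _ ≤ _ at h6
    rw [← hpt s hs, ← hpt t ht] at h6
    have h7 := ENNReal.toReal_mono (ENNReal.add_ne_top.2 ⟨htop _ _, ENNReal.ofReal_ne_top⟩) h6
    rwa [ENNReal.toReal_add (ENNReal.add_ne_top.2 ⟨htop _ _, htop _ _⟩) (htop _ _),
      ENNReal.toReal_add (htop _ _) (htop _ _), ENNReal.toReal_add (htop _ _) ENNReal.ofReal_ne_top,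
      ENNReal.toReal_ofReal hε.le] at h7

/-- A product structure on a sheet is a bi-Lipschitz map. -/
lemma exists_sheetBiLip {a D : ℝ} {K K' : ℝ≥0} {n : ℤ} (hn : (n : ℝ) ∈ M.J) (hK : K ≤ K')
    (h : M.IsBiLipschitzProduct a D K {(n : ℝ)}) : ∃ f, M.SheetBiLip K' n f := by
  obtain ⟨f, -, hf⟩ := h
  refine ⟨f, fun z w => ?_⟩
  have := hf (M.pt n z) (pt_mem_sheet hn z) (M.pt n w) (pt_mem_sheet hn w)
  rw [base_pt, base_pt, height_pt hn, height_pt hn] at this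
  have e : edist (f z, (n : ℝ)) (f w, (n : ℝ)) = edist (f z) (f w) := by
    rw [Prod.edist_eq]; simp
  rw [e] at this
  have hK' : (K : ℝ≥0∞) ≤ K' := by exact_mod_cast hK
  exact ⟨this.1.trans (mul_le_mul_left hK' _), this.2.trans (mul_le_mul_left hK' _)⟩

/-- `f` gives a `K`-bi-Lipschitz product structure of the block `i`. -/
def BlockBiLip (M : MarkedModel Γ X) (K : ℝ≥0) (i : ℤ) (f : ℍ ≃ₜ ℍ) : Prop :=
  ∀ p ∈ M.region univ (Icc (i : ℝ) (i + 1)), ∀ q ∈ M.region univ (Icc (i : ℝ) (i + 1)),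
    edist (f (M.base p), M.height p) (f (M.base q), M.height q)
        ≤ K * inducedEDist (M.region univ (Icc (i : ℝ) (i + 1))) p q ∧
      inducedEDist (M.region univ (Icc (i : ℝ) (i + 1))) p q
        ≤ K * edist (f (M.base p), M.height p) (f (M.base q), M.height q)

/-- The product structure of a thick block restricts to its horizontal boundary. -/
lemma BlockBiLip.sheetBiLip {K : ℝ≥0} {i : ℤ} {f : ℍ ≃ₜ ℍ} (h : M.BlockBiLip K i f) {n : ℤ}
    (hn : (n : ℝ) ∈ M.J) (hni : (n : ℝ) ∈ Icc (i : ℝ) (i + 1)) : M.SheetBiLip K n f := by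
  have hmem : ∀ z, M.pt n z ∈ M.region univ (Icc (i : ℝ) (i + 1)) := fun z =>
    ⟨trivial, by rw [height_pt hn]; exact hni⟩
  have hsub : M.sheet n ⊆ M.region univ (Icc (i : ℝ) (i + 1)) := fun p hp =>
    ⟨trivial, by rw [mem_sheet_iff.1 hp]; exact hni⟩
  have hb : ∀ z w, edist (f z) (f w) ≤
        K * inducedEDist (M.region univ (Icc (i : ℝ) (i + 1))) (M.pt n z) (M.pt n w) ∧
      inducedEDist (M.region univ (Icc (i : ℝ) (i + 1))) (M.pt n z) (M.pt n w) ≤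
        K * edist (f z) (f w) := by
    intro z w
    have := h _ (hmem z) _ (hmem w)
    rw [base_pt, base_pt, height_pt hn, height_pt hn] at this
    have e : edist (f z, (n : ℝ)) (f w, (n : ℝ)) = edist (f z) (f w) := by
      rw [Prod.edist_eq]; simp
    rwa [e] at this
  refine fun z w => ⟨(hb z w).1.trans (mul_le_mul_right (inducedEDist_mono hsub) _), ?_⟩
  -- For the upper bound the hyperbolic geodesic is pulled back to the sheet. It is Lipschitz for
  -- the ambient metric by the block estimate, and its length is the same whether measured in the
  -- sheet or in the slab.
  obtain ⟨γ, h0, h1, hγ⟩ := exists_geodesic_param (f z) (f w)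
  have hL := inducedEDist_le_of_lipschitz (A := M.sheet n) (c := fun t => M.pt n (f.symm (γ t)))
    (L := K * nndist (f z) (f w)) (fun t _ => pt_mem_sheet hn _) (fun s _ t _ => by
      refine edist_le_inducedEDist.trans ((hb _ _).2.trans (le_of_eq ?_))
      rw [f.apply_symm_apply, f.apply_symm_apply, edist_dist, hγ, ENNReal.ofReal_mul dist_nonneg,
        edist_dist, Real.dist_eq, ENNReal.coe_mul, ← edist_nndist, edist_dist, mul_assoc])
  simp only [h0, h1, f.symm_apply_apply] at hL
  rwa [ENNReal.coe_mul, ← edist_nndist] at hL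

end MarkedModel

/-! ### Lifts of tubes -/

namespace Tube

lemma lift_mul (T : Tube) (g γ : SL(2, ℝ)) :
    (fun z : ℍ => g • z) '' T.lift γ = T.lift (g * γ) := by
  simp only [lift, image_image, mul_smul]

lemma mem_interval {T : Tube} {n : ℤ} (h : T.SplitsLevel n) : (n : ℝ) ∈ T.interval := by
  obtain ⟨h1, h2⟩ := h
  have h1' : (T.lo : ℝ) ≤ 2 * n := by exact_mod_cast h1
  have h2' : 2 * (n : ℝ) ≤ T.hi := by exact_mod_cast h2
  exact ⟨by linarith, by linarith⟩

lemma zpow_smul_curve {T : Tube} {ε : ℝ} (h : ∀ s, T.curve (s + ε) = T.gen • T.curve s) (k : ℤ)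
    (s : ℝ) : T.gen ^ k • T.curve s = T.curve (s + k * ε) := by
  induction k using Int.induction_on generalizing s with
  | zero => simp
  | succ n ih =>
    rw [zpow_add_one, mul_smul, ← h, ih]
    push_cast
    ring_nf
  | pred n ih =>
    have h1 : T.gen⁻¹ • T.curve s = T.curve (s - ε) := by
      rw [inv_smul_eq_iff, ← h, sub_add_cancel]
    rw [zpow_sub_one, mul_smul, h1, ih]
    push_cast
    ring_nf

/-- The generator slides the chosen lift along itself, so lifts depend only on cosets of its powers.
-/
lemma lift_mul_zpow {T : Tube} {ε : ℝ} (h : ∀ s, T.curve (s + ε) = T.gen • T.curve s) (k : ℤ)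
    (γ : SL(2, ℝ)) : T.lift (γ * T.gen ^ k) = T.lift γ := by
  ext z
  constructor
  · rintro ⟨_, ⟨s, rfl⟩, rfl⟩
    exact ⟨_, ⟨s + k * ε, rfl⟩, by simp only [mul_smul, zpow_smul_curve h]⟩
  · rintro ⟨_, ⟨s, rfl⟩, rfl⟩
    refine ⟨_, ⟨s - k * ε, rfl⟩, ?_⟩
    simp only [mul_smul, zpow_smul_curve h, sub_add_cancel]

end Tube

namespace MarkedModel

variable {Γ : Subgroup SL(2, ℝ)} {X : Type*} [MetricSpace X] {M : MarkedModel Γ X}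

/-- The separation axiom compares a lift with the chosen lift of the other tube; a deck
transformation reduces a general pair to this case. A pair not covered by the axiom consists of one
lift written in two ways. -/
lemma IsWeakSplitGeometry.exists_lift_eq (hM : M.IsWeakSplitGeometry) :
    ∃ ρ : ℝ, 0 < ρ ∧ ∀ T ∈ M.tubes, ∀ T' ∈ M.tubes, ∀ γ ∈ Γ, ∀ γ' ∈ Γ,
      ∀ p ∈ M.region (T.lift γ) T.interval, ∀ q ∈ M.region (T'.lift γ') T'.interval,
        dist p q < ρ → T = T' ∧ T.lift γ = T'.lift γ' := by
  obtain ⟨ρ, hρ, hsep⟩ := hM.separated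
  obtain ⟨ε, -, hann⟩ := hM.standard_annuli
  refine ⟨ρ, hρ, fun T hT T' hT' γ hγ γ' hγ' p hp q hq hpq => ?_⟩
  have hmove : ∀ (S : Tube) g x, x ∈ M.region (S.lift g) S.interval →
      M.deck γ'⁻¹ x ∈ M.region (S.lift (γ'⁻¹ * g)) S.interval := by
    rintro S g x ⟨h1, h2⟩
    refine ⟨?_, by rwa [height_deck]⟩
    rw [← S.lift_mul, deck, base_pt]
    exact ⟨_, h1, rfl⟩
  have hq' := hmove _ _ _ hq
  rw [inv_mul_cancel] at hq'
  by_cases hcase : T ≠ T' ∨ γ'⁻¹ * γ ∉ Subgroup.zpowers T.gen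
  · have := hsep T hT T' hT' _ (Γ.mul_mem (Γ.inv_mem hγ') hγ) hcase _ (hmove _ _ _ hp) _ hq'
    rw [dist_deck (Γ.inv_mem hγ')] at this
    linarith
  · push Not at hcase
    obtain ⟨rfl, k, hk⟩ := hcase
    refine ⟨rfl, ?_⟩
    have : γ = γ' * T.gen ^ k := by
      simp only at hk
      rw [hk, mul_inv_cancel_left]
    rw [this, Tube.lift_mul_zpow (hann T hT).1]

/-- A horizontal boundary of a split block. -/
lemma SheetBiLip.isSplitSheet {K : ℝ≥0} {n : ℤ} {f : ℍ ≃ₜ ℍ} (h : M.SheetBiLip K n f)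
    (hM : M.IsWeakSplitGeometry) (hK : 1 ≤ K) (hn : (n : ℝ) ∈ M.J) {i : ℤ}
    (hi : n = i ∨ n = i + 1) : IsSplitSheet K f (M.sheetR n) (M.splitLines i) := by
  have hr := h.isSheetMetric hK
  obtain ⟨ρ, hρ, hsep⟩ := hM.exists_lift_eq
  obtain ⟨ε, hε, hann⟩ := hM.standard_annuli
  have hlines : ∀ l ∈ M.splitLines i, ∃ T ∈ M.tubes, T.SplitsLevel n ∧ ∃ γ ∈ Γ, l = T.lift γ := by
    rintro l ⟨T, hT, hs, hl⟩
    refine ⟨T, hT, ?_, hl⟩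
    rcases hi with rfl | rfl
    · exact hs.1
    · exact hs.2
  have hcurve : ∀ T ∈ M.tubes, T.SplitsLevel n → ∀ γ ∈ Γ, ∀ s s',
      M.sheetR n (γ • T.curve s) (γ • T.curve s') = |s - s'| := by
    intro T hT hs γ hγ s s'
    rw [sheetR_smul hn hγ, sheetR, (hann T hT).2.2 n hs s s' _ (pt_mem_sheet hn _) _
      (pt_mem_sheet hn _) (base_pt _ _) (base_pt _ _), ENNReal.toReal_ofReal (abs_nonneg _)]
  refine ⟨hr, ⟨fun l hl => ?_, fun z => ?_⟩, fun l hl u hu v hv => ?_, fun l hl => ?_⟩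
  · obtain ⟨T, hT, hs, γ, hγ, rfl⟩ := hlines l hl
    obtain ⟨Φ, hΦ⟩ := (hM.tube T hT).2.1
    have e : T.lift γ = (Φ.trans (Homeomorph.smul γ)) '' (univ ×ˢ {0}) := by
      ext z
      constructor
      · rintro ⟨_, ⟨s, rfl⟩, rfl⟩
        exact ⟨(s, 0), ⟨trivial, rfl⟩, by simp [hΦ]⟩
      · rintro ⟨⟨s, t⟩, ⟨-, ht⟩, rfl⟩
        obtain rfl : t = 0 := ht
        exact ⟨_, ⟨s, rfl⟩, by simp [hΦ]⟩
    rw [e]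
    exact exists_isSides _
  · refine ⟨M.pt n ⁻¹' Metric.ball (M.pt n z) (ρ / 2),
      (continuous_pt _).continuousAt (Metric.ball_mem_nhds _ (half_pos hρ)), ?_⟩
    rintro l hl l' hl' ⟨u, hu, huO⟩ ⟨v, hv, hvO⟩
    obtain ⟨T, hT, hs, γ, hγ, rfl⟩ := hlines l hl
    obtain ⟨T', hT', hs', γ', hγ', rfl⟩ := hlines l' hl'
    refine (hsep T hT T' hT' γ hγ γ' hγ' (M.pt n u) ⟨by rwa [base_pt], ?_⟩ (M.pt n v)
      ⟨by rwa [base_pt], ?_⟩ ?_).2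
    · rw [height_pt hn]; exact Tube.mem_interval hs
    · rw [height_pt hn]; exact Tube.mem_interval hs'
    · have := dist_triangle_right (M.pt n u) (M.pt n v) (M.pt n z)
      have h1 : dist (M.pt n u) (M.pt n z) < ρ / 2 := huO
      have h2 : dist (M.pt n v) (M.pt n z) < ρ / 2 := hvO
      linarith
  · obtain ⟨T, hT, hs, γ, hγ, rfl⟩ := hlines l hl
    obtain ⟨_, ⟨s, rfl⟩, rfl⟩ := hu
    obtain ⟨_, ⟨s', rfl⟩, rfl⟩ := hv
    wlog hss : s ≤ s' generalizing s s'
    · obtain ⟨S, hS, hg⟩ := this s' s (le_of_not_ge hss)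
      exact ⟨S, hS, hg.symm⟩
    refine ⟨_, ?_, s' - s, fun t => γ • T.curve (s + t), sub_nonneg.2 hss, by simp, by simp,
      fun t _ t' _ => ?_, rfl⟩
    · rintro _ ⟨t, -, rfl⟩
      exact ⟨_, ⟨_, rfl⟩, rfl⟩
    · rw [hcurve T hT hs γ hγ]
      congr 1; ring
  · obtain ⟨T, hT, hs, γ, hγ, rfl⟩ := hlines l hl
    obtain ⟨Φ, hΦ⟩ := (hM.tube T hT).2.1
    have hcont : Continuous T.curve := by
      rw [show T.curve = fun s => Φ (s, 0) from funext hΦ]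
      exact Φ.continuous.comp (Continuous.prodMk_left _)
    refine ⟨(fun s => γ • T.curve s) '' Icc 0 ε, ?_,
      isCompact_Icc.image (hcont.const_smul γ), ?_⟩
    · rintro _ ⟨s, -, rfl⟩
      exact ⟨_, ⟨s, rfl⟩, rfl⟩
    · rintro _ ⟨_, ⟨s, rfl⟩, rfl⟩
      -- This conjugate of a power of the generator shifts the parameter `s` by whole periods into
      -- `[0, ε]`.
      set g := γ * T.gen ^ (-⌊s / ε⌋) * γ⁻¹ with hg
      have hgΓ : g ∈ Γ := Γ.mul_mem (Γ.mul_mem hγ (Γ.zpow_mem (hM.tube T hT).1 _)) (Γ.inv_mem hγ)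
      refine ⟨MulAction.toPerm g, fun z w => sheetR_smul hn hgΓ z w, ?_, ?_, ?_⟩
      · change (fun z : ℍ => g • z) '' _ = _
        rw [T.lift_mul, hg, inv_mul_cancel_right, Tube.lift_mul_zpow (hann T hT).1]
      · rintro _ ⟨T', hT', hs', γ', hγ', rfl⟩
        exact ⟨T', hT', hs', g * γ', Γ.mul_mem hgΓ hγ', T'.lift_mul g γ'⟩
      · have e : g • γ • T.curve s = γ • T.curve (s + (-⌊s / ε⌋ : ℤ) * ε) := by
          rw [← Tube.zpow_smul_curve (hann T hT).1, hg, mul_smul, mul_smul, inv_smul_smul]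
        refine ⟨s + (-⌊s / ε⌋ : ℤ) * ε, ⟨?_, ?_⟩, e.symm⟩
        · have := Int.floor_le (s / ε)
          rw [le_div_iff₀ hε] at this
          push_cast
          linarith
        · have := (Int.lt_floor_add_one (s / ε)).le
          rw [div_le_iff₀ hε] at this
          push_cast
          linarith

end MarkedModel

/-! ### The graph metric -/

namespace MarkedModel

variable {Γ : Subgroup SL(2, ℝ)} {X : Type*} [MetricSpace X] {M : MarkedModel Γ X}

lemma telDist_comm (p q : X) : M.telDist p q = M.telDist q p :=
  electrocute_comm fun _ _ => edist_comm _ _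

lemma graphDist_comm (p q : X) : M.graphDist p q = M.graphDist q p :=
  electrocute_comm telDist_comm

lemma graphDist_triangle (p q r : X) : M.graphDist p r ≤ M.graphDist p q + M.graphDist q r :=
  electrocute_triangle

lemma graphDist_le_edist (p q : X) : M.graphDist p q ≤ edist p q :=
  electrocute_le.trans electrocute_le

lemma graphDist_self (p : X) : M.graphDist p p = 0 :=
  nonpos_iff_eq_zero.1 ((graphDist_le_edist p p).trans (edist_self p).le)

/-- Points of a split component are close in the graph metric. -/
lemma graphDist_le_two {i : ℤ} (hi : M.IsSplit i) {p q : X}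
    (h : SameComponent (M.splitLines i) (M.base p) (M.base q))
    (hp : M.height p ∈ Icc (i : ℝ) (i + 1)) (hq : M.height q ∈ Icc (i : ℝ) (i + 1)) :
    M.graphDist p q ≤ 2 := by
  obtain ⟨A, hA, h1, h2⟩ := h
  exact electrocute_le_of_mem ⟨i, hi, A, hA, rfl⟩ ⟨h1, hp⟩ ⟨h2, hq⟩

lemma IsSplit.isBlock (hM : M.IsWeakSplitGeometry) {i : ℤ} (hi : M.IsSplit i) : M.IsBlock i := by
  obtain ⟨T, hT, h1, h2⟩ := hi
  refine Subset.trans ?_ (hM.tube T hT).2.2.2.2.2.1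
  have e1 := (Tube.mem_interval h1).1
  have e2 := (Tube.mem_interval h2).2
  push_cast at e2
  exact Icc_subset_Icc e1 e2

lemma IsBlock.mem_J {i n : ℤ} (hi : M.IsBlock i) (hn : n = i ∨ n = i + 1) : (n : ℝ) ∈ M.J := by
  apply hi
  rcases hn with rfl | rfl <;> constructor <;> push_cast <;> linarith

lemma isBlock_of_mem_J {n : ℤ} (hn : (n : ℝ) ∈ M.J) : M.IsBlock n := by
  unfold IsBlock
  rcases M.J_eq with h | h
  · rw [h]; exact subset_univ _
  · rw [h] at hn ⊢
    exact fun t ht => le_trans (mem_Ici.1 hn) ht.1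

/-- The constant of the bi-Lipschitz structures of sheets and thick blocks. -/
structure IsGeometryConstant (M : MarkedModel Γ X) (K : ℝ≥0) : Prop where
  one_le : 1 ≤ K
  sheet : ∀ n : ℤ, (n : ℝ) ∈ M.J → ∃ f, M.SheetBiLip K n f
  block : ∀ i, M.IsBlock i → ¬ M.IsSplit i → ∃ f, M.BlockBiLip K i f

lemma IsWeakSplitGeometry.exists_constant (hM : M.IsWeakSplitGeometry) :
    ∃ K, M.IsGeometryConstant K := by
  obtain ⟨a, D, K, -, h1, h2⟩ := hM.bounded_geometry
  refine ⟨max K 1, le_max_right _ _, fun n hn => exists_sheetBiLip hn (le_max_left _ _) (h1 n),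
    fun i hi hs => ?_⟩
  obtain ⟨f, -, hf⟩ := h2 i hi hs
  have hK' : (K : ℝ≥0∞) ≤ (max K 1 : ℝ≥0) := by exact_mod_cast le_max_left _ _
  exact ⟨f, fun p hp q hq => ⟨(hf p hp q hq).1.trans (mul_le_mul_left hK' _),
    (hf p hp q hq).2.trans (mul_le_mul_left hK' _)⟩⟩

lemma SheetBiLip.edist_pt_le {K : ℝ≥0} {n : ℤ} {f : ℍ ≃ₜ ℍ} (h : M.SheetBiLip K n f) (z w : ℍ) :
    edist (M.pt n z) (M.pt n w) ≤ ENNReal.ofReal (M.sheetR n z w) := by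
  have := h.sheetDist_eq z w
  unfold toEDist at this
  rw [← this]
  exact edist_le_inducedEDist

/-! ### Rungs and projections -/

lemma IsRung.eq_pt {i n : ℤ} {a b : ℍ} {μ : Set X} (h : M.IsRung i n a b μ) :
    (M.IsSplit i → IsElectroAmbient (M.sheetDist n) (M.atLevel n (M.splitLines i))
      (M.atLevel n (M.amalgamationComponents i)) (M.pt n a) (M.pt n b) μ) ∧
    (¬ M.IsSplit i → IsGeodesicSegment (M.sheetDist n) μ (M.pt n a) (M.pt n b)) := by
  obtain ⟨a', ha', b', hb', rfl, rfl, h⟩ := h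
  rwa [pt_base_of_mem_sheet ha', pt_base_of_mem_sheet hb']

variable {K : ℝ≥0} {n i : ℤ} {f : ℍ ≃ₜ ℍ} {a b : ℍ} {μ : Set X}

lemma IsRung.electroAmbient (h : M.IsRung i n a b μ) (hs : M.IsSplit i) (hn : (n : ℝ) ∈ M.J)
    (hf : M.SheetBiLip K n f) : μ ⊆ range (M.pt n) ∧
      IsElectroAmbient (toEDist (M.sheetR n)) (M.splitLines i) (lineComponents (M.splitLines i))
        a b (M.pt n ⁻¹' μ) := by
  have := h.eq_pt.1 hs
  rw [atLevel_eq hn, atLevel_eq hn, amalgamationComponents_eq] at this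
  exact this.preimage (pt_injective _) hf.sheetDist_eq

lemma IsRung.isGeod (h : M.IsRung i n a b μ) (hs : ¬ M.IsSplit i) (hn : (n : ℝ) ∈ M.J)
    (hf : M.SheetBiLip K n f) (hK : 1 ≤ K) : μ ⊆ range (M.pt n) ∧
      IsGeod (M.sheetR n) (M.pt n ⁻¹' μ) a b := by
  have := h.eq_pt.2 hs
  have hsub := geodesicSegment_subset_sheet this
  rw [sheet_eq_range hn] at hsub
  exact ⟨hsub, (hf.isSheetMetric hK).isGeodesicSegment_iff.1
    (this.preimage (pt_injective _) hf.sheetDist_eq hsub)⟩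

/-- `p` is the projection of `x` in the block `i` to the rung `μ` at level `n`. -/
def IsBlockProjection (M : MarkedModel Γ X) (i n : ℤ) (μ : Set X) (x p : X) : Prop :=
  (M.IsSplit i → IsElectricNearestPoint (M.sheetDist n) (M.atLevel n (M.splitLines i))
    (M.atLevel n (M.amalgamationComponents i)) μ x p) ∧
  (¬ M.IsSplit i → IsNearestPoint (M.sheetDist n) μ x p)

lemma IsBlockProjection.of_split {x p : X} (h : M.IsBlockProjection i n μ x p)
    (hr : M.IsRung i n a b μ) (hs : M.IsSplit i) (hn : (n : ℝ) ∈ M.J) (hf : M.SheetBiLip K n f)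
    (hx : x ∈ M.sheet n) : p = M.pt n (M.base p) ∧
      IsElectricNearestPoint (toEDist (M.sheetR n)) (M.splitLines i)
        (lineComponents (M.splitLines i)) (M.pt n ⁻¹' μ) (M.base x) (M.base p) := by
  obtain ⟨hsub, -⟩ := hr.electroAmbient hs hn hf
  have h1 := h.1 hs
  obtain ⟨z, rfl⟩ := hsub h1.1
  rw [base_pt]
  refine ⟨rfl, ?_⟩
  rw [← pt_base_of_mem_sheet hx, atLevel_eq hn, atLevel_eq hn, amalgamationComponents_eq,
    isElectricNearestPoint_image_iff (pt_injective _) hf.sheetDist_eq hsub] at h1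
  exact h1

lemma IsBlockProjection.of_thick {x p : X} (h : M.IsBlockProjection i n μ x p)
    (hr : M.IsRung i n a b μ) (hs : ¬ M.IsSplit i) (hn : (n : ℝ) ∈ M.J) (hf : M.SheetBiLip K n f)
    (hK : 1 ≤ K) (hx : x ∈ M.sheet n) : p = M.pt n (M.base p) ∧ M.base p ∈ M.pt n ⁻¹' μ ∧
      ∀ q ∈ M.pt n ⁻¹' μ, M.sheetR n (M.base x) (M.base p) ≤ M.sheetR n (M.base x) q := by
  obtain ⟨hsub, -⟩ := hr.isGeod hs hn hf hK
  have h1 := h.2 hs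
  obtain ⟨z, rfl⟩ := hsub h1.1
  rw [base_pt]
  rw [← pt_base_of_mem_sheet hx, isNearestPoint_image_iff hf.sheetDist_eq hsub] at h1
  exact ⟨rfl, h1.1, fun q hq => (hf.isSheetMetric hK).toEDist_le_iff.1 (h1.2 q hq)⟩

lemma exists_isBlockProjection (hM : M.IsWeakSplitGeometry) (hr : M.IsRung i n a b μ)
    (hn : (n : ℝ) ∈ M.J) (hni : n = i ∨ n = i + 1) (hf : M.SheetBiLip K n f) (hK : 1 ≤ K) {x : X}
    (hx : x ∈ M.sheet n) : ∃ p, M.IsBlockProjection i n μ x p := by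
  rw [← pt_base_of_mem_sheet hx]
  by_cases hs : M.IsSplit i
  · obtain ⟨hsub, hE⟩ := hr.electroAmbient hs hn hf
    have hS := hf.isSplitSheet hM hK hn hni
    obtain ⟨hc, ht⟩ := hS.trace hE
    obtain ⟨p, hp⟩ := hS.exists_nearest hc ⟨a, ht.left_mem⟩ (M.base x)
    refine ⟨M.pt n p, fun _ => ?_, fun h => absurd hs h⟩
    rw [atLevel_eq hn, atLevel_eq hn, amalgamationComponents_eq]
    exact (isElectricNearestPoint_image_iff (pt_injective _) hf.sheetDist_eq hsub).2 hp
  · obtain ⟨hsub, hg⟩ := hr.isGeod hs hn hf hK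
    have hm := hf.isSheetMetric hK
    obtain ⟨p, hp, hmin⟩ := (hg.isCompact hm).exists_isMinOn ⟨a, hg.left_mem⟩
      (hm.continuous_left (M.base x)).continuousOn
    exact ⟨M.pt n p, fun h => absurd h hs, fun _ => (isNearestPoint_image_iff hf.sheetDist_eq
        hsub).2
      ⟨hp, fun q hq => hm.toEDist_le_iff.2 (hmin hq)⟩⟩

/-- Every rung joins the points over the same two ends, so the rungs of different blocks can be
chosen independently of each other. -/
lemma exists_isLadder (hM : M.IsWeakSplitGeometry) {a b : X} {lam : Set X} (ha : a ∈ M.sheet 0)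
    (hb : b ∈ M.sheet 0) (hlam : IsGeodesicSegment (M.sheetDist 0) lam a b) :
    ∃ L : ℤ → ℤ → Set X, M.IsLadder lam a b L := by
  obtain ⟨K, hK, hsheet, -⟩ := hM.exists_constant
  have key : ∀ i n : ℤ, ∃ μ : Set X, M.IsBlock i → n = i ∨ n = i + 1 →
      M.IsRung i n (M.base a) (M.base b) μ ∧ (n = 0 → ¬ M.IsSplit i → μ = lam) := by
    intro i n
    by_cases hi : M.IsBlock i
    swap
    · exact ⟨∅, fun h => absurd h hi⟩
    by_cases hni : n = i ∨ n = i + 1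
    swap
    · exact ⟨∅, fun _ h => absurd h hni⟩
    have hn := hi.mem_J hni
    obtain ⟨f, hf⟩ := hsheet n hn
    have hrung : ∀ μ, (M.IsSplit i → IsElectroAmbient (M.sheetDist n) (M.atLevel n (M.splitLines i))
        (M.atLevel n (M.amalgamationComponents i)) (M.pt n (M.base a)) (M.pt n (M.base b)) μ) →
        (¬ M.IsSplit i → IsGeodesicSegment (M.sheetDist n) μ (M.pt n (M.base a))
          (M.pt n (M.base b))) → M.IsRung i n (M.base a) (M.base b) μ := fun μ h1 h2 =>
      ⟨_, pt_mem_sheet hn _, _, pt_mem_sheet hn _, base_pt _ _, base_pt _ _, h1, h2⟩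
    by_cases hs : M.IsSplit i
    · obtain ⟨μ, hμ⟩ := (hf.isSplitSheet hM hK hn hni).exists_isElectroAmbient (M.base a) (M.base b)
      refine ⟨M.pt n '' μ, fun _ _ => ⟨hrung _ (fun _ => ?_) fun h => absurd hs h,
        fun _ h => absurd hs h⟩⟩
      rw [atLevel_eq hn, atLevel_eq hn, amalgamationComponents_eq]
      exact hμ.image (pt_injective _) hf.sheetDist_eq
    by_cases h0 : n = 0
    · subst h0
      refine ⟨lam, fun _ _ => ⟨hrung _ (fun h => absurd h hs) fun _ => ?_, fun _ _ => rfl⟩⟩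
      rwa [pt_base_of_mem_sheet ha, pt_base_of_mem_sheet hb]
    · obtain ⟨s, hg⟩ := (hf.isSheetMetric hK).exists_geod (M.base a) (M.base b)
      refine ⟨M.pt n '' s, fun _ _ => ⟨hrung _ (fun h => absurd h hs) fun _ => ?_,
        fun h => absurd h h0⟩⟩
      exact ((hf.isSheetMetric hK).isGeodesicSegment_iff.2 hg).image hf.sheetDist_eq
  choose L hL using key
  exact ⟨L, hL⟩

variable {a b : X} {lam : Set X} {L : ℤ → ℤ → Set X}

lemma IsLadder.exists_projection (hL : M.IsLadder lam a b L) (hM : M.IsWeakSplitGeometry)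
    {x : X} (hx : x ∈ M.horizontal) : ∃ p, M.IsProjection L x p := by
  obtain ⟨K, hK, hsheet, -⟩ := hM.exists_constant
  obtain ⟨n, hx⟩ := hx
  have hn := mem_J_of_mem_sheet hx
  obtain ⟨f, hf⟩ := hsheet n hn
  have hb := isBlock_of_mem_J hn
  obtain ⟨p, hp⟩ := exists_isBlockProjection hM (hL n n hb (Or.inl rfl)).1 hn (Or.inl rfl) hf hK hx
  exact ⟨p, n, n, hb, Or.inl rfl, hx, hp⟩

lemma int_eq_of_mem_sheet {n m : ℤ} {x : X} (h : x ∈ M.sheet n) (h' : x ∈ M.sheet m) : n = m := by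
  rw [mem_sheet_iff] at h h'
  exact_mod_cast h.symm.trans h'

/-- Projections are close to coarse centers of the triangle of the projected point and the ends of
the ladder. -/
lemma exists_center_of_projection (hM : M.IsWeakSplitGeometry) (hK : M.IsGeometryConstant K) :
    ∃ C D : ℝ, 0 ≤ C ∧ 0 ≤ D ∧ ∀ a b lam L, M.IsLadder lam a b L → ∀ x p n, M.IsProjection L x p →
      x ∈ M.sheet n → ∃ p0, M.graphDist p (M.pt n p0) ≤ ENNReal.ofReal C ∧
        ∀ f, M.SheetBiLip K n f →
          IsCoarseCenter D (f (M.base x)) (f (M.base a)) (f (M.base b)) (f p0) := by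
  have hK1 : (1 : ℝ) ≤ K := by exact_mod_cast hK.one_le
  obtain ⟨D, hD0, hD⟩ := exists_isCoarseCenter hK1
  obtain ⟨C, hC0, hC⟩ := exists_nearest_close_electric hK1
  refine ⟨2 + C, D, by linarith, hD0, ?_⟩
  intro a b lam L hL x p m ⟨i, n, hi, hni, hx, hp⟩ hxm
  obtain rfl := int_eq_of_mem_sheet hx hxm
  replace hp : M.IsBlockProjection i n (L i n) x p := hp
  have hn := hi.mem_J hni
  obtain ⟨f, hf⟩ := hK.sheet n hn
  have hr := (hL i n hi hni).1
  by_cases hs : M.IsSplit i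
  · obtain ⟨-, hE⟩ := hr.electroAmbient hs hn hf
    have hS := hf.isSplitSheet hM hK.one_le hn hni
    obtain ⟨-, ht⟩ := hS.trace hE
    obtain ⟨hpe, hp⟩ := hp.of_split hr hs hn hf hx
    -- This geodesic is auxiliary and not part of the ladder: its nearest point to `x` serves as the
    -- coarse center.
    obtain ⟨s, hg⟩ := hS.metric.exists_geod (M.base a) (M.base b)
    obtain ⟨p0, hp0, hmin⟩ := (hg.isCompact hS.metric).exists_isMinOn ⟨_, hg.left_mem⟩
      (hS.metric.continuous_left (M.base x)).continuousOn
    have hmin' : ∀ q ∈ s, M.sheetR n (M.base x) p0 ≤ M.sheetR n (M.base x) q := fun q hq => hmin hq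
    obtain ⟨t, ht1, ht2⟩ := hC f _ _ hS _ _ s _ (M.base x) p0 (M.base p) hg ht hp0 hmin' hp.1
      fun w hw => hp.dGel_le hw
    -- The nearest point is a center in every chart of the sheet. This freedom lets the two sheets
    -- of a thick block be compared in one chart.
    refine ⟨p0, ?_, fun g hg' => hD g _ (hg'.isSheetMetric hK.one_le) s _ _ _ _ hg hp0 hmin'⟩
    refine (graphDist_triangle _ (M.pt n t) _).trans ?_
    rw [ENNReal.ofReal_add zero_le_two hC0]
    have hlev : (n : ℝ) ∈ Icc (i : ℝ) (i + 1) := by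
      rcases hni with rfl | rfl <;> constructor <;> push_cast <;> linarith
    refine add_le_add ?_ ?_
    · rw [hpe, ENNReal.ofReal_ofNat]
      refine graphDist_le_two hs ?_ ?_ ?_
      · rw [base_pt, base_pt]; exact ht2.symm
      · rwa [height_pt hn]
      · rwa [height_pt hn]
    · refine (graphDist_le_edist _ _).trans ((hf.edist_pt_le _ _).trans ?_)
      rw [hS.metric.symm]
      exact ENNReal.ofReal_le_ofReal ht1
  · obtain ⟨-, hg⟩ := hr.isGeod hs hn hf hK.one_le
    obtain ⟨hpe, hp, hmin⟩ := hp.of_thick hr hs hn hf hK.one_le hx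
    refine ⟨M.base p, ?_, fun g hg' => hD g _ (hg'.isSheetMetric hK.one_le) _ _ _ _ _ hg hp hmin⟩
    rw [← hpe, graphDist_self]
    exact bot_le

/-! ### Coarse behaviour of projections on sheets, thick blocks and split components. -/

/-- A map of the union of the sheets that is coarsely well behaved on sheets, blocks and split
components. -/
structure IsCoarseRetraction (M : MarkedModel Γ X) (c C : ℝ≥0) (R : X → X → Prop) : Prop where
  sheet : ∀ n : ℤ, ∀ x ∈ M.sheet n, ∀ y ∈ M.sheet n, ∀ p q, R x p → R y q →
    M.sheetDist n x y ≤ c → M.graphDist p q ≤ C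
  block : ∀ i : ℤ, ∀ x ∈ M.sheet i, ∀ y ∈ M.sheet (i + 1), ∀ p q, R x p → R y q →
    M.base x = M.base y → M.graphDist p q ≤ C
  component : ∀ i n m : ℤ, M.IsSplit i → (n = i ∨ n = i + 1) → (m = i ∨ m = i + 1) →
    ∀ x ∈ M.sheet n, ∀ y ∈ M.sheet m, ∀ p q, R x p → R y q →
    SameComponent (M.splitLines i) (M.base x) (M.base y) → M.graphDist p q ≤ C

/-- Both values are close to coarse centers of triangles differing by a small displacement of one
vertex. With `c = 0` it says that all values at one point, from either adjacent block, are close. -/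
lemma IsGeometryConstant.exists_close_of_sheet (hM : M.IsWeakSplitGeometry)
    (hK : M.IsGeometryConstant K) (c : ℝ≥0) :
    ∃ C : ℝ≥0, ∀ a b lam L, M.IsLadder lam a b L → ∀ n : ℤ, ∀ x ∈ M.sheet n, ∀ y ∈ M.sheet n,
      ∀ p q, M.IsProjection L x p → M.IsProjection L y q → M.sheetDist n x y ≤ c →
      M.graphDist p q ≤ C := by
  obtain ⟨C, D, hC0, hD0, hC⟩ := exists_center_of_projection hM hK
  refine ⟨Real.toNNReal (C + (K * (D + 2 * (K * c) + 2 * Real.log 5) + C)), ?_⟩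
  intro a b lam L hL n x hx y hy p q hp hq hxy
  have hn := mem_J_of_mem_sheet hx
  obtain ⟨f, hf⟩ := hK.sheet n hn
  have hm := hf.isSheetMetric hK.one_le
  obtain ⟨p0, hp0, hpc⟩ := hC a b lam L hL x p n hp hx
  obtain ⟨q0, hq0, hqc⟩ := hC a b lam L hL y q n hq hy
  have hd : dist (f (M.base x)) (f (M.base y)) ≤ K * c := by
    refine (hm.lower _ _).trans (mul_le_mul_of_nonneg_left ?_ K.2)
    unfold sheetR
    rw [pt_base_of_mem_sheet hx, pt_base_of_mem_sheet hy]
    exact ENNReal.toReal_le_coe_of_le_coe hxy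
  have h1 : IsCoarseCenter (D + 2 * (K * c)) (f (M.base y)) (f (M.base a)) (f (M.base b)) (f p0) :=
    (hpc f hf).move.mono (by linarith)
  have h2 := h1.dist_le ((hqc f hf).mono (by have : (0 : ℝ) ≤ K * c := by positivity
                                             linarith))
  have h3 := (hm.upper p0 q0).trans (mul_le_mul_of_nonneg_left h2 K.2)
  have h3' := (hm.nonneg p0 q0).trans h3
  refine (graphDist_triangle _ (M.pt n p0) _).trans ?_
  change _ ≤ ENNReal.ofReal _
  rw [ENNReal.ofReal_add hC0 (add_nonneg h3' hC0), ENNReal.ofReal_add h3' hC0]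
  refine add_le_add hp0 ((graphDist_triangle _ (M.pt n q0) _).trans (add_le_add ?_ ?_))
  · exact (graphDist_le_edist _ _).trans ((hf.edist_pt_le _ _).trans (ENNReal.ofReal_le_ofReal h3))
  · rwa [graphDist_comm]

/-- The given values may come from neighbouring blocks, so they are first replaced by projections
made in block `i` itself. These are joined through three components, each costing 2, hence the 6. -/
lemma IsGeometryConstant.exists_close_of_component (hM : M.IsWeakSplitGeometry)
    (hK : M.IsGeometryConstant K) :
    ∃ C : ℝ≥0, ∀ a b lam L, M.IsLadder lam a b L → ∀ i n m : ℤ, M.IsSplit i →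
      (n = i ∨ n = i + 1) → (m = i ∨ m = i + 1) → ∀ x ∈ M.sheet n, ∀ y ∈ M.sheet m,
      ∀ p q, M.IsProjection L x p → M.IsProjection L y q →
      SameComponent (M.splitLines i) (M.base x) (M.base y) → M.graphDist p q ≤ C := by
  obtain ⟨C, hC⟩ := hK.exists_close_of_sheet hM 0
  refine ⟨C + (6 + C), ?_⟩
  intro a b lam L hL i n m hs hn hm x hx y hy p q hp hq hxy
  have hi := hs.isBlock hM
  have hkey : ∀ k : ℤ, k = i ∨ k = i + 1 → ∀ z ∈ M.sheet k, ∀ w, M.IsProjection L z w →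
      ∃ w' : ℍ, M.graphDist w (M.pt k w') ≤ C ∧ ∃ μ, IsElectricTrace (M.splitLines i) (M.base a)
        (M.base b) μ ∧ w' ∈ μ ∧ ∀ v ∈ μ,
        dGel (M.splitLines i) (lineComponents (M.splitLines i)) (M.base z) w' ≤
        dGel (M.splitLines i) (lineComponents (M.splitLines i)) (M.base z) v := by
    intro k hk z hz w hw
    have hkJ := hi.mem_J hk
    obtain ⟨f, hf⟩ := hK.sheet k hkJ
    have hr := (hL i k hi hk).1
    obtain ⟨w1, hw1⟩ := exists_isBlockProjection hM hr hkJ hk hf hK.one_le hz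
    obtain ⟨e, hne⟩ := hw1.of_split hr hs hkJ hf hz
    obtain ⟨-, ht⟩ := (hf.isSplitSheet hM hK.one_le hkJ hk).trace (hr.electroAmbient hs hkJ hf).2
    refine ⟨M.base w1, ?_, _, ht, hne.1, fun v hv => hne.dGel_le hv⟩
    rw [← e]
    refine hC a b lam L hL k z hz z hz w w1 hw ⟨i, k, hi, hk, hz, hw1⟩ ?_
    refine le_of_eq ?_
    have := hf.sheetDist_eq (M.base z) (M.base z)
    rw [pt_base_of_mem_sheet hz] at this
    rw [this, toEDist, (hf.isSheetMetric hK.one_le).self]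
    simp
  obtain ⟨p', hp', μ, hμ, hpμ, hpm⟩ := hkey n hn x hx p hp
  obtain ⟨q', hq', μ', hμ', hqμ, hqm⟩ := hkey m hm y hy q hq
  have hnJ := hi.mem_J hn
  have hmJ := hi.mem_J hm
  have hlev : ∀ k : ℤ, k = i ∨ k = i + 1 → (k : ℝ) ∈ Icc (i : ℝ) (i + 1) := by
    intro k hk
    rcases hk with rfl | rfl <;> constructor <;> push_cast <;> linarith
  obtain ⟨f, hf⟩ := hK.sheet n hnJ
  obtain ⟨u, v, h1, h2, h3⟩ := (hf.isSplitSheet hM hK.one_le hnJ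
      hn).system.electric_projections_close
    hμ hμ' hxy hpμ hqμ hpm hqm
  have htwo : ∀ k k' : ℤ, k = i ∨ k = i + 1 → k' = i ∨ k' = i + 1 → ∀ z w,
      SameComponent (M.splitLines i) z w → M.graphDist (M.pt k z) (M.pt k' w) ≤ 2 := by
    intro k k' hk hk' z w hzw
    refine graphDist_le_two hs (by simpa using hzw) ?_ ?_
    · rw [height_pt (hi.mem_J hk)]; exact hlev k hk
    · rw [height_pt (hi.mem_J hk')]; exact hlev k' hk'
  have hmid : M.graphDist (M.pt n p') (M.pt m q') ≤ 6 := by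
    refine (graphDist_triangle _ (M.pt n u) _).trans ?_
    refine (add_le_add (htwo n n hn hn _ _ h1) ((graphDist_triangle _ (M.pt n v) _).trans
      (add_le_add (htwo n n hn hn _ _ h2) (htwo n m hn hm _ _ h3)))).trans ?_
    norm_num
  refine (graphDist_triangle _ (M.pt n p') _).trans ?_
  push_cast
  refine add_le_add hp' ((graphDist_triangle _ (M.pt m q') _).trans (add_le_add hmid ?_))
  rwa [graphDist_comm]

/-- In the common chart of the block the two triangles coincide, so the centers are close. The
product carries the maximum metric and the levels differ by 1, which explains the maximum with 1 in
the constant. -/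
lemma IsGeometryConstant.exists_close_of_thick (hM : M.IsWeakSplitGeometry)
    (hK : M.IsGeometryConstant K) :
    ∃ C : ℝ≥0, ∀ a b lam L, M.IsLadder lam a b L → ∀ i : ℤ, ¬ M.IsSplit i →
      ∀ x ∈ M.sheet i, ∀ y ∈ M.sheet (i + 1), ∀ p q, M.IsProjection L x p → M.IsProjection L y q →
      M.base x = M.base y → M.graphDist p q ≤ C := by
  obtain ⟨C, D, hC0, hD0, hC⟩ := exists_center_of_projection hM hK
  refine ⟨Real.toNNReal (C + (K * max (D + 2 * Real.log 5) 1 + C)), ?_⟩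
  intro a b lam L hL i hs x hx y hy p q hp hq hxy
  have hiJ := mem_J_of_mem_sheet hx
  have hiJ' := mem_J_of_mem_sheet hy
  have hi := isBlock_of_mem_J hiJ
  obtain ⟨f, hf⟩ := hK.block i hi hs
  have hl1 : (i : ℝ) ∈ Icc (i : ℝ) (i + 1) := ⟨le_rfl, by linarith⟩
  have hl2 : ((i + 1 : ℤ) : ℝ) ∈ Icc (i : ℝ) (i + 1) := by
    push_cast; exact ⟨by linarith, le_rfl⟩
  have hf1 := hf.sheetBiLip hiJ hl1
  have hf2 := hf.sheetBiLip hiJ' hl2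
  obtain ⟨p0, hp0, hpc⟩ := hC a b lam L hL x p i hp hx
  obtain ⟨q0, hq0, hqc⟩ := hC a b lam L hL y q (i + 1) hq hy
  have h1 := hpc f hf1
  have h2 := hqc f hf2
  rw [← hxy] at h2
  have h3 := h1.dist_le h2
  have h4 : edist (M.pt i p0) (M.pt (i + 1 : ℤ) q0) ≤
      ENNReal.ofReal (K * max (D + 2 * Real.log 5) 1) := by
    refine edist_le_inducedEDist.trans ((hf _ ⟨trivial, ?_⟩ _ ⟨trivial, ?_⟩).2.trans ?_)
    · rwa [height_pt hiJ]
    · rwa [height_pt hiJ']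
    · rw [base_pt, base_pt, height_pt hiJ, height_pt hiJ', ENNReal.ofReal_mul K.coe_nonneg,
        ENNReal.ofReal_coe_nnreal, edist_dist]
      refine mul_le_mul_right (ENNReal.ofReal_le_ofReal ?_) _
      rw [Prod.dist_eq]
      refine max_le_max h3 ?_
      rw [Real.dist_eq]
      push_cast
      simp
  refine (graphDist_triangle _ (M.pt i p0) _).trans ?_
  have h5 : 0 ≤ K * max (D + 2 * Real.log 5) 1 := by positivity
  change _ ≤ ENNReal.ofReal _
  rw [ENNReal.ofReal_add hC0 (add_nonneg h5 hC0), ENNReal.ofReal_add h5 hC0]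
  refine add_le_add hp0 ((graphDist_triangle _ (M.pt (i + 1 : ℤ) q0) _).trans (add_le_add ?_ ?_))
  · exact (graphDist_le_edist _ _).trans h4
  · rwa [graphDist_comm]

/-- The projections to ladders are uniformly coarse retractions. -/
lemma IsWeakSplitGeometry.exists_isCoarseRetraction (hM : M.IsWeakSplitGeometry) (c : ℝ≥0) :
    ∃ C : ℝ≥0, ∀ a b lam L, M.IsLadder lam a b L →
      M.IsCoarseRetraction c C (M.IsProjection L) := by
  obtain ⟨K, hK⟩ := hM.exists_constant
  obtain ⟨C1, h1⟩ := hK.exists_close_of_sheet hM c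
  obtain ⟨C2, h2⟩ := hK.exists_close_of_component hM
  obtain ⟨C3, h3⟩ := hK.exists_close_of_thick hM
  have e1 : (C1 : ℝ≥0∞) ≤ (C1 + C2 + C3 : ℝ≥0) := by
    push_cast; exact le_add_right le_self_add
  have e2 : (C2 : ℝ≥0∞) ≤ (C1 + C2 + C3 : ℝ≥0) := by
    push_cast; exact le_add_right le_add_self
  have e3 : (C3 : ℝ≥0∞) ≤ (C1 + C2 + C3 : ℝ≥0) := by
    push_cast; exact le_add_self
  refine ⟨C1 + C2 + C3, fun a b lam L hL => ⟨?_, ?_, ?_⟩⟩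
  · intro n x hx y hy p q hp hq hxy
    exact (h1 a b lam L hL n x hx y hy p q hp hq hxy).trans e1
  · intro i x hx y hy p q hp hq hxy
    by_cases hs : M.IsSplit i
    · refine (h2 a b lam L hL i i (i + 1) hs (Or.inl rfl) (Or.inr rfl) x hx y hy p q hp hq ?_).trans
        e2
      obtain ⟨f, hf⟩ := hK.sheet i (mem_J_of_mem_sheet hx)
      rw [hxy]
      exact (hf.isSplitSheet hM hK.one_le (mem_J_of_mem_sheet hx)
        (Or.inl rfl)).system.sameComponent_self _
    · exact (h3 a b lam L hL i hs x hx y hy p q hp hq hxy).trans e3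
  · intro i n m hs hn hm x hx y hy p q hp hq hxy
    exact (h2 a b lam L hL i n m hs hn hm x hx y hy p q hp hq hxy).trans e2

end MarkedModel

/-! ### First hitting times -/

section Hitting

lemma exists_first_hit {Y : Type*} [TopologicalSpace Y] {γ : ℝ → Y}
    (hγ : ContinuousOn γ (Icc 0 1)) {F : Set Y} (hF : IsClosed F)
        (h : ∃ t ∈ Icc (0 : ℝ) 1, γ t ∈ F) :
    ∃ t ∈ Icc (0 : ℝ) 1, γ t ∈ F ∧ ∀ s ∈ Ico 0 t, γ s ∉ F := by
  have hc : IsCompact (Icc (0 : ℝ) 1 ∩ γ ⁻¹' F) :=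
    isCompact_Icc.of_isClosed_subset (hγ.preimage_isClosed_of_isClosed isClosed_Icc hF)
      inter_subset_left
  obtain ⟨t0, ht0, ht0F⟩ := h
  obtain ⟨t, ⟨ht, htF⟩, hmin⟩ := hc.exists_isLeast ⟨t0, ht0, ht0F⟩
  exact ⟨t, ht, htF, fun s hs hsF => not_le_of_gt hs.2 (hmin ⟨⟨hs.1, hs.2.le.trans ht.2⟩, hsF⟩)⟩

lemma sameComponent_of_isPreconnected {Y : Type*} [TopologicalSpace Y] {lines : Set (Set Y)}
    {C : Set Y} (hC : IsPreconnected C) (hd : C ⊆ (⋃₀ lines)ᶜ) {x y : Y} (hx : x ∈ C)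
    (hy : y ∈ closure C) : SameComponent lines x y :=
  ⟨_, ⟨x, hd hx, rfl⟩, subset_closure (mem_connectedComponentIn (hd hx)),
    closure_mono (hC.subset_connectedComponentIn hx hd) hy⟩

/-- Up to the first hit the path avoids all lines, hence stays in one component, whose closure
contains the hitting point. -/
lemma IsLineSystem.exists_line_hit {lines : Set (Set ℍ)} (h : IsLineSystem lines) {γ : ℝ → ℍ}
    (hγ : ContinuousOn γ (Icc 0 1)) (hhit : ∃ t ∈ Icc (0 : ℝ) 1, γ t ∈ ⋃₀ lines) :
    ∃ t ∈ Icc (0 : ℝ) 1, γ t ∈ ⋃₀ lines ∧ SameComponent lines (γ 0) (γ t) := by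
  obtain ⟨t, ht, htF, hmin⟩ := exists_first_hit hγ (h.isClosed_sUnion le_rfl) hhit
  refine ⟨t, ht, htF, ?_⟩
  rcases ht.1.eq_or_lt with rfl | h0
  · exact h.sameComponent_self _
  have hsub : Icc 0 t ⊆ Icc (0 : ℝ) 1 := Icc_subset_Icc_right ht.2
  have hsub' : Ico 0 t ⊆ Icc (0 : ℝ) 1 := Ico_subset_Icc_self.trans hsub
  refine sameComponent_of_isPreconnected (isPreconnected_Ico.image γ (hγ.mono hsub')) ?_
    ⟨0, ⟨le_rfl, h0⟩, rfl⟩ ?_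
  · rintro _ ⟨s, hs, rfl⟩
    exact hmin s hs
  · have hcl : t ∈ closure (Ico 0 t) := by
      rw [closure_Ico h0.ne]; exact ⟨ht.1, le_rfl⟩
    exact ((hγ t ht).mono hsub').mem_closure_image hcl

variable {g : ℝ → ℝ} {n : ℤ}

/-- A function that stays near `n` and does not take the value `n` before `t` keeps its floor. -/
lemma floor_region {t : ℝ} (hg : ContinuousOn g (Icc 0 t)) (hn : ∀ s ∈ Icc 0 t, |g s - n| < 1)
    (h : ∀ s ∈ Ico 0 t, g s ≠ n) (ht : 0 ≤ t) : (n = ⌊g 0⌋ ∨ n = ⌊g 0⌋ + 1) ∧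
      (∀ s ∈ Icc 0 t, g s ∈ Icc (⌊g 0⌋ : ℝ) (⌊g 0⌋ + 1)) ∧ (g t ≠ n → ⌊g t⌋ = ⌊g 0⌋) := by
  have hfl : ∀ s ∈ Icc 0 t, (n ≤ g s → ⌊g s⌋ = n) ∧ (g s < n → ⌊g s⌋ = n - 1) := by
    intro s hs
    have := abs_lt.1 (hn s hs)
    refine ⟨fun h1 => Int.floor_eq_iff.2 ⟨h1, by linarith⟩, fun h1 => Int.floor_eq_iff.2 ?_⟩
    push_cast
    exact ⟨by linarith, by linarith⟩
  have hpre : ∀ s ∈ Icc 0 t, IsPreconnected (g '' Icc 0 s) := fun s hs =>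
    isPreconnected_Icc.image g (hg.mono (Icc_subset_Icc_right hs.2))
  have hcross : ∀ s ∈ Icc 0 t, (n ≤ g 0 → n ≤ g s) ∧ (g 0 < n → g s ≤ n) := by
    intro s hs
    constructor
    · intro h1
      by_contra! h2
      obtain ⟨u, hu, e⟩ := (hpre s hs).Icc_subset ⟨s, ⟨hs.1, le_rfl⟩, rfl⟩ ⟨0, ⟨le_rfl, hs.1⟩, rfl⟩
        ⟨h2.le, h1⟩
      have hus : u ≠ s := by rintro rfl; exact h2.ne e
      exact h u ⟨hu.1, (lt_of_le_of_ne hu.2 hus).trans_le hs.2⟩ e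
    · intro h1
      by_contra! h2
      obtain ⟨u, hu, e⟩ := (hpre s hs).Icc_subset ⟨0, ⟨le_rfl, hs.1⟩, rfl⟩ ⟨s, ⟨hs.1, le_rfl⟩, rfl⟩
        ⟨h1.le, h2.le⟩
      have hus : u ≠ s := by rintro rfl; exact h2.ne' e
      exact h u ⟨hu.1, (lt_of_le_of_ne hu.2 hus).trans_le hs.2⟩ e
  have h00 : (0 : ℝ) ∈ Icc 0 t := ⟨le_rfl, ht⟩
  have htt : t ∈ Icc 0 t := ⟨ht, le_rfl⟩
  rcases le_or_gt (n : ℝ) (g 0) with h0 | h0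
  · have e := (hfl 0 h00).1 h0
    rw [e]
    refine ⟨Or.inl rfl, fun s hs => ⟨(hcross s hs).1 h0, ?_⟩, fun _ => (hfl t htt).1
      ((hcross t htt).1 h0)⟩
    linarith [(abs_lt.1 (hn s hs)).2]
  · have e := (hfl 0 h00).2 h0
    rw [e]
    refine ⟨Or.inr (by omega), fun s hs => ?_, fun hne => (hfl t htt).2
      (lt_of_le_of_ne ((hcross t htt).2 h0) hne)⟩
    push_cast
    exact ⟨by linarith [(abs_lt.1 (hn s hs)).1], by linarith [(hcross s hs).2 h0]⟩

end Hitting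

namespace MarkedModel

variable {Γ : Subgroup SL(2, ℝ)} {X : Type*} [MetricSpace X] {M : MarkedModel Γ X}

/-! ### Small scales -/

/-- The slab of the block `i`. -/
def slab (M : MarkedModel Γ X) (i : ℤ) : Set X := M.region univ (Icc (i : ℝ) (i + 1))

/-- At the scale `ρ`, the sheets, blocks and tubes of the model look standard. -/
structure IsScale (M : MarkedModel Γ X) (k c ρ : ℝ≥0) : Prop where
  pos : 0 < ρ
  lipschitz : LipschitzWith k M.height
  small : k * ρ ≤ 1 / 4
  sheet : ∀ n : ℤ, ∀ p ∈ M.sheet n, ∀ q ∈ M.sheet n, edist p q < ρ → M.sheetDist n p q ≤ c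
  lift : ∀ T ∈ M.tubes, ∀ T' ∈ M.tubes, ∀ γ ∈ Γ, ∀ γ' ∈ Γ,
    ∀ p ∈ M.region (T.lift γ) T.interval, ∀ q ∈ M.region (T'.lift γ') T'.interval,
      edist p q < ρ → T = T' ∧ T.lift γ = T'.lift γ'
  block : ∀ i : ℤ, M.IsBlock i → ¬ M.IsSplit i → ∀ p ∈ M.slab i, ∀ q ∈ M.slab i,
    inducedEDist (M.slab i) p q < ρ →
      M.sheetDist i (M.pt i (M.base p)) (M.pt i (M.base q)) ≤ c

/-- The scale `ρ` is below the separation of the lifts and the embedding scale of the sheets, and so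
small that heights vary by at most 1/4. The constant `k + K * K` covers both the sheet bound and the
thick-block bound. -/
lemma IsWeakSplitGeometry.exists_isScale (hM : M.IsWeakSplitGeometry) :
    ∃ k c ρ, M.IsScale k c ρ := by
  obtain ⟨K, hK⟩ := hM.exists_constant
  obtain ⟨σ, hσ, hlift⟩ := hM.exists_lift_eq
  obtain ⟨k, r, hr, hlip, hsheet⟩ := hM.uniform_sheets
  have hpos : 0 < min (min σ r) (min 1 (1 / (4 * (k + 1) : ℝ))) := by positivity
  obtain ⟨ρ, hρ⟩ : ∃ ρ : ℝ≥0, (ρ : ℝ) = min (min σ r) (min 1 (1 / (4 * (k + 1) : ℝ))) :=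
    ⟨⟨_, hpos.le⟩, rfl⟩
  have h1 : (ρ : ℝ) ≤ σ := hρ.le.trans ((min_le_left _ _).trans (min_le_left _ _))
  have h2 : (ρ : ℝ) ≤ r := hρ.le.trans ((min_le_left _ _).trans (min_le_right _ _))
  have h3 : (ρ : ℝ) ≤ 1 := hρ.le.trans ((min_le_right _ _).trans (min_le_left _ _))
  have h4 : (ρ : ℝ) ≤ 1 / (4 * (k + 1)) := hρ.le.trans ((min_le_right _ _).trans (min_le_right _ _))
  have h3' : (ρ : ℝ≥0∞) ≤ 1 := by exact_mod_cast h3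
  have hdist : ∀ p q : X, edist p q < ρ → dist p q < ρ := by
    intro p q h
    rw [edist_nndist] at h
    exact_mod_cast h
  refine ⟨k, k + K * K, ρ, ?_, hlip, ?_, ?_, ?_, ?_⟩
  · rw [← hρ] at hpos
    exact_mod_cast hpos
  · have hk : (0 : ℝ) < 4 * (k + 1) := by positivity
    rw [le_div_iff₀ hk] at h4
    have h5 : (k : ℝ) * ρ ≤ 1 / 4 := by
      have := ρ.coe_nonneg
      linarith
    exact_mod_cast h5
  · intro n p hp q hq hpq
    refine (hsheet n p hp q hq ((hdist p q hpq).le.trans h2)).trans ?_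
    calc (k : ℝ≥0∞) * edist p q ≤ k * 1 := mul_le_mul_right (hpq.le.trans h3') _
      _ ≤ (k + K * K : ℝ≥0) := by rw [mul_one]; push_cast; exact le_self_add
  · intro T hT T' hT' γ hγ γ' hγ' p hp q hq hpq
    exact hlift T hT T' hT' γ hγ γ' hγ' p hp q hq ((hdist p q hpq).trans_le h1)
  · intro i hi hs p hp q hq hpq
    obtain ⟨f, hf⟩ := hK.block i hi hs
    have hiJ := hi.mem_J (Or.inl rfl)
    have hf1 := hf.sheetBiLip hiJ ⟨le_rfl, by linarith⟩
    have h5 : edist (f (M.base p)) (f (M.base q)) ≤ K * 1 := by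
      refine le_trans ?_ ((hf p hp q hq).1.trans (mul_le_mul_right (hpq.le.trans h3') _))
      rw [Prod.edist_eq]
      exact le_max_left _ _
    refine (hf1 _ _).2.trans ((mul_le_mul_right h5 _).trans ?_)
    rw [mul_one]
    push_cast
    exact le_add_self

variable {k c ρ : ℝ≥0}

lemma IsScale.abs_height_sub_le (h : M.IsScale k c ρ) {p q : X} (hpq : edist p q < ρ) :
    |M.height p - M.height q| ≤ 1 / 4 := by
  rw [edist_nndist] at hpq
  have h1 : dist p q < ρ := by exact_mod_cast hpq
  have h2 := h.lipschitz.dist_le_mul p q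
  have h3 : (k : ℝ) * ρ ≤ 1 / 4 := by exact_mod_cast h.small
  rw [← Real.dist_eq]
  exact h2.trans ((mul_le_mul_of_nonneg_left h1.le k.coe_nonneg).trans h3)

/-- Two close points lie in a common slab, or are joined through a common sheet. -/
lemma IsScale.exists_link (h : M.IsScale k c ρ) {x y : X} (hxy : edist x y < ρ) :
    (⌊M.height x⌋ = ⌊M.height y⌋ ∧ inducedEDist (M.slab ⌊M.height x⌋) x y < ρ) ∨
    ∃ n : ℤ, ∃ z ∈ M.sheet n, ∃ w ∈ M.sheet n, edist z w < ρ ∧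
      ((n = ⌊M.height x⌋ ∨ n = ⌊M.height x⌋ + 1) ∧
        inducedEDist (M.slab ⌊M.height x⌋) x z < ρ) ∧
      ((n = ⌊M.height y⌋ ∨ n = ⌊M.height y⌋ + 1) ∧
        inducedEDist (M.slab ⌊M.height y⌋) y w < ρ) := by
  rw [← M.length_space] at hxy
  obtain ⟨γ, hγ, -, h0, h1, hlen⟩ := exists_curve_of_inducedEDist_lt hxy
  -- A curve of length less than `ρ` changes height by at most 1/4, so it stays within 3/4 of the
  -- nearest integer `n` and can meet no other integer level.
  set n := round (M.height x) with hn
  have hclose : ∀ s ∈ Icc (0 : ℝ) 1, ∀ t ∈ Icc (0 : ℝ) 1, edist (γ s) (γ t) < ρ := fun s hs t ht =>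
    (eVariationOn.edist_le γ hs ht).trans_lt hlen
  have hnear : ∀ t ∈ Icc (0 : ℝ) 1, |M.height (γ t) - n| < 1 := by
    intro t ht
    have e1 := h.abs_height_sub_le (hclose t ht 0 ⟨le_rfl, zero_le_one⟩)
    have e2 := abs_sub_round (M.height x)
    rw [h0] at e1
    have := abs_sub_le (M.height (γ t)) (M.height x) n
    rw [← hn] at e2
    linarith
  have hcont : ContinuousOn (fun t => M.height (γ t)) (Icc 0 1) :=
      continuous_height.comp_continuousOn hγ
  by_cases hhit : ∃ t ∈ Icc (0 : ℝ) 1, M.height (γ t) ∈ ({(n : ℝ)} : Set ℝ)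
  swap
  · left
    push Not at hhit
    obtain ⟨-, hreg, hfl⟩ := floor_region hcont hnear (fun s hs => hhit s (Ico_subset_Icc_self hs))
      zero_le_one
    simp only [h0, h1] at hreg hfl
    refine ⟨(hfl ?_).symm, ?_⟩
    · have := hhit 1 ⟨zero_le_one, le_rfl⟩
      rwa [h1] at this
    · rw [← h0, ← h1]
      refine (inducedEDist_le_of_curve (A := M.slab ⌊M.height (γ 0)⌋) zero_le_one hγ fun t ht =>
          ⟨trivial, ?_⟩).trans_lt hlen
      rw [h0]
      exact hreg t ht
  · right
    -- Applied to the curve and to its reverse, this gives the first and the last visit to the sheet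
    -- `n`.
    have key : ∀ δ : ℝ → X, ContinuousOn δ (Icc 0 1) → (∀ t ∈ Icc (0 : ℝ) 1, |M.height (δ t) - n| <
        1) →
        (∃ t ∈ Icc (0 : ℝ) 1, M.height (δ t) ∈ ({(n : ℝ)} : Set ℝ)) →
        eVariationOn δ (Icc 0 1) < ρ → ∃ t ∈ Icc (0 : ℝ) 1, δ t ∈ M.sheet n ∧
          (n = ⌊M.height (δ 0)⌋ ∨ n = ⌊M.height (δ 0)⌋ + 1) ∧
          inducedEDist (M.slab ⌊M.height (δ 0)⌋) (δ 0) (δ t) < ρ := by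
      intro δ hδ hδn hδh hδl
      have hδc : ContinuousOn (fun t => M.height (δ t)) (Icc 0 1) :=
        continuous_height.comp_continuousOn hδ
      obtain ⟨t, ht, htn, hmin⟩ := exists_first_hit hδc isClosed_singleton hδh
      have hsub : Icc 0 t ⊆ Icc (0 : ℝ) 1 := Icc_subset_Icc_right ht.2
      obtain ⟨hfl, hreg, -⟩ := floor_region (hδc.mono hsub) (fun s hs => hδn s (hsub hs)) hmin ht.1
      refine ⟨t, ht, mem_sheet_iff.2 htn, hfl, ?_⟩
      refine (inducedEDist_le_of_curve (A := M.slab ⌊M.height (δ 0)⌋) ht.1 (hδ.mono hsub)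
        fun s hs => ⟨trivial, hreg s hs⟩).trans_lt ?_
      exact (eVariationOn.mono δ hsub).trans_lt hδl
    have hrev : ∀ t ∈ Icc (0 : ℝ) 1, 1 - t ∈ Icc (0 : ℝ) 1 := fun t ht =>
      ⟨by linarith [ht.2], by linarith [ht.1]⟩
    obtain ⟨t, ht, htn, htf, htl⟩ := key γ hγ hnear hhit hlen
    obtain ⟨s, hs, hsn, hsf, hsl⟩ := key (fun t => γ (1 - t)) (hγ.comp (by fun_prop) hrev)
      (fun t ht => hnear _ (hrev t ht))
      (by
        obtain ⟨t, ht, htn⟩ := hhit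
        exact ⟨1 - t, hrev t ht, by rwa [sub_sub_cancel]⟩)
      ((eVariationOn.comp_le_of_antitoneOn γ (fun t => 1 - t) (fun a _ b _ hab => by
        simp only; linarith) hrev).trans_lt hlen)
    simp only [sub_zero, h1] at hsf hsl
    rw [h0] at htf htl
    exact ⟨n, _, htn, _, hsn, hclose t ht _ (hrev s hs), ⟨htf, htl⟩, hsf, hsl⟩

/-! ### Coarse retractions in the small -/

lemma floor_mem_J (x : X) : (⌊M.height x⌋ : ℝ) ∈ M.J := by
  rcases M.J_eq with h | h
  · rw [h]; trivial
  · have := height_mem (M := M) x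
    rw [h] at this ⊢
    have h0 : 0 ≤ ⌊M.height x⌋ := Int.floor_nonneg.2 this
    exact mem_Ici.2 (by exact_mod_cast h0)

/-- The vertical projection to the next lower sheet. -/
def shadow (M : MarkedModel Γ X) (x : X) : X := M.pt ⌊M.height x⌋ (M.base x)

lemma shadow_mem (x : X) : M.shadow x ∈ M.sheet ⌊M.height x⌋ := pt_mem_sheet (floor_mem_J x) _

lemma shadow_of_mem_sheet {n : ℤ} {x : X} (hx : x ∈ M.sheet n) : M.shadow x = x := by
  unfold shadow
  rw [mem_sheet_iff.1 hx, Int.floor_intCast, pt_base_of_mem_sheet hx]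

variable {C : ℝ≥0} {R : X → X → Prop} {G : X → X}

lemma IsCoarseRetraction.vertical (hR : M.IsCoarseRetraction c C R)
    (hG : ∀ x ∈ M.horizontal, R x (G x)) {i n : ℤ} (hi : M.IsBlock i) (hn : n = i ∨ n = i + 1)
    {z : X} (hz : z ∈ M.sheet n) : M.graphDist (G (M.pt i (M.base z))) (G z) ≤ C := by
  rcases hn with rfl | rfl
  · rw [pt_base_of_mem_sheet hz, graphDist_self]
    exact bot_le
  · have h1 := pt_mem_sheet (hi.mem_J (Or.inl rfl)) (M.base z)
    exact hR.block i _ h1 z hz _ _ (hG _ ⟨_, h1⟩) (hG _ ⟨_, hz⟩) (base_pt _ _)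

/-- Points that are joined by a short path in a slab have close images. -/
lemma IsCoarseRetraction.slab (hR : M.IsCoarseRetraction c C R) (hM : M.IsWeakSplitGeometry)
    (hG : ∀ x ∈ M.horizontal, R x (G x)) (hρ : M.IsScale k c ρ) {i : ℤ} (hi : M.IsBlock i)
    {x y : X} (hxy : inducedEDist (M.slab i) x y < ρ) :
    M.graphDist (G (M.pt i (M.base x))) (G (M.pt i (M.base y))) ≤ C + (C + C) := by
  obtain ⟨γ, hγ, hmem, rfl, rfl, hlen⟩ := exists_curve_of_inducedEDist_lt hxy
  have h0 : (0 : ℝ) ∈ Icc (0 : ℝ) 1 := ⟨le_rfl, zero_le_one⟩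
  have h1 : (1 : ℝ) ∈ Icc (0 : ℝ) 1 := ⟨zero_le_one, le_rfl⟩
  have hiJ := hi.mem_J (Or.inl rfl)
  have hpt : ∀ z, M.pt i z ∈ M.sheet i := pt_mem_sheet hiJ
  have hGpt : ∀ z, R (M.pt i z) (G (M.pt i z)) := fun z => hG _ ⟨_, hpt z⟩
  by_cases hs : M.IsSplit i
  swap
  · refine (hR.sheet i _ (hpt _) _ (hpt _) _ _ (hGpt _) (hGpt _)
      (hρ.block i hi hs _ (hmem h0) _ (hmem h1) hxy)).trans le_self_add
  have hcomp : ∀ z w, SameComponent (M.splitLines i) z w →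
      M.graphDist (G (M.pt i z)) (G (M.pt i w)) ≤ C := fun z w hzw =>
    hR.component i i i hs (Or.inl rfl) (Or.inl rfl) _ (hpt _) _ (hpt _) _ _ (hGpt _) (hGpt _)
      (by simpa using hzw)
  obtain ⟨K, hK⟩ := hM.exists_constant
  obtain ⟨f, hf⟩ := hK.sheet i hiJ
  have hsys := (hf.isSplitSheet hM hK.one_le hiJ (Or.inl rfl)).system
  have hc : ContinuousOn (fun t => M.base (γ t)) (Icc 0 1) := continuous_base.comp_continuousOn hγ
  by_cases hhit : ∃ t ∈ Icc (0 : ℝ) 1, M.base (γ t) ∈ ⋃₀ M.splitLines i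
  swap
  · refine (hcomp _ _ ?_).trans le_self_add
    refine sameComponent_of_isPreconnected (isPreconnected_Icc.image _ hc) ?_ ⟨0, h0, rfl⟩
      (subset_closure ⟨1, h1, rfl⟩)
    rintro _ ⟨t, ht, rfl⟩ htl
    exact hhit ⟨t, ht, htl⟩
  have hrev : ∀ t ∈ Icc (0 : ℝ) 1, 1 - t ∈ Icc (0 : ℝ) 1 := fun t ht =>
    ⟨by linarith [ht.2], by linarith [ht.1]⟩
  obtain ⟨t, ht, htl, hts⟩ := hsys.exists_line_hit hc hhit
  obtain ⟨s, hs', hsl, hss⟩ := hsys.exists_line_hit (γ := fun t => M.base (γ (1 - t)))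
    (hc.comp (by fun_prop) hrev) (by
      obtain ⟨t, ht, htl⟩ := hhit
      exact ⟨1 - t, hrev t ht, by simpa using htl⟩)
  rw [sub_zero] at hss
  -- The first and the last line met by the curve are lifts of tubes running through the whole
  -- height of the slab. The curve is shorter than the separation of lifts, so they coincide, and
  -- three components suffice.
  have hsame : SameComponent (M.splitLines i) (M.base (γ t)) (M.base (γ (1 - s))) := by
    have hreg : ∀ u ∈ Icc (0 : ℝ) 1, ∀ l ∈ M.splitLines i, M.base (γ u) ∈ l →
        ∃ T ∈ M.tubes, ∃ g ∈ Γ, l = T.lift g ∧ γ u ∈ M.region (T.lift g) T.interval := by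
      rintro u hu l ⟨T, hT, ⟨hT1, hT2⟩, g, hg, rfl⟩ hul
      refine ⟨T, hT, g, hg, rfl, hul, ?_⟩
      have e1 := (Tube.mem_interval hT1).1
      have e2 := (Tube.mem_interval hT2).2
      push_cast at e2
      exact ⟨e1.trans (hmem hu).2.1, (hmem hu).2.2.trans e2⟩
    obtain ⟨l, hl, htl⟩ := htl
    obtain ⟨l', hl', hsl⟩ := hsl
    obtain ⟨T, hT, g, hg, rfl, hreg1⟩ := hreg t ht l hl htl
    obtain ⟨T', hT', g', hg', rfl, hreg2⟩ := hreg _ (hrev s hs') l' hl' hsl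
    have e := (hρ.lift T hT T' hT' g hg g' hg' _ hreg1 _ hreg2
      ((eVariationOn.edist_le γ ht (hrev s hs')).trans_lt hlen)).2
    obtain ⟨U, V, hUV⟩ := hsys.sides _ hl
    obtain ⟨A, hA, -, hlA⟩ := hsys.exists_component hl hUV
    exact ⟨A, hA, hlA htl, hlA (e ▸ hsl)⟩
  refine (graphDist_triangle _ (G (M.pt i (M.base (γ t)))) _).trans (add_le_add (hcomp _ _ hts) ?_)
  exact (graphDist_triangle _ (G (M.pt i (M.base (γ (1 - s))))) _).trans
    (add_le_add (hcomp _ _ hsame) (hcomp _ _ hss.symm))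

/-- Close points have shadows with close images. -/
lemma IsCoarseRetraction.of_edist_lt (hR : M.IsCoarseRetraction c C R) (hM : M.IsWeakSplitGeometry)
    (hG : ∀ x ∈ M.horizontal, R x (G x)) (hρ : M.IsScale k c ρ) {x y : X} (hxy : edist x y < ρ) :
    M.graphDist (G (M.shadow x)) (G (M.shadow y)) ≤ 9 * C := by
  have hx := isBlock_of_mem_J (floor_mem_J (M := M) x)
  have hy := isBlock_of_mem_J (floor_mem_J (M := M) y)
  rcases hρ.exists_link hxy with ⟨e, hl⟩ | ⟨n, z, hz, w, hw, hzw, ⟨h1, h2⟩, h3, h4⟩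
  · have := hR.slab hM hG hρ hx hl
    unfold shadow
    rw [← e]
    refine this.trans ?_
    calc (C + (C + C) : ℝ≥0∞) = 3 * C := by ring
      _ ≤ 9 * C := by gcongr; norm_num
  -- From the shadow of `x` to the sheet `n`, across the sheet, and down to the shadow of `y`: the
  -- costs are `3C + C + C + C + 3C`.
  · have e1 := hR.slab hM hG hρ hx h2
    have e2 := hR.vertical hG hx h1 hz
    have e3 := hR.sheet n z hz w hw _ _ (hG _ ⟨_, hz⟩) (hG _ ⟨_, hw⟩) (hρ.sheet n z hz w hw hzw)
    have e4 := hR.vertical hG hy h3 hw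
    have e5 := hR.slab hM hG hρ hy h4
    rw [graphDist_comm] at e4 e5
    refine (graphDist_triangle _ _ _).trans ((add_le_add e1 ((graphDist_triangle _ _ _).trans
      (add_le_add e2 ((graphDist_triangle _ _ _).trans (add_le_add e3
      ((graphDist_triangle _ _ _).trans (add_le_add e4 e5))))))).trans (le_of_eq ?_))
    ring

lemma floor_cases {t : ℝ} {i : ℤ} (ht : t ∈ Icc (i : ℝ) (i + 1)) : ⌊t⌋ = i ∨ ⌊t⌋ = i + 1 := by
  have h1 : i ≤ ⌊t⌋ := Int.le_floor.2 ht.1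
  have h2 : ⌊t⌋ < i + 1 + 1 := Int.floor_lt.2 (by push_cast; linarith [ht.2])
  omega

/-- Points of a split component have shadows with close images. -/
lemma IsCoarseRetraction.of_component (hR : M.IsCoarseRetraction c C R)
    (hG : ∀ x ∈ M.horizontal, R x (G x)) {i : ℤ} (hi : M.IsSplit i) {x y : X}
    (hxy : SameComponent (M.splitLines i) (M.base x) (M.base y))
    (hx : M.height x ∈ Icc (i : ℝ) (i + 1)) (hy : M.height y ∈ Icc (i : ℝ) (i + 1)) :
    M.graphDist (G (M.shadow x)) (G (M.shadow y)) ≤ C :=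
  hR.component i _ _ hi (floor_cases hx) (floor_cases hy) _ (shadow_mem x) _ (shadow_mem y) _ _
    (hG _ ⟨_, shadow_mem x⟩) (hG _ ⟨_, shadow_mem y⟩) (by simpa [shadow] using hxy)

/-- A lift of a tube that reaches a split block lies in one component of it. -/
lemma sameComponent_of_lift (hM : M.IsWeakSplitGeometry) {T : Tube} (hT : T ∈ M.tubes)
    {γ : SL(2, ℝ)} (hγ : γ ∈ Γ) {i : ℤ} (hi : M.IsSplit i) {t : ℝ} (ht : t ∈ T.interval)
    (hti : t ∈ Icc (i : ℝ) (i + 1)) {z w : ℍ} (hz : z ∈ T.lift γ) (hw : w ∈ T.lift γ) :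
    SameComponent (M.splitLines i) z w := by
  have hblock := hi.isBlock hM
  have hiJ := hblock.mem_J (Or.inl rfl)
  obtain ⟨K, hK⟩ := hM.exists_constant
  obtain ⟨f, hf⟩ := hK.sheet i hiJ
  have hsys := (hf.isSplitSheet hM hK.one_le hiJ (Or.inl rfl)).system
  obtain ⟨ρ, hρ, hlift⟩ := hM.exists_lift_eq
  -- The tube splits some integer level and reaches the height `t` in the block, so its vertical
  -- interval contains one of the two boundary levels of the block.
  obtain ⟨m, hm, hTm⟩ : ∃ m : ℤ, (m = i ∨ m = i + 1) ∧ (m : ℝ) ∈ T.interval := by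
    obtain ⟨n, hn⟩ := (hM.tube T hT).2.2.2.2.1
    have hn' := Tube.mem_interval hn
    rcases le_or_gt n i with h | h
    · have : (n : ℝ) ≤ i := by exact_mod_cast h
      exact ⟨i, Or.inl rfl, hn'.1.trans this, hti.1.trans ht.2⟩
    · have : (i : ℝ) + 1 ≤ n := by exact_mod_cast h
      refine ⟨i + 1, Or.inr rfl, ?_, ?_⟩ <;> push_cast
      · exact ht.1.trans hti.2
      · exact this.trans hn'.2
  have hmJ := hblock.mem_J hm
  -- A tube that hangs into the block need not split it. Its lift either avoids the lines of the
  -- block, or meets one of them at level `m` and then equals it by separation.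
  by_cases hd : T.lift γ ⊆ (⋃₀ M.splitLines i)ᶜ
  · obtain ⟨Φ, hΦ⟩ := (hM.tube T hT).2.1
    have hcont : Continuous fun s => γ • T.curve s := by
      rw [show T.curve = fun s => Φ (s, 0) from funext hΦ]
      exact (Φ.continuous.comp (Continuous.prodMk_left _)).const_smul γ
    have e : T.lift γ = range fun s => γ • T.curve s := by
      unfold Tube.lift
      rw [← range_comp]
      rfl
    refine sameComponent_of_isPreconnected ?_ hd hz (subset_closure hw)
    rw [e]
    exact isPreconnected_range hcont
  · obtain ⟨v, hv, hvl⟩ := not_subset.1 hd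
    obtain ⟨l, hl, hvl⟩ := not_notMem.1 hvl
    have hl' := hl
    obtain ⟨T', hT', hs, γ', hγ', rfl⟩ := hl
    have hTm' : (m : ℝ) ∈ T'.interval := by
      rcases hm with rfl | rfl
      · exact Tube.mem_interval hs.1
      · exact Tube.mem_interval hs.2
    have hreg : ∀ S : Tube, ∀ g, v ∈ S.lift g → (m : ℝ) ∈ S.interval →
        M.pt m v ∈ M.region (S.lift g) S.interval := fun S g h1 h2 =>
      ⟨by rwa [base_pt], by rwa [height_pt hmJ]⟩
    have e := (hlift T hT T' hT' γ hγ γ' hγ' _ (hreg T γ hv hTm) _ (hreg T' γ' hvl hTm')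
      (by rwa [dist_self])).2
    obtain ⟨U, V, hUV⟩ := hsys.sides _ hl'
    obtain ⟨A, hA, -, hlA⟩ := hsys.exists_component hl' hUV
    rw [← e] at hlA
    exact ⟨A, hA, hlA hz, hlA hw⟩

/-- Each height of a tube lies in a split block, and there the circle stays within a single
component. -/
lemma IsCoarseRetraction.of_circle (hR : M.IsCoarseRetraction c C R) (hM : M.IsWeakSplitGeometry)
    (hG : ∀ x ∈ M.horizontal, R x (G x)) {A : Set X} (hA : A ∈ M.horizontalCircles) {x y : X}
    (hx : x ∈ A) (hy : y ∈ A) : M.graphDist (G (M.shadow x)) (G (M.shadow y)) ≤ C := by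
  obtain ⟨T, hT, γ, hγ, t, ht, rfl⟩ := hA
  obtain ⟨i, hi, hti⟩ := (hM.tube T hT).2.2.2.2.2.2 t ht
  refine hR.of_component hG hi (sameComponent_of_lift hM hT hγ hi ht hti hx.1 hy.1) ?_ ?_
  · rw [show M.height x = t from hx.2]; exact hti
  · rw [show M.height y = t from hy.2]; exact hti

end MarkedModel

/-! ### Coarse estimates along chains -/

section Chains

variable {X : Type*} {d : X → X → ℝ≥0∞} {w : ℝ≥0∞} {H : Set (Set X)}

lemma electricStep_cases (x y : X) : electricStep d w H x y = d x y ∨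
    electricStep d w H x y = w ∧ ∃ A ∈ H, x ∈ A ∧ y ∈ A := by
  unfold electricStep
  by_cases h : ∃ A ∈ H, x ∈ A ∧ y ∈ A
  · have e : (⨅ (A ∈ H) (_ : x ∈ A ∧ y ∈ A), w) = w := by
      apply le_antisymm
      · obtain ⟨A, hA, hxy⟩ := h
        exact iInf₂_le_of_le A hA (iInf_le _ hxy)
      · exact le_iInf₂ fun A hA => le_iInf fun _ => le_rfl
    rw [e]
    rcases min_choice (d x y) w with h1 | h1
    · exact Or.inl h1
    · exact Or.inr ⟨h1, h⟩
  · left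
    have e : (⨅ (A ∈ H) (_ : x ∈ A ∧ y ∈ A), w) = ⊤ := by
      simp only [iInf_eq_top]
      exact fun A hA hxy => absurd ⟨A, hA, hxy⟩ h
    rw [e, min_eq_left le_top]

/-- A pseudodistance that is bounded on short stretches of a chain is bounded linearly by the total
cost of the chain. -/
lemma coarse_chain {D : X → X → ℝ≥0∞} (h0 : ∀ x, D x x = 0) (htri : ∀ x y z, D x z ≤ D x y + D y z)
    {p : ℕ → X} {s : ℕ → ℝ≥0∞} {n : ℕ} {ρ B : ℝ≥0} (hρ : 0 < ρ)
    (h1 : ∀ j k, j ≤ k → k ≤ n → ∑ i ∈ Finset.Ico j k, s i < ρ → D (p j) (p k) ≤ B)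
    (h2 : ∀ k < n, D (p k) (p (k + 1)) ≤ B * (s k + 1)) :
    D (p 0) (p n) ≤ (B + 2 * B / ρ : ℝ≥0) * ∑ i ∈ Finset.range n, s i + B := by
  set E : ℝ≥0 := B + 2 * B / ρ with hE
  -- The index `j` starts the current stretch of cost below `ρ`; everything before `j` is already
  -- paid for linearly.
  have key : ∀ k ≤ n, ∃ j ≤ k, ∑ i ∈ Finset.Ico j k, s i < ρ ∧
      D (p 0) (p j) ≤ E * ∑ i ∈ Finset.range j, s i := by
    intro k
    induction k with
    | zero => exact fun _ => ⟨0, le_rfl, by simpa using hρ, by simp [h0]⟩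
    | succ k ih =>
      intro hk
      obtain ⟨j, hj, hs, hD⟩ := ih (by omega)
      by_cases hs' : ∑ i ∈ Finset.Ico j (k + 1), s i < ρ
      · exact ⟨j, by omega, hs', hD⟩
      · refine ⟨k + 1, le_rfl, by simpa using hρ, ?_⟩
        rw [not_lt] at hs'
        have e1 := h1 j k hj (by omega) hs
        have e2 := h2 k (by omega)
        have e3 : s k ≤ ∑ i ∈ Finset.Ico j (k + 1), s i :=
          Finset.single_le_sum (f := s) (fun _ _ => bot_le) (Finset.mem_Ico.2 ⟨hj, by omega⟩)
        -- When a step completes a stretch of cost at least `ρ`, the constant part `2 * B` of the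
        -- displacement is charged to that stretch.
        have e4 : (2 * B : ℝ≥0∞) ≤ (2 * B / ρ : ℝ≥0) * ∑ i ∈ Finset.Ico j (k + 1), s i := by
          calc (2 * B : ℝ≥0∞) = (2 * B / ρ : ℝ≥0) * ρ := by
                rw [← ENNReal.coe_mul, div_mul_cancel₀ _ hρ.ne']
                push_cast; rfl
            _ ≤ _ := mul_le_mul_right hs' _
        rw [← Finset.sum_range_add_sum_Ico s (show j ≤ k + 1 by omega), mul_add]
        refine (htri _ (p j) _).trans (add_le_add hD ?_)
        refine (htri _ (p k) _).trans ((add_le_add e1 e2).trans ?_)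
        calc (B + B * (s k + 1) : ℝ≥0∞) = B * s k + 2 * B := by ring
          _ ≤ B * (∑ i ∈ Finset.Ico j (k + 1), s i) +
              (2 * B / ρ : ℝ≥0) * ∑ i ∈ Finset.Ico j (k + 1), s i :=
            add_le_add (mul_le_mul_right e3 _) e4
          _ = E * ∑ i ∈ Finset.Ico j (k + 1), s i := by
            rw [hE, ENNReal.coe_add, add_mul]
  obtain ⟨j, hj, hs, hD⟩ := key n le_rfl
  refine (htri _ (p j) _).trans (add_le_add (hD.trans (mul_le_mul_right ?_ _))
    (h1 j n hj le_rfl hs))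
  exact Finset.sum_le_sum_of_subset (Finset.range_mono hj)

lemma le_linear_of_le {E B : ℝ≥0} {t D : ℝ≥0∞} (h : D ≤ E * (t + 1) + B) :
    D ≤ (E + B : ℝ≥0) * (t + 1) := by
  refine h.trans ?_
  rw [ENNReal.coe_add, add_mul]
  exact add_le_add le_rfl (le_mul_of_one_le_right bot_le le_add_self)

/-- In a length space, two points are joined by a fine chain that is almost geodesic. -/
lemma exists_fine_chain {X : Type*} [MetricSpace X] {x y : X}
    (h : inducedEDist univ x y = edist x y) {ρ : ℝ} (hρ : 0 < ρ) :
    ∃ (N : ℕ) (z : ℕ → X), z 0 = x ∧ z N = y ∧ (∀ k < N, dist (z k) (z (k + 1)) < ρ) ∧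
      ∑ k ∈ Finset.range N, edist (z k) (z (k + 1)) ≤ edist x y + 1 := by
  have hlt : inducedEDist univ x y < edist x y + 1 := by
    rw [h]
    exact ENNReal.lt_add_right (edist_ne_top _ _) one_ne_zero
  obtain ⟨γ, hγ, -, h0, h1, hlen⟩ := exists_curve_of_inducedEDist_lt hlt
  obtain ⟨δ, hδ, hu⟩ := Metric.uniformContinuousOn_iff.1
    (isCompact_Icc.uniformContinuousOn_of_continuous hγ) ρ hρ
  obtain ⟨N, hN⟩ := exists_nat_one_div_lt hδ
  have hN0 : (0 : ℝ) < N + 1 := by positivity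
  have hmem : ∀ k : ℕ, k ≤ N + 1 → (k : ℝ) / (N + 1) ∈ Icc (0 : ℝ) 1 := fun k hk => by
    have : (k : ℝ) ≤ N + 1 := by exact_mod_cast hk
    exact ⟨by positivity, (div_le_one hN0).2 this⟩
  refine ⟨N + 1, fun k => γ (k / (N + 1)), by simpa using h0, ?_, fun k hk => ?_, ?_⟩
  · simp only
    push_cast
    rw [div_self hN0.ne', h1]
  · refine hu _ (hmem k hk.le) _ (hmem (k + 1) hk) ?_
    rw [dist_comm, Real.dist_eq, ← sub_div]
    push_cast
    rw [add_sub_cancel_left, abs_of_pos (by positivity)]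
    exact hN
  · refine le_trans ?_ hlen.le
    have := eVariationOn.sum_le_of_monotoneOn_Icc (f := γ) (s := Icc 0 1) (m := 0) (n := N + 1)
      (u := fun k => (k : ℝ) / (N + 1)) (fun a _ b _ hab => by
        have : (a : ℝ) ≤ b := by exact_mod_cast hab
        simp only
        gcongr) (fun k hk => hmem k hk.2)
    rw [Nat.Ico_zero_eq_range] at this
    refine le_trans (le_of_eq (Finset.sum_congr rfl fun k _ => ?_)) this
    rw [edist_comm]

end Chains

namespace MarkedModel

variable {Γ : Subgroup SL(2, ℝ)} {X : Type*} [MetricSpace X] {M : MarkedModel Γ X}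
  {k c ρ C : ℝ≥0} {R : X → X → Prop} {G : X → X}

/-- The bound is chosen before the retraction, from `C` and the scale alone; this makes the final
constant independent of the segment and the ladder. -/
lemma IsScale.exists_bound_edist (hM : M.IsWeakSplitGeometry) (hρ : M.IsScale k c ρ) (C : ℝ≥0) :
    ∃ B : ℝ≥0, ∀ (R : X → X → Prop) (G : X → X), M.IsCoarseRetraction c C R →
      (∀ x ∈ M.horizontal, R x (G x)) → ∀ x y,
      M.graphDist (G (M.shadow x)) (G (M.shadow y)) ≤ B * (edist x y + 1) := by
  refine ⟨9 * C + 2 * (9 * C) / ρ + 9 * C, fun R G hR hG x y => le_linear_of_le ?_⟩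
  obtain ⟨N, z, rfl, rfl, hz, hsum⟩ := exists_fine_chain (M.length_space x y)
    (ρ := ρ) (by exact_mod_cast hρ.pos)
  have hshort : ∀ x y, edist x y < ρ →
      M.graphDist (G (M.shadow x)) (G (M.shadow y)) ≤ (9 * C : ℝ≥0) := by
    intro x y h
    push_cast
    exact hR.of_edist_lt hM hG hρ h
  refine (coarse_chain (D := fun x y => M.graphDist (G (M.shadow x)) (G (M.shadow y)))
    (fun _ => graphDist_self _) (fun _ _ _ => graphDist_triangle _ _ _) hρ.pos
    (s := fun i => edist (z i) (z (i + 1))) (B := 9 * C) (fun i j hij _ h => ?_) fun i hi =>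
        ?_).trans ?_
  · exact hshort _ _ ((edist_le_Ico_sum_edist z hij).trans_lt h)
  · refine (hshort _ _ ?_).trans (le_mul_of_one_le_right bot_le le_add_self)
    have := hz i hi
    rw [edist_nndist]
    exact_mod_cast this
  · exact add_le_add (mul_le_mul_right hsum _) le_rfl

/-- Heights less than 1 apart have equal or adjacent integer parts, so the shadows differ by at most
one vertical step. -/
lemma IsCoarseRetraction.of_base_eq (hR : M.IsCoarseRetraction c C R)
    (hG : ∀ x ∈ M.horizontal, R x (G x)) {x y : X} (hb : M.base x = M.base y)
    (hh : |M.height x - M.height y| < 1) : M.graphDist (G (M.shadow x)) (G (M.shadow y)) ≤ C := by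
  wlog hle : ⌊M.height x⌋ ≤ ⌊M.height y⌋ generalizing x y
  · rw [graphDist_comm]
    exact this hb.symm (by rwa [abs_sub_comm]) (by omega)
  have h1 : ⌊M.height y⌋ < ⌊M.height x⌋ + 2 := by
    rw [Int.floor_lt]
    push_cast
    linarith [(abs_lt.1 hh).1, Int.lt_floor_add_one (M.height x)]
  have h2 := hR.vertical hG (isBlock_of_mem_J (floor_mem_J x)) (by omega) (shadow_mem y)
  rwa [show M.base (M.shadow y) = M.base x by rw [shadow, base_pt, hb]] at h2

/-- A short chain for the tube-electrocuted metric meets at most one lift of a tube. -/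
lemma IsScale.exists_lift_of_chain (hρ : M.IsScale k c ρ) {p : ℕ → X} {n : ℕ}
    (h : ∑ i ∈ Finset.range n,
      electricStep (fun x y => edist x y) 0 M.horizontalCircles (p i) (p (i + 1)) < ρ) :
    |M.height (p 0) - M.height (p n)| ≤ 1 / 4 ∧ (edist (p 0) (p n) < ρ ∨
      ∃ T ∈ M.tubes, ∃ γ ∈ Γ, ∃ u ∈ M.region (T.lift γ) T.interval,
        ∃ v ∈ M.region (T.lift γ) T.interval, edist (p 0) u < ρ ∧ edist v (p n) < ρ) := by
  set s := fun i => electricStep (fun x y => edist x y) 0 M.horizontalCircles (p i) (p (i + 1))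
    with hs
  -- Free jumps are along horizontal circles and leave the height unchanged, so only the metric
  -- steps count.
  have hh : edist (M.height (p 0)) (M.height (p n)) ≤ k * ∑ i ∈ Finset.range n, s i := by
    refine (edist_le_range_sum_edist (fun i => M.height (p i)) n).trans ?_
    rw [Finset.mul_sum]
    refine Finset.sum_le_sum fun i _ => ?_
    rcases electricStep_cases (d := fun x y => edist x y) (w := 0) (H := M.horizontalCircles) (p i)
      (p (i + 1)) with e | ⟨-, A, ⟨T, -, γ, -, t, -, rfl⟩, h1, h2⟩
    · rw [hs]; simp only; rw [e]
      exact hρ.lipschitz _ _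
    · rw [show M.height (p i) = t from h1.2, show M.height (p (i + 1)) = t from h2.2, edist_self]
      exact bot_le
  constructor
  · have h1 := hh.trans (mul_le_mul_right h.le _)
    rw [edist_nndist] at h1
    have h2 : nndist (M.height (p 0)) (M.height (p n)) ≤ 1 / 4 :=
      le_trans (by exact_mod_cast h1) hρ.small
    rw [← Real.dist_eq]
    exact_mod_cast h2
  clear hh
  -- Before the first circle and after the last one the chain is an ordinary short path; `u` is
  -- where the first circle is entered and `v` where the last one is left.
  have key : ∀ m ≤ n, edist (p 0) (p m) ≤ ∑ i ∈ Finset.range m, s i ∨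
      ∃ T ∈ M.tubes, ∃ γ ∈ Γ, ∃ u ∈ M.region (T.lift γ) T.interval,
        ∃ v ∈ M.region (T.lift γ) T.interval, edist (p 0) u ≤ ∑ i ∈ Finset.range m, s i ∧
          edist v (p m) ≤ ∑ i ∈ Finset.range m, s i := by
    intro m
    induction m with
    | zero => exact fun _ => Or.inl (by simp)
    | succ m ih =>
      intro hm
      have hlt : ∑ i ∈ Finset.range m, s i < ρ :=
        (Finset.sum_le_sum_of_subset (Finset.range_mono (by omega))).trans_lt h
      have hcircle : ∀ (T : Tube) (γ : SL(2, ℝ)) (t : ℝ), t ∈ T.interval → ∀ q ∈ M.region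
          (T.lift γ) {t},
          q ∈ M.region (T.lift γ) T.interval := fun T γ t ht q hq =>
        ⟨hq.1, by rw [show M.height q = t from hq.2]; exact ht⟩
      rw [Finset.sum_range_succ]
      rcases electricStep_cases (d := fun x y => edist x y) (w := 0) (H := M.horizontalCircles)
          (p m)
        (p (m + 1)) with e | ⟨-, A, ⟨T, hT, γ, hγ, t, ht, rfl⟩, h1, h2⟩
      · have e' : s m = edist (p m) (p (m + 1)) := e
        rcases ih (by omega) with h1 | ⟨T, hT, γ, hγ, u, hu, v, hv, h1, h2⟩
        · left
          rw [e']
          exact (edist_triangle _ (p m) _).trans (add_le_add h1 le_rfl)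
        · right
          refine ⟨T, hT, γ, hγ, u, hu, v, hv, h1.trans le_self_add, ?_⟩
          rw [e']
          exact (edist_triangle _ (p m) _).trans (add_le_add h2 le_rfl)
      · right
        rcases ih (by omega) with h3 | ⟨T', hT', γ', hγ', u, hu, v, hv, h3, h4⟩
        · exact ⟨T, hT, γ, hγ, p m, hcircle T γ t ht _ h1, p (m + 1), hcircle T γ t ht _ h2,
            h3.trans le_self_add, by rw [edist_self]; exact bot_le⟩
        -- The metric cost between two successive circles is below `ρ`, so they belong to the same
        -- lift of the same tube.
        · obtain ⟨rfl, e⟩ := hρ.lift T' hT' T hT γ' hγ' γ hγ v hv (p m) (hcircle T γ t ht _ h1)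
            (h4.trans_lt hlt)
          exact ⟨T', hT', γ', hγ', u, hu, p (m + 1), e ▸ hcircle T' γ t ht _ h2,
            h3.trans le_self_add, by rw [edist_self]; exact bot_le⟩
  rcases key n le_rfl with h1 | ⟨T, hT, γ, hγ, u, hu, v, hv, h1, h2⟩
  · exact Or.inl (h1.trans_lt h)
  · exact Or.inr ⟨T, hT, γ, hγ, u, hu, v, hv, h1.trans_lt h, h2.trans_lt h⟩

lemma IsCoarseRetraction.of_short_chain (hR : M.IsCoarseRetraction c C R)
    (hM : M.IsWeakSplitGeometry) (hG : ∀ x ∈ M.horizontal, R x (G x)) (hρ : M.IsScale k c ρ)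
    {p : ℕ → X} {n : ℕ} (h : ∑ i ∈ Finset.range n,
      electricStep (fun x y => edist x y) 0 M.horizontalCircles (p i) (p (i + 1)) < ρ) :
    M.graphDist (G (M.shadow (p 0))) (G (M.shadow (p n))) ≤ 20 * C := by
  obtain ⟨hh, h1 | ⟨T, hT, γ, hγ, u, hu, v, hv, h1, h2⟩⟩ := hρ.exists_lift_of_chain h
  · refine (hR.of_edist_lt hM hG hρ h1).trans ?_
    gcongr
    norm_num
  · have e1 := hR.of_edist_lt hM hG hρ h1
    have e4 := hR.of_edist_lt hM hG hρ h2
    -- From `u` one moves along the horizontal circle to the point over `v`, then vertically to `v`;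
    -- the heights differ by at most 3/4. The total is `9C + C + C + 9C`.
    have hJ := height_mem (M := M) u
    have e2 : M.graphDist (G (M.shadow u)) (G (M.shadow (M.pt (M.height u) (M.base v)))) ≤ C :=
      hR.of_circle hM hG ⟨T, hT, γ, hγ, _, hu.2, rfl⟩ ⟨hu.1, rfl⟩
        ⟨by rw [base_pt]; exact hv.1, height_pt hJ _⟩
    have e3 : M.graphDist (G (M.shadow (M.pt (M.height u) (M.base v)))) (G (M.shadow v)) ≤ C := by
      refine hR.of_base_eq hG (base_pt _ _) ?_
      rw [height_pt hJ]
      have f1 := abs_le.1 (hρ.abs_height_sub_le h1)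
      have f2 := abs_le.1 (hρ.abs_height_sub_le h2)
      have f3 := abs_le.1 hh
      rw [abs_lt]
      constructor <;> linarith [f1.1, f1.2, f2.1, f2.2, f3.1, f3.2]
    refine (graphDist_triangle _ _ _).trans ((add_le_add e1 ((graphDist_triangle _ _ _).trans
      (add_le_add e2 ((graphDist_triangle _ _ _).trans (add_le_add e3 e4))))).trans (le_of_eq ?_))
    ring

lemma IsScale.exists_bound_telDist (hM : M.IsWeakSplitGeometry) (hρ : M.IsScale k c ρ) (C : ℝ≥0) :
    ∃ B : ℝ≥0, ∀ (R : X → X → Prop) (G : X → X), M.IsCoarseRetraction c C R →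
      (∀ x ∈ M.horizontal, R x (G x)) → ∀ x y,
      M.graphDist (G (M.shadow x)) (G (M.shadow y)) ≤ B * (M.telDist x y + 1) := by
  obtain ⟨B, hB⟩ := hρ.exists_bound_edist hM C
  refine ⟨20 * C + B + 2 * (20 * C + B) / ρ + (20 * C + B), fun R G hR hG x y =>
    le_linear_of_le ?_⟩
  have hlt : M.telDist x y < M.telDist x y + 1 := ENNReal.lt_add_right
    (ne_top_of_le_ne_top (edist_ne_top x y) electrocute_le) one_ne_zero
  obtain ⟨n, p, rfl, rfl, hp⟩ := exists_chain_of_electrocute_lt hlt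
  refine (coarse_chain (D := fun x y => M.graphDist (G (M.shadow x)) (G (M.shadow y)))
    (fun _ => graphDist_self _) (fun _ _ _ => graphDist_triangle _ _ _) hρ.pos
    (s := fun i => electricStep (fun x y => edist x y) 0 M.horizontalCircles (p i) (p (i + 1)))
    (B := 20 * C + B) (fun i j hij _ h => ?_) fun i hi => ?_).trans ?_
  · rw [Finset.sum_Ico_eq_sum_range] at h
    have := hR.of_short_chain hM hG hρ (p := fun m => p (i + m)) h
    simp only [add_zero, Nat.add_sub_cancel' hij] at this
    refine this.trans ?_
    push_cast
    exact le_self_add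
  · rcases electricStep_cases (d := fun x y => edist x y) (w := 0) (H := M.horizontalCircles) (p i)
      (p (i + 1)) with e | ⟨-, A, hA, h1, h2⟩
    · simp only [e]
      refine (hB R G hR hG _ _).trans (mul_le_mul_left ?_ _)
      push_cast
      exact le_add_self
    · refine (hR.of_circle hM hG hA h1 h2).trans (le_trans ?_
        (le_mul_of_one_le_right bot_le le_add_self))
      have : C ≤ 20 * C + B := (le_mul_of_one_le_left bot_le (by norm_num)).trans le_self_add
      exact_mod_cast this
  · exact add_le_add (mul_le_mul_right hp.le _) le_rfl

lemma telDist_triangle (p q r : X) : M.telDist p r ≤ M.telDist p q + M.telDist q r :=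
  electrocute_triangle

lemma IsScale.exists_bound_graphDist (hM : M.IsWeakSplitGeometry) (hρ : M.IsScale k c ρ)
    (C : ℝ≥0) :
    ∃ B : ℝ≥0, ∀ (R : X → X → Prop) (G : X → X), M.IsCoarseRetraction c C R →
      (∀ x ∈ M.horizontal, R x (G x)) → ∀ x y,
      M.graphDist (G (M.shadow x)) (G (M.shadow y)) ≤ B * (M.graphDist x y + 1) := by
  obtain ⟨B, hB⟩ := hρ.exists_bound_telDist hM C
  refine ⟨B * 2 + C + 2 * (B * 2 + C) / 1 + (B * 2 + C), fun R G hR hG x y =>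
    le_linear_of_le ?_⟩
  have hlt : M.graphDist x y < M.graphDist x y + 1 := ENNReal.lt_add_right
    (ne_top_of_le_ne_top (edist_ne_top x y) (graphDist_le_edist x y)) one_ne_zero
  obtain ⟨n, p, rfl, rfl, hp⟩ := exists_chain_of_electrocute_lt hlt
  refine (coarse_chain (D := fun x y => M.graphDist (G (M.shadow x)) (G (M.shadow y)))
    (fun _ => graphDist_self _) (fun _ _ _ => graphDist_triangle _ _ _) one_pos
    (s := fun i => electricStep M.telDist 2 M.splitComponents (p i) (p (i + 1)))
    (B := B * 2 + C) (fun i j hij _ h => ?_) fun i hi => ?_).trans ?_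
  -- Stretches of cost less than 1 contain no passage through a split component, whose price is 2,
  -- so they are chains for the tube-electrocuted metric.
  · have hstep : ∀ m ∈ Finset.Ico i j, electricStep M.telDist 2 M.splitComponents (p m) (p (m + 1))
      =
        M.telDist (p m) (p (m + 1)) := by
      intro m hm
      refine (electricStep_cases _ _).resolve_right fun h2 => ?_
      have h3 := (Finset.single_le_sum
        (f := fun i => electricStep M.telDist 2 M.splitComponents (p i) (p (i + 1)))
        (fun _ _ => bot_le) hm).trans_lt h
      simp only [h2.1, ENNReal.coe_one] at h3
      exact absurd h3 (by norm_num)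
    rw [Finset.sum_congr rfl hstep] at h
    have htel : M.telDist (p i) (p j) ≤ ∑ m ∈ Finset.Ico i j, M.telDist (p m) (p (m + 1)) := by
      clear h hstep
      induction j, hij using Nat.le_induction with
      | base =>
        rw [Finset.Ico_self, Finset.sum_empty]
        exact electrocute_le.trans (edist_self _).le
      | succ j hij ih =>
        rw [Finset.sum_Ico_succ_top hij]
        exact (telDist_triangle _ (p j) _).trans (add_le_add (ih (by omega)) le_rfl)
    refine (hB R G hR hG _ _).trans ?_
    have h1 : M.telDist (p i) (p j) + 1 ≤ 2 := by
      calc M.telDist (p i) (p j) + 1 ≤ 1 + 1 := add_le_add (htel.trans (by simpa using h.le)) le_rfl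
        _ = 2 := one_add_one_eq_two
    refine (mul_le_mul_right h1 _).trans ?_
    push_cast
    exact le_self_add
  · have hB2 : B ≤ B * 2 + C := (le_mul_of_one_le_right bot_le (by norm_num)).trans le_self_add
    rcases electricStep_cases (d := M.telDist) (w := 2) (H := M.splitComponents) (p i)
      (p (i + 1)) with e | ⟨-, A, ⟨m, hm, A', hA', rfl⟩, h1, h2⟩
    · simp only [e]
      exact (hB R G hR hG _ _).trans (mul_le_mul_left (by exact_mod_cast hB2) _)
    · refine (hR.of_component hG hm ⟨A', hA', h1.1, h2.1⟩ h1.2 h2.2).trans (le_trans ?_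
        (le_mul_of_one_le_right bot_le le_add_self))
      have : C ≤ B * 2 + C := le_add_self
      exact_mod_cast this
  · exact add_le_add (mul_le_mul_right hp.le _) le_rfl

end MarkedModel

end

theorem theorem5p3 {Γ : Subgroup SL(2, ℝ)} (hΓ : IsClosedSurfaceGroup Γ)
    {X : Type*} [MetricSpace X] (M : MarkedModel Γ X) (hM : M.IsWeakSplitGeometry) :
    ∃ C : ℝ≥0, 0 < C ∧
      ∀ (a b : X) (lam : Set X), a ∈ M.sheet 0 → b ∈ M.sheet 0 →
        IsGeodesicSegment (M.sheetDist 0) lam a b →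
        (∃ L : ℤ → ℤ → Set X, M.IsLadder lam a b L) ∧
        ∀ L : ℤ → ℤ → Set X, M.IsLadder lam a b L →
          (∀ x ∈ M.horizontal, ∃ p, M.IsProjection L x p) ∧
          ∀ x y p q : X, M.IsProjection L x p → M.IsProjection L y q →
            M.graphDist p q ≤ C * M.graphDist x y + C := by
  obtain ⟨k, c, ρ, hρ⟩ := hM.exists_isScale
  obtain ⟨C, hC⟩ := hM.exists_isCoarseRetraction c
  obtain ⟨B, hB⟩ := hρ.exists_bound_graphDist hM C
  -- The term `2 * C` pays for replacing the two given values by those of one fixed selection `G`;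
  -- the 1 only secures positivity.
  refine ⟨B + 2 * C + 1, by positivity, fun a b lam ha hb hlam =>
    ⟨MarkedModel.exists_isLadder hM ha hb hlam, fun L hL => ⟨fun x hx => hL.exists_projection hM
        hx, fun x y p q hp hq => ?_⟩⟩⟩
  have hR := hC a b lam L hL
  have hex : ∀ x, ∃ p, x ∈ M.horizontal → M.IsProjection L x p := by
    intro x
    by_cases hx : x ∈ M.horizontal
    · obtain ⟨p, hp⟩ := hL.exists_projection hM hx
      exact ⟨p, fun _ => hp⟩
    · exact ⟨x, fun h => absurd h hx⟩
  choose G hG using hex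
  have hself : ∀ x p, M.IsProjection L x p → M.graphDist p (G x) ≤ C ∧ M.shadow x = x := by
    intro x p hp
    obtain ⟨i, n, hi, hni, hx, -⟩ := id hp
    refine ⟨hR.sheet n x hx x hx p _ hp (hG x ⟨n, hx⟩) (hρ.sheet n x hx x hx ?_),
      MarkedModel.shadow_of_mem_sheet hx⟩
    rw [edist_self]
    exact_mod_cast hρ.pos
  obtain ⟨h1, e1⟩ := hself x p hp
  obtain ⟨h2, e2⟩ := hself y q hq
  have h3 := hB _ G hR hG x y
  rw [e1, e2] at h3
  rw [MarkedModel.graphDist_comm] at h2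
  refine (MarkedModel.graphDist_triangle _ _ _).trans ((add_le_add h1
    ((MarkedModel.graphDist_triangle _ _ _).trans (add_le_add h3 h2))).trans ?_)
  push_cast
  calc (C + (B * (M.graphDist x y + 1) + C) : ℝ≥0∞) = B * M.graphDist x y + (B + 2 * C) := by ring
    _ ≤ (B + 2 * C + 1) * M.graphDist x y + (B + 2 * C + 1) :=
      add_le_add (mul_le_mul_left (by rw [add_assoc]; exact le_self_add) _) le_self_add
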